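/- **Model.** A supply chain has processors $I_j=[a_j,b_j]$, $j=1,\dots,P$ ($P\ge 1$), with $b_{j-1}=a_j$, maximal processing rates $\mu_j>0$, processing times $T_j>0$ and velocities $v_j=(b_j-a_j)/T_j$, and queues $q_j$, $j=2,\dots,P$. With $f_j(\rho)=\min\{\mu_j,v_j\rho\}$, densities and queues satisfy, for $t\in[0,T]$, $$\partial_t\rho_j+\partial_x f_j(\rho_j)=0,\quad \rho_j(x,0)=\rho_{j,0}(x),\quad \rho_j(a_j,t)=f_{j,inc}(t)/v_j,$$ $$\dot q_j=f_{j-1}(\rho_{j-1}(b_{j-1},t))-f_{j,inc}(t),\quad q_j(0)=q_{j,0}\ (j\ge2),$$ where $f_{1,inc}=u$ and, for $j\ge 2$, $f_{j,inc}=\min\{f_{j-1}(\rho_{j-1}(b_{j-1},t)),\mu_j\}$ if $q_j(t)=0$, $f_{j,inc}=\mu_j$ if $q_j(t)>0$. Solutions are bounded nonnegative entropy weak solutions, BV in $x$, with $q_j\ge0$. The data $\rho_{j,0}\ge0$ are piecewise constant with $v_j\rho_{j,0}\le\mu_j$, and $q_{j,0}\ge 0$. The cost is $$J(u)=\sum_{j=2}^P\int_0^T\alpha_1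 q_j\,dt+\int_0^T\alpha_2(t)\,[v_P\rho_P(b_P,t)-\psi(t)]^2dt ,$$ with $\alpha_1\in L^1$, $\alpha_2,\psi$ Lipschitz on $(0,T)$, all nonnegative. **Control and displacement.** Let $u$ be piecewise constant with values in $[0,\mu_1]$ and discontinuity points $0<\tau_1<\dots<\tau_\delta<T$. Let $\xi\in\mathbb R^\delta$, and let $u_\varepsilon$ be $u$ with discontinuity points moved to $\tau_k+\varepsilon\xi_k$. **Shifts.** Every discontinuity of $\rho_j$ carries a shift $\xi_j$, constant while it travels through $I_j$, and every queue a piecewise constant shift $\eta_j(t)$. Initially $\eta_j=0$; discontinuities issuing from the initial densities, or leaving $a_j$ at time $0$, have shift $0$; the one entering $I_1$ at $\tau_k$ has shift $v_1\xi_k$. For $j\ge2$, shifts change at the times $t\in(0,T)$ of the following interactions, where $\rho_{j-1}^{\mp}$ are the densities at $b_{j-1}$ and $\eta_j^{\mp}$ the queue shifts just before/after $t$, and $\xi_j$ is the shift of the wave leaving into $I_j$: * a wave meets queue $j$ with $q_j=0$ and $v_{j-1}\rho_{j-1}^+\le\mu_j$: $\xi_j=\frac{v_j}{v_{j-1}}\xi_{j-1}$,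 $\eta_j^+=0$; * a wave meets queue $j$ with $q_j=0$ and $v_{j-1}\rho_{j-1}^+>\mu_j$: $\xi_j=\frac{v_j}{v_{j-1}}\xi_{j-1}$, $\eta_j^+=\eta_j^--\xi_{j-1}\frac{v_{j-1}\rho_{j-1}^+-\mu_j}{v_{j-1}}$; * a wave meets queue $j$ with $q_j>0$: $\xi_j=0$, $\eta_j^+=\eta_j^-+\xi_{j-1}(\rho_{j-1}^--\rho_{j-1}^+)$; * queue $j$ empties: $\eta_j^+=0$, $\xi_j=-\dfrac{v_j\eta_j^-}{v_{j-1}\rho_{j-1}^--\mu_j}$. **Proposition.** For all $\varepsilon$ near $0$ the model has a solution for the control $u_\varepsilon$. Assume that, for the solution with control $u$, no wave reaches a queue at the very time in $(0,T)$ when that queue empties, and no wave that entered the last processor at a positive time reaches $b_P$ exactly at time $T$. Then only finitely many discontinuities $\beta$ of $\rho_P$ reach $b_P$ at times $t^\beta\in(0,T)$, shifts obeying the above rules exist, and $\varepsilon\mapsto J(u_\varepsilon)$ (computed with any solutions for the controls $u_\varepsilon$) is differentiable at $\varepsilon=0$ with $$\nabla_\xi J(u)=\frac{d}{d\varepsilon}J(u_\varepsilon)\Big|_{\varepsilon=0}=\sum_{j=2}^P\int_0^T\alpha_1(t)\eta_j(t)\,dt+\sum_\beta\alpha_2(t^\beta)\Big(v_P\big({}^\beta\rho_P^++{}^\beta\rho_P^-\big)-2\psi(t^\beta)\Big)\,{}^\beta\xi_P\,\Delta({}^\beta\rho_P),$$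 where in this formula ${}^\beta\rho_P^{+}$, ${}^\beta\rho_P^-$ are the values of $\rho_P$ on the right and on the left of $\beta$ (in $x$), and $\Delta({}^\beta\rho_P)={}^\beta\rho_P^+-{}^\beta\rho_P^-$. -/

import Mathlib

open Set Filter Topology MeasureTheory

noncomputable section

namespace SupplyChain

/-- A supply chain with processors `I_j = [a j, b j]`, `j = 1, …, P`, and a queue in front of every
processor except the first. `μ j` is the maximal processing rate and `procTime j` the processing
time of processor `j`. Values at indices outside `1, …, P` are never used. -/
structure Chain where
  P : ℕ
  one_le_P : 1 ≤ P
  a : ℕ → ℝ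
  b : ℕ → ℝ
  μ : ℕ → ℝ
  procTime : ℕ → ℝ
  a_lt_b : ∀ j ∈ Finset.Icc 1 P, a j < b j
  adjacent : ∀ j ∈ Finset.Icc 2 P, b (j - 1) = a j
  μ_pos : ∀ j ∈ Finset.Icc 1 P, 0 < μ j
  procTime_pos : ∀ j ∈ Finset.Icc 1 P, 0 < procTime j

/-- Processing velocity `v_j = L_j / T_j`. -/
def Chain.v (C : Chain) (j : ℕ) : ℝ := (C.b j - C.a j) / C.procTime j

/-- Flux of processor `j`. -/
def Chain.flux (C : Chain) (j : ℕ) (r : ℝ) : ℝ := min (C.μ j) (C.v j * r)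

/-- Piecewise constant on the open interval `(a, b)`, with finitely many break points. -/
def IsPiecewiseConstant (f : ℝ → ℝ) (a b : ℝ) : Prop :=
  ∃ D : Finset ℝ, ∀ x y : ℝ, a < x → x ≤ y → y < b → (∀ z ∈ D, z ∉ Icc x y) → f x = f y

/-- Initial densities and initial queue lengths. -/
structure InitialData where
  ρ₀ : ℕ → ℝ → ℝ
  q₀ : ℕ → ℝ

/-- Admissible initial data: nonnegative piecewise constant densities for which the processors
work below capacity, and nonnegative queues. -/
structure InitialData.Admissible (D : InitialData) (C : Chain) : Prop where
  pc : ∀ j ∈ Finset.Icc 1 C.P, IsPiecewiseConstant (D.ρ₀ j) (C.a j) (C.b j)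
  nonneg : ∀ j ∈ Finset.Icc 1 C.P, ∀ x ∈ Ioo (C.a j) (C.b j), 0 ≤ D.ρ₀ j x
  below : ∀ j ∈ Finset.Icc 1 C.P, ∀ x ∈ Ioo (C.a j) (C.b j), C.v j * D.ρ₀ j x ≤ C.μ j
  queue_nonneg : ∀ j ∈ Finset.Icc 2 C.P, 0 ≤ D.q₀ j

/-! ### Piecewise constant controls and their displacements -/

/-- The nodes `0 = τ_0, τ_1, …, τ_δ, τ_{δ+1} = T`. -/
def nodes (T : ℝ) {δ : ℕ} (τ : Fin δ → ℝ) : Fin (δ + 2) → ℝ :=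
  Fin.cons 0 (Fin.snoc τ T : Fin (δ + 1) → ℝ)

/-- The control `∑_k χ_{[τ_k, τ_{k+1}[} c_k`. -/
def pcControl (T : ℝ) {δ : ℕ} (τ : Fin δ → ℝ) (c : Fin (δ + 1) → ℝ) (t : ℝ) : ℝ :=
  ∑ k : Fin (δ + 1), (Ico (nodes T τ k.castSucc) (nodes T τ k.succ)).indicator (fun _ => c k) t

/-- `τ` lists the discontinuity points, all in `(0, T)`, of the control `pcControl T τ c`, which
takes values in `[0, μ_1]`. -/
structure IsPCControl (C : Chain) (T : ℝ) {δ : ℕ} (τ : Fin δ → ℝ) (c : Fin (δ + 1) → ℝ) :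
    Prop where
  strictMono : StrictMono τ
  mem : ∀ k, τ k ∈ Ioo 0 T
  jump : ∀ k : Fin δ, c k.castSucc ≠ c k.succ
  range : ∀ k, c k ∈ Icc 0 (C.μ 1)

/-- The control with discontinuity points shifted by `ε ξ`. -/
def shiftedControl (T : ℝ) {δ : ℕ} (τ : Fin δ → ℝ) (c : Fin (δ + 1) → ℝ) (ξ : Fin δ → ℝ) (ε : ℝ) :
    ℝ → ℝ :=
  pcControl T (fun k => τ k + ε * ξ k) c

/-! ### The coupled PDE-ODE system -/

/-- Densities `ρ j x t` and queues `q j t`. -/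
structure State where
  ρ : ℕ → ℝ → ℝ → ℝ
  q : ℕ → ℝ → ℝ

/-- The trace `ρ_j(b_j, t)`. -/
def State.outDensity (S : State) (C : Chain) (j : ℕ) (t : ℝ) : ℝ :=
  Function.leftLim (fun x => S.ρ j x t) (C.b j)

/-- The outgoing flux `f_j(ρ_j(b_j, t))`. -/
def State.outFlux (S : State) (C : Chain) (j : ℕ) (t : ℝ) : ℝ :=
  C.flux j (S.outDensity C j t)

/-- The incoming flux `f_{j,inc}(t)`. -/
def State.inFlux (S : State) (C : Chain) (u : ℝ → ℝ) (j : ℕ) (t : ℝ) : ℝ :=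
  if j = 1 then u t
  else if S.q j t = 0 then min (S.outFlux C (j - 1) t) (C.μ j)
  else C.μ j

/-- `C¹` test functions of `(x, t)` with compact support in `{x < b, t < T}`. -/
structure IsTest (φ : ℝ × ℝ → ℝ) (b T : ℝ) : Prop where
  contDiff : ContDiff ℝ 1 φ
  compact : HasCompactSupport φ
  support : tsupport φ ⊆ {p | p.1 < b ∧ p.2 < T}

def dx (φ : ℝ × ℝ → ℝ) (p : ℝ × ℝ) : ℝ := fderiv ℝ φ p (1, 0)

def dt (φ : ℝ × ℝ → ℝ) (p : ℝ × ℝ) : ℝ := fderiv ℝ φ p (0, 1)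

/-- `r` solves `∂_t r + ∂_x f(r) = 0` on `(a, b) × (0, T)` in the weak sense with initial datum `r₀`
and inflow boundary datum `rin` at `x = a`, and it is a Kruzhkov entropy solution. -/
structure IsEntropySolution (f : ℝ → ℝ) (a b T : ℝ) (r₀ rin : ℝ → ℝ) (r : ℝ → ℝ → ℝ) : Prop where
  measurable : AEStronglyMeasurable (fun p : ℝ × ℝ => r p.1 p.2)
    (volume.restrict (Ioo a b ×ˢ Ioo 0 T))
  bounded : ∃ M : ℝ, ∀ᵐ p : ℝ × ℝ ∂(volume.restrict (Ioo a b ×ˢ Ioo 0 T)), r p.1 p.2 ∈ Icc 0 M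
  bv : ∀ᵐ t ∂(volume.restrict (Ioo 0 T)), BoundedVariationOn (fun x => r x t) (Ioo a b)
  weak : ∀ φ : ℝ × ℝ → ℝ, IsTest φ b T →
    (∫ p in Ioo a b ×ˢ Ioo 0 T, (r p.1 p.2 * dt φ p + f (r p.1 p.2) * dx φ p))
      + (∫ x in Ioo a b, r₀ x * φ (x, 0)) + (∫ t in Ioo 0 T, f (rin t) * φ (a, t)) = 0
  entropy : ∀ (k : ℝ) (φ : ℝ × ℝ → ℝ), IsTest φ b T → tsupport φ ⊆ {p | a < p.1} → (∀ p, 0 ≤ φ p) →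
    0 ≤ (∫ p in Ioo a b ×ˢ Ioo 0 T,
          (|r p.1 p.2 - k| * dt φ p + Real.sign (r p.1 p.2 - k) * (f (r p.1 p.2) - f k) * dx φ p))
      + ∫ x in Ioo a b, |r₀ x - k| * φ (x, 0)

/-- `S` is a solution on `[0, T]` of the supply chain model with initial data `D` and control `u`. -/
structure IsSolution (C : Chain) (D : InitialData) (T : ℝ) (u : ℝ → ℝ) (S : State) : Prop where
  density : ∀ j ∈ Finset.Icc 1 C.P,
    IsEntropySolution (C.flux j) (C.a j) (C.b j) T (D.ρ₀ j)
      (fun t => S.inFlux C u j t / C.v j) (S.ρ j)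
  queue_integrable : ∀ j ∈ Finset.Icc 2 C.P, IntervalIntegrable
    (fun s => S.outFlux C (j - 1) s - S.inFlux C u j s) volume 0 T
  queue_nonneg : ∀ j ∈ Finset.Icc 2 C.P, ∀ t ∈ Icc 0 T, 0 ≤ S.q j t
  queue : ∀ j ∈ Finset.Icc 2 C.P, ∀ t ∈ Icc 0 T,
    S.q j t = D.q₀ j + ∫ s in (0)..t, (S.outFlux C (j - 1) s - S.inFlux C u j s)

/-! ### The cost functional -/

structure Weights where
  α₁ : ℝ → ℝ
  α₂ : ℝ → ℝ
  ψ : ℝ → ℝ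

structure Weights.Admissible (W : Weights) (T : ℝ) : Prop where
  α₁_integrable : IntegrableOn W.α₁ (Ioo 0 T)
  α₂_lipschitz : ∃ K, LipschitzOnWith K W.α₂ (Ioo 0 T)
  ψ_lipschitz : ∃ K, LipschitzOnWith K W.ψ (Ioo 0 T)
  α₁_nonneg : ∀ t ∈ Ioo 0 T, 0 ≤ W.α₁ t
  α₂_nonneg : ∀ t ∈ Ioo 0 T, 0 ≤ W.α₂ t
  ψ_nonneg : ∀ t ∈ Ioo 0 T, 0 ≤ W.ψ t

/-- The cost of the solution `S`: if `S` solves the model for the control `u`, this is `J(u)`. -/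
def cost (C : Chain) (T : ℝ) (W : Weights) (S : State) : ℝ :=
  (∑ j ∈ Finset.Icc 2 C.P, ∫ t in (0)..T, W.α₁ t * S.q j t)
    + ∫ t in (0)..T, W.α₂ t * (C.v C.P * S.outDensity C C.P t - W.ψ t) ^ 2

/-! ### Evolution of the tangent vectors -/

/-- Essential limit from the left: null sets of times are disregarded, since traces of a solution
are determined for almost every time only. -/
def essLeft (f : ℝ → ℝ) (t : ℝ) : ℝ := limUnder (𝓝[<] t ⊓ ae volume) f

/-- Essential limit from the right. -/
def essRight (f : ℝ → ℝ) (t : ℝ) : ℝ := limUnder (𝓝[>] t ⊓ ae volume) f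

/-- The queue `q` empties at time `t`. -/
def Empties (q : ℝ → ℝ) (t : ℝ) : Prop := q t = 0 ∧ ∀ᶠ s in 𝓝[<] t, 0 < q s

/-- The change of shifts at queue `j` at time `t`. Here `ρm`, `ρp` are the densities at the end of
processor `j - 1` before and after `t`; `ξin` is the shift of the density wave arriving at the
queue, if `ρm ≠ ρp`; `ηm`, `ηp` are the queue shifts before and after `t`; `ξout` is the shift of
the wave that leaves the queue into processor `j`. -/
structure InteractionRule (C : Chain) (j : ℕ) (q : ℝ → ℝ) (t ρm ρp ξin ηm ηp ξout : ℝ) :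
    Prop where
  /-- no interaction -/
  none : ρm = ρp → ¬ Empties q t → ηp = ηm ∧ ξout = 0
  /-- a wave meets an empty queue, which stays empty -/
  wave_empty_below : ρm ≠ ρp → ¬ Empties q t → q t = 0 → C.v (j - 1) * ρp ≤ C.μ j →
    ξout = C.v j / C.v (j - 1) * ξin ∧ ηp = 0
  /-- a wave meets an empty queue, which starts to fill -/
  wave_empty_above : ρm ≠ ρp → ¬ Empties q t → q t = 0 → C.μ j < C.v (j - 1) * ρp →
    ξout = C.v j / C.v (j - 1) * ξin ∧
      ηp = ηm - ξin * (C.v (j - 1) * ρp - C.μ j) / C.v (j - 1)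
  /-- a wave meets a nonempty queue -/
  wave_nonempty : ρm ≠ ρp → 0 < q t → ξout = 0 ∧ ηp = ηm + ξin * (ρm - ρp)
  /-- the queue empties -/
  emptying : Empties q t → ηp = 0 ∧ ξout = - (C.v j * ηm) / (C.v (j - 1) * ρm - C.μ j)

/-- Shifts of density waves and queues. A wave of processor `j` is labelled by the time `s` at
which it leaves `a j`, so that it reaches `b j` at time `s + procTime j`; `ξ j s` is its shift, the
same along the whole processor, and waves issuing from the initial density have labels `s ≤ 0`.
`η j t` is the shift of the queue `q j` at time `t`. -/
structure Shifts where
  ξ : ℕ → ℝ → ℝ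
  η : ℕ → ℝ → ℝ

/-- `Z` is the tangent vector along the solution `S` that is generated by the tangent vector `ξ` to
the control with discontinuity points `τ`. -/
structure IsTangentEvolution (C : Chain) (T : ℝ) {δ : ℕ} (τ ξ : Fin δ → ℝ) (S : State)
    (Z : Shifts) : Prop where
  initial_wave : ∀ j ∈ Finset.Icc 1 C.P, ∀ s ≤ 0, Z.ξ j s = 0
  control_wave : ∀ k, Z.ξ 1 (τ k) = C.v 1 * ξ k
  initial_queue : ∀ j ∈ Finset.Icc 2 C.P, Z.η j 0 = 0 ∧ ∀ᶠ s in 𝓝[>] 0, Z.η j s = 0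
  evolution : ∀ j ∈ Finset.Icc 2 C.P, ∀ t ∈ Ioo 0 T, ∃ ηm : ℝ,
    (∀ᶠ s in 𝓝[<] t, Z.η j s = ηm) ∧ (∀ᶠ s in 𝓝[>] t, Z.η j s = Z.η j t) ∧
    InteractionRule C j (S.q j) t
      (essLeft (S.outDensity C (j - 1)) t) (essRight (S.outDensity C (j - 1)) t)
      (Z.ξ (j - 1) (t - C.procTime (j - 1))) ηm (Z.η j t) (Z.ξ j t)

/-- No simultaneous interactions: no wave reaches a queue at the very moment when it empties, and no
wave that entered the last processor at a positive time reaches the outlet at the final time. -/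
structure NoSimultaneous (C : Chain) (T : ℝ) (u : ℝ → ℝ) (S : State) : Prop where
  queue : ∀ j ∈ Finset.Icc 2 C.P, ∀ t ∈ Ioo 0 T, Empties (S.q j) t →
    essLeft (S.outDensity C (j - 1)) t = essRight (S.outDensity C (j - 1)) t
  outlet : 0 < T - C.procTime C.P →
    essLeft (S.inFlux C u C.P) (T - C.procTime C.P)
      = essRight (S.inFlux C u C.P) (T - C.procTime C.P)

/-- The times in `(0, T)` at which a discontinuity of `ρ_P` reaches the outlet `b_P`. -/
def outletTimes (C : Chain) (T : ℝ) (S : State) : Set ℝ :=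
  {t | t ∈ Ioo 0 T ∧ essLeft (S.outDensity C C.P) t ≠ essRight (S.outDensity C C.P) t}

def Y₁ (C : Chain) (T : ℝ) (W : Weights) (Z : Shifts) : ℝ :=
  ∑ j ∈ Finset.Icc 2 C.P, ∫ t in (0)..T, W.α₁ t * Z.η j t

/-- Contribution to the gradient of the discontinuity reaching the outlet at time `t`. The value of
`ρ_P` on the right of the discontinuity is the one observed at the outlet before `t`, the value on
its left is the one observed after `t`. -/
def outletTerm (C : Chain) (W : Weights) (S : State) (Z : Shifts) (t : ℝ) : ℝ :=
  let ρp := essLeft (S.outDensity C C.P) t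
  let ρm := essRight (S.outDensity C C.P) t
  W.α₂ t * (C.v C.P * (ρp + ρm) - 2 * W.ψ t) * Z.ξ C.P (t - C.procTime C.P) * (ρp - ρm)

def Y₂ (C : Chain) (T : ℝ) (W : Weights) (S : State) (Z : Shifts) : ℝ :=
  ∑ᶠ t ∈ outletTimes C T S, outletTerm C W S Z t

end SupplyChain

end

noncomputable section

namespace SupplyChain

/-! ### Piecewise constant functions -/

/-! The model is a chain of delays and queues in disguise. Initial flows do not exceed the capacity,
and the entropy condition keeps every density below capacity (`IsEntropySolution.le_capacity`).
There the flux is linear, so the outflow of a processor is its inflow delayed by `procTime`,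
preceded by the initial density. A queue is the reflected (Skorokhod) integral `queueLen` of its net
input. Alternating delays and queues produces `canonicalState`, which is a solution. Conversely,
duality with test functions that follow characteristics determines the outflow trace
(`IsEntropySolution.leftLim_eq`), and a comparison argument determines the queue
(`le_of_queue_equation`); hence every solution has the canonical queues and, almost everywhere, the
canonical boundary flows (`IsSolution.eq_canonical`). The cost depends on these explicit functions
only.

For the displaced controls the flows are step functions whose jumps move affinely in `ε` (`JumpAt`),
and queue lengths are affine in `ε` near `0` (`ShiftAt`). Delays clearly preserve this structure.
`queueFamily_step` shows that queues preserve it as well, and the new velocities are those of the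
interaction rules: a jump whose arrival time moves with velocity `β` is a wave of shift `v * β`.
Excluding simultaneous interactions prevents different left and right derivatives. The admissible
range of `ε` depends on the time considered, so the structure is propagated by induction along the
time interval for each queue, and then by induction along the chain. The rules determine their
outputs, so true derivatives obey them (`WaveShift.exists_step`) and shifts obeying them are true
derivatives (`WaveShift.of_step`).

It remains to differentiate two kinds of integrals. By compactness the final outflow has finitely
many jumps, and for small `ε` it differs from the unperturbed one exactly on the intervals swept by
them (`eventually_sub_eq_sum`); each contributes the jump of the integrand times the velocity, and
the difference of squares factors into the outlet term. The queue integrals are treated by dominated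
convergence, where the bound comes from the `L¹`-Lipschitz dependence of a queue on its inflow
(`abs_queueLen_sub_le`). -/

theorem IsPiecewiseConstant.exists_factor {f : ℝ → ℝ} {a b : ℝ} (h : IsPiecewiseConstant f a b) :
    ∃ (N : ℝ → ℕ) (m : ℕ) (g : ℕ → ℝ), Monotone N ∧ (∀ x, N x ≤ m) ∧
      ∀ x ∈ Ioo a b, f x = g (N x) := by
  classical
  obtain ⟨D, hD⟩ := h
  -- Counting with both `<` and `≤` gives each break point a level of its own, separate from the
  -- intervals on either side of it.
  let N : ℝ → ℕ := fun x => (D.filter (· < x)).card + (D.filter (· ≤ x)).card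
  have hsub1 : ∀ x y, x ≤ y → D.filter (· < x) ⊆ D.filter (· < y) := fun x y hxy =>
    Finset.monotone_filter_right D fun z _ hz => lt_of_lt_of_le hz hxy
  have hsub2 : ∀ x y, x ≤ y → D.filter (· ≤ x) ⊆ D.filter (· ≤ y) := fun x y hxy =>
    Finset.monotone_filter_right D fun z _ hz => le_trans hz hxy
  have hmono : Monotone N := fun x y hxy =>
    add_le_add (Finset.card_le_card (hsub1 x y hxy)) (Finset.card_le_card (hsub2 x y hxy))
  have key : ∀ x ∈ Ioo a b, ∀ y ∈ Ioo a b, x ≤ y → N x = N y → f x = f y := by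
    intro x hx y hy hxy hN
    rcases hxy.eq_or_lt with rfl | hlt
    · rfl
    have h1 := Finset.card_le_card (hsub1 x y hxy)
    have h2 := Finset.card_le_card (hsub2 x y hxy)
    have e1 : D.filter (· < x) = D.filter (· < y) :=
      Finset.eq_of_subset_of_card_le (hsub1 x y hxy) (by simp only [N] at hN; omega)
    have e2 : D.filter (· ≤ x) = D.filter (· ≤ y) :=
      Finset.eq_of_subset_of_card_le (hsub2 x y hxy) (by simp only [N] at hN; omega)
    refine hD x y hx.1 hxy hy.2 fun z hz hzI => ?_
    have hzx : z ∈ D.filter (· ≤ x) := by rw [e2]; simp [hz, hzI.2]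
    have hzx' : z = x := le_antisymm (Finset.mem_filter.1 hzx).2 hzI.1
    have : z ∈ D.filter (· < x) := by rw [e1]; simp [hzx' ▸ hz, hzx', hlt]
    exact absurd (Finset.mem_filter.1 this).2 (by simp [hzx'])
  refine ⟨N, 2 * D.card, fun n => if h : ∃ x ∈ Ioo a b, N x = n then f h.choose else 0, hmono,
    fun x => ?_, fun x hx => ?_⟩
  · have := Finset.card_filter_le D (· < x)
    have := Finset.card_filter_le D (· ≤ x)
    simp only [N]; omega
  · have h : ∃ y ∈ Ioo a b, N y = N x := ⟨x, hx, rfl⟩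
    simp only [h, dite_true]
    obtain ⟨h1, h2⟩ := h.choose_spec
    rcases le_total x h.choose with hle | hle
    · exact key _ hx _ h1 hle h2.symm
    · exact (key _ h1 _ hx hle h2).symm

theorem IsPiecewiseConstant.exists_measurable {f : ℝ → ℝ} {a b : ℝ}
    (h : IsPiecewiseConstant f a b) :
    ∃ g : ℝ → ℝ, Measurable g ∧ (∃ M, ∀ x, |g x| ≤ M) ∧ ∀ x ∈ Ioo a b, f x = g x := by
  obtain ⟨N, m, g, hN, hm, hg⟩ := h.exists_factor
  refine ⟨fun x => g (N x), (measurable_from_top (f := g)).comp hN.measurable,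
    ⟨∑ i ∈ Finset.range (m + 1), |g i|, fun x => ?_⟩, hg⟩
  exact Finset.single_le_sum (f := fun i => |g i|) (fun i _ => abs_nonneg _)
    (Finset.mem_range.2 (Nat.lt_succ_of_le (hm x)))

/-- The function factors through a bounded monotone integer-valued map, whose variation telescopes.
Distinct integers are at distance at least one, so the bounded outer map is Lipschitz on them. -/
theorem IsPiecewiseConstant.boundedVariationOn {f : ℝ → ℝ} {a b : ℝ}
    (h : IsPiecewiseConstant f a b) : BoundedVariationOn f (Ioo a b) := by
  obtain ⟨N, m, g, hN, hm, hg⟩ := h.exists_factor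
  set M := ∑ i ∈ Finset.range (m + 1), |g i| with hM
  have hb : ∀ n ≤ m, |g n| ≤ M := fun n hn =>
    Finset.single_le_sum (f := fun i => |g i|) (fun i _ => abs_nonneg _)
      (Finset.mem_range.2 (Nat.lt_succ_of_le hn))
  have hNr : Monotone (fun x => (N x : ℝ)) := fun x y hxy => Nat.cast_le.2 (hN hxy)
  have hbv : BoundedVariationOn (fun x => (N x : ℝ)) (Ioo a b) := by
    have h1 : BoundedVariationOn (fun x => (N x : ℝ)) (Ioo a b ∩ univ) := by
      rw [inter_univ]
      have : eVariationOn (fun x => (N x : ℝ)) (Ioo a b) ≤ ENNReal.ofReal (m : ℝ) := by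
        apply iSup_le
        rintro ⟨n, u, hu, us⟩
        have : ∀ i ∈ Finset.range n, edist (N (u (i + 1)) : ℝ) (N (u i) : ℝ)
            = ENNReal.ofReal ((N (u (i + 1)) : ℝ) - (N (u i) : ℝ)) := fun i _ => by
          rw [edist_dist, Real.dist_eq, abs_of_nonneg]
          exact sub_nonneg.2 (hNr (hu (Nat.le_succ i)))
        simp only
        rw [Finset.sum_congr rfl this, ← ENNReal.ofReal_sum_of_nonneg, Finset.sum_range_sub
          (fun i => (N (u i) : ℝ))]
        · apply ENNReal.ofReal_le_ofReal
          have : (N (u n) : ℝ) ≤ m := by exact_mod_cast hm _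
          have : (0 : ℝ) ≤ N (u 0) := Nat.cast_nonneg _
          linarith
        · intro i _
          exact sub_nonneg.2 (hNr (hu (Nat.le_succ i)))
      exact ne_top_of_le_ne_top ENNReal.ofReal_ne_top this
    simpa using h1
  have hL : LipschitzOnWith (2 * M).toNNReal (fun r : ℝ => g ⌊r⌋₊)
      ((fun x => (N x : ℝ)) '' Ioo a b) := by
    apply LipschitzOnWith.of_dist_le_mul
    rintro _ ⟨x, _, rfl⟩ _ ⟨y, _, rfl⟩
    have hM0 : 0 ≤ M := (abs_nonneg _).trans (hb 0 (Nat.zero_le _))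
    simp only [Nat.floor_natCast]
    rw [Real.coe_toNNReal _ (by positivity), Real.dist_eq, Real.dist_eq]
    by_cases hxy : N x = N y
    · simp [hxy]
    have h1 : (1 : ℝ) ≤ |(N x : ℝ) - N y| := by
      have : (1 : ℤ) ≤ |(N x : ℤ) - N y| := Int.one_le_abs (by omega)
      exact_mod_cast this
    calc |g (N x) - g (N y)| ≤ |g (N x)| + |g (N y)| := abs_sub _ _
      _ ≤ 2 * M := by linarith [hb _ (hm x), hb _ (hm y)]
      _ ≤ 2 * M * |(N x : ℝ) - N y| := le_mul_of_one_le_right (by positivity) h1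
  have := hL.comp_boundedVariationOn (mapsTo_image _ _) hbv
  have he : EqOn f ((fun r : ℝ => g ⌊r⌋₊) ∘ fun x => (N x : ℝ)) (Ioo a b) := fun x hx => by
    simp [hg x hx]
  unfold BoundedVariationOn
  rw [eVariationOn.eq_of_eqOn he]
  exact this

theorem IsPiecewiseConstant.eventually_left {f : ℝ → ℝ} {a b x : ℝ}
    (h : IsPiecewiseConstant f a b) (hx : x ∈ Ioc a b) : ∃ c, ∀ᶠ y in 𝓝[<] x, f y = c := by
  classical
  obtain ⟨D, hD⟩ := h
  have h1 : ∀ᶠ y in 𝓝 x, ∀ z ∈ D.erase x, dist y x < dist z x :=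
    (Finset.eventually_all _).2 fun z hz => by
      have : 0 < dist z x := dist_pos.2 (Finset.ne_of_mem_erase hz)
      exact Metric.ball_mem_nhds x this
  have h2 : ∀ᶠ y in 𝓝[<] x, a < y ∧ y < x ∧ ∀ z ∈ D.erase x, dist y x < dist z x := by
    filter_upwards [nhdsWithin_le_nhds h1, nhdsWithin_le_nhds (Ioi_mem_nhds hx.1),
      self_mem_nhdsWithin] with y h1 h2 h3 using ⟨h2, h3, h1⟩
  obtain ⟨y₀, hy₀⟩ := h2.exists
  have key : ∀ y y', a < y → y ≤ y' → y' < x → (∀ z ∈ D.erase x, dist y x < dist z x) →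
      f y = f y' := by
    intro y y' h1 h2 h3 h4
    refine hD y y' h1 h2 (h3.trans_le hx.2) fun z hz hzI => ?_
    have hzx : z < x := hzI.2.trans_lt h3
    have := h4 z (Finset.mem_erase.2 ⟨hzx.ne, hz⟩)
    rw [Real.dist_eq, Real.dist_eq, abs_of_neg (by linarith), abs_of_neg (by linarith)] at this
    linarith [hzI.1]
  refine ⟨f y₀, h2.mono fun y hy => ?_⟩
  rcases le_total y y₀ with hle | hle
  · exact key y y₀ hy.1 hle hy₀.2.1 hy.2.2
  · exact (key y₀ y hy₀.1 hle hy.2.1 hy₀.2.2).symm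

theorem IsPiecewiseConstant.comp_neg {f : ℝ → ℝ} {a b : ℝ} (h : IsPiecewiseConstant f a b) :
    IsPiecewiseConstant (fun x => f (-x)) (-b) (-a) := by
  classical
  obtain ⟨D, hD⟩ := h
  refine ⟨D.image (fun z => -z), fun x y h1 h2 h3 h4 => ?_⟩
  refine (hD (-y) (-x) (by linarith) (by linarith) (by linarith) fun z hz hzI => ?_).symm
  exact h4 (-z) (Finset.mem_image_of_mem _ hz) ⟨by linarith [hzI.2], by linarith [hzI.1]⟩

theorem IsPiecewiseConstant.eventually_right {f : ℝ → ℝ} {a b x : ℝ}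
    (h : IsPiecewiseConstant f a b) (hx : x ∈ Ico a b) : ∃ c, ∀ᶠ y in 𝓝[>] x, f y = c := by
  obtain ⟨c, hc⟩ := h.comp_neg.eventually_left (x := -x) ⟨by linarith [hx.2], by linarith [hx.1]⟩
  refine ⟨c, ?_⟩
  have : Tendsto (fun y : ℝ => -y) (𝓝[>] x) (𝓝[<] (-x)) := by
    apply tendsto_nhdsWithin_of_tendsto_nhds_of_eventually_within
    · exact (continuous_neg.tendsto x).mono_left nhdsWithin_le_nhds
    · filter_upwards [self_mem_nhdsWithin] with y hy
      simpa using hy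
  filter_upwards [this.eventually hc] with y hy
  simpa using hy

/-- Right-continuous step functions on `[l, r)`, described by their germs. -/
structure StepOn (f : ℝ → ℝ) (l r : ℝ) : Prop where
  inner : ∀ t ∈ Ioo l r, ∃ cL cR, ∀ᶠ s in 𝓝 t, f s = if s < t then cL else cR
  left_end : ∃ c, ∀ᶠ s in 𝓝[≥] l, f s = c
  right_end : ∃ c, ∀ᶠ s in 𝓝[<] r, f s = c

theorem StepOn.exists_Ioo {f : ℝ → ℝ} {l r : ℝ} (h : StepOn f l r) {t : ℝ} (ht : t ∈ Icc l r) :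
    ∃ d > 0, (∃ c, ∀ s, l < s → s < t → t - d < s → f s = c) ∧
      ∃ c, ∀ s, t < s → s < r → s < t + d → f s = c := by
  by_cases h1 : t = l
  · subst h1
    obtain ⟨c, hc⟩ := h.left_end
    obtain ⟨u, hu, hu'⟩ := (mem_nhdsGE_iff_exists_Ico_subset).1 hc
    refine ⟨u - t, sub_pos.2 hu, ⟨0, fun s h1 h2 => absurd h1 h2.not_gt⟩, c, fun s h1 _ h3 => ?_⟩
    exact hu' ⟨h1.le, by linarith⟩
  by_cases h2 : t = r
  · subst h2
    obtain ⟨c, hc⟩ := h.right_end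
    obtain ⟨u, hu, hu'⟩ := (mem_nhdsLT_iff_exists_Ioo_subset).1 hc
    refine ⟨t - u, sub_pos.2 hu, ⟨c, fun s _ h2 h3 => ?_⟩, 0, fun s h1 h2 => absurd h1 h2.not_gt⟩
    exact hu' ⟨by linarith, h2⟩
  obtain ⟨cL, cR, hc⟩ := h.inner t ⟨lt_of_le_of_ne ht.1 (Ne.symm h1), lt_of_le_of_ne ht.2 h2⟩
  obtain ⟨d, hd, hd'⟩ := Metric.eventually_nhds_iff.1 hc
  refine ⟨d, hd, ⟨cL, fun s _ h2 h3 => ?_⟩, cR, fun s h1 _ h3 => ?_⟩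
  · rw [hd' (by rw [Real.dist_eq, abs_lt]; constructor <;> linarith), if_pos h2]
  · rw [hd' (by rw [Real.dist_eq, abs_lt]; constructor <;> linarith), if_neg h1.not_gt]

theorem StepOn.isPiecewiseConstant {f : ℝ → ℝ} {l r : ℝ} (h : StepOn f l r) :
    IsPiecewiseConstant f l r := by
  classical
  have h' : ∀ t, ∃ d > 0, t ∈ Icc l r → (∃ c, ∀ s, l < s → s < t → t - d < s → f s = c) ∧
      ∃ c, ∀ s, t < s → s < r → s < t + d → f s = c := fun t => by
    by_cases ht : t ∈ Icc l r
    · obtain ⟨d, hd, h⟩ := h.exists_Ioo ht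
      exact ⟨d, hd, fun _ => h⟩
    · exact ⟨1, one_pos, fun h => absurd h ht⟩
  choose d hd hd' using h'
  obtain ⟨K, hK, hcov⟩ := (isCompact_Icc (a := l) (b := r)).elim_nhds_subcover
    (fun t => Ioo (t - d t) (t + d t)) fun t _ => Ioo_mem_nhds (by linarith [hd t])
      (by linarith [hd t])
  -- The centres separate the two sides of each covering interval. The right ends prevent `y` from
  -- leaving the interval that contains `x`; left ends are not needed, because `x ≤ y`.
  refine ⟨K ∪ K.image (fun t => t + d t), fun x y hx hxy hy hz => ?_⟩
  obtain ⟨t, htK, ht⟩ := mem_iUnion₂.1 (hcov ⟨hx.le, hxy.trans hy.le⟩)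
  have ht1 := hz t (Finset.mem_union_left _ htK)
  have ht2 := hz (t + d t) (Finset.mem_union_right _ (Finset.mem_image_of_mem _ htK))
  obtain ⟨⟨c, hc⟩, c', hc'⟩ := hd' t (hK t htK)
  have hy2 : y < t + d t := by
    by_contra! hcon
    exact ht2 ⟨ht.2.le, hcon⟩
  rcases lt_or_ge x t with hxt | hxt
  · have hyt : y < t := by
      by_contra! hcon
      exact ht1 ⟨hxt.le, hcon⟩
    rw [hc x hx hxt ht.1, hc y (hx.trans_le hxy) hyt (ht.1.trans_le hxy)]
  · have hxt : t < x := lt_of_le_of_ne hxt fun h => ht1 ⟨h.ge, h ▸ hxy⟩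
    rw [hc' x hxt (hxy.trans_lt hy) ht.2, hc' y (hxt.trans_le hxy) hy hy2]

/-- Bounded functions that are measurable up to modifications outside `(a, b)`. -/
theorem StepOn.intervalIntegrable {f : ℝ → ℝ} {l r : ℝ} (h : StepOn f l r) (hlr : l ≤ r) :
    IntervalIntegrable f volume l r := by
  obtain ⟨g, hg, ⟨M, hM⟩, hfg⟩ := h.isPiecewiseConstant.exists_measurable
  rw [intervalIntegrable_iff_integrableOn_Ioo_of_le hlr]
  have : IntegrableOn g (Ioo l r) := Measure.integrableOn_of_bounded (M := M) (by simp)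
    hg.aestronglyMeasurable (Eventually.of_forall fun x => by simpa using hM x)
  exact this.congr_fun (fun x hx => (hfg x hx).symm) measurableSet_Ioo

/-- Induction along a real interval. -/
theorem forall_Ioc_of_left_right {Q : ℝ → Prop} {T : ℝ} (h0 : ∀ᶠ s in 𝓝[>] 0, Q s)
    (hleft : ∀ t ∈ Ioc 0 T, (∀ s ∈ Ioo 0 t, Q s) → Q t)
    (hright : ∀ t ∈ Ioo 0 T, Q t → ∀ᶠ s in 𝓝[>] t, Q s) : ∀ t ∈ Ioc 0 T, Q t := by
  by_contra! hcon
  obtain ⟨t₀, ht₀, hQ⟩ := hcon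
  set A := {t | t ∈ Ioc 0 T ∧ ¬ Q t} with hA
  have hne : A.Nonempty := ⟨t₀, ht₀, hQ⟩
  have hbdd : BddBelow A := ⟨0, fun t ht => ht.1.1.le⟩
  obtain ⟨u, hu, hu'⟩ := (mem_nhdsGT_iff_exists_Ioo_subset).1 h0
  set m := sInf A with hm
  have hm0 : 0 < m := lt_of_lt_of_le hu <| le_csInf hne fun t ht => by
    by_contra! hlt
    exact ht.2 (hu' ⟨ht.1.1, hlt⟩)
  have hmT : m ≤ T := (csInf_le hbdd ⟨ht₀, hQ⟩).trans ht₀.2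
  have hbelow : ∀ s ∈ Ioo 0 m, Q s := fun s hs => by
    by_contra hq
    exact (csInf_le hbdd ⟨⟨hs.1, hs.2.le.trans hmT⟩, hq⟩).not_gt hs.2
  have hQm := hleft m ⟨hm0, hmT⟩ hbelow
  rcases hmT.eq_or_lt with h | h
  · have : t₀ = m := le_antisymm (ht₀.2.trans h.ge) (csInf_le hbdd ⟨ht₀, hQ⟩)
    exact hQ (this ▸ hQm)
  · obtain ⟨v, hv, hv'⟩ := (mem_nhdsGT_iff_exists_Ioo_subset).1 (hright m ⟨hm0, h⟩ hQm)
    have : v ≤ m := le_csInf hne fun t ht => by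
      by_contra! hlt
      rcases (csInf_le hbdd ht).eq_or_lt with h' | h'
      · exact ht.2 (h' ▸ hQm)
      · exact ht.2 (hv' ⟨h', hlt⟩)
    exact absurd hv this.not_gt

/-! ### The queue driven by a given inflow -/

theorem StepOn.exists_right {f : ℝ → ℝ} {l r t : ℝ} (h : StepOn f l r) (ht : t ∈ Ico l r) :
    ∃ t' ∈ Ioc t r, ∀ s ∈ Ico t t', f s = f t := by
  have : ∃ c, ∀ᶠ s in 𝓝[≥] t, f s = c := by
    rcases ht.1.eq_or_lt with rfl | hlt
    · exact h.left_end
    · obtain ⟨cL, cR, hc⟩ := h.inner t ⟨hlt, ht.2⟩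
      refine ⟨cR, ?_⟩
      filter_upwards [nhdsWithin_le_nhds hc, self_mem_nhdsWithin] with s hs hts
      rw [hs, if_neg (not_lt.2 hts)]
  obtain ⟨c, hc⟩ := this
  obtain ⟨u, hu, hu'⟩ := mem_nhdsGE_iff_exists_Ico_subset.1 hc
  have htc : f t = c := hu' ⟨le_rfl, hu⟩
  exact ⟨min u r, ⟨lt_min hu ht.2, min_le_right _ _⟩, fun s hs =>
    (hu' ⟨hs.1, hs.2.trans_le (min_le_left _ _)⟩ : f s = c).trans htc.symm⟩

theorem StepOn.exists_left {f : ℝ → ℝ} {l r t : ℝ} (h : StepOn f l r) (ht : t ∈ Ioc l r) :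
    ∃ c, ∃ t' ∈ Ioo l t, ∀ s ∈ Ico t' t, f s = c := by
  obtain ⟨d, hd, ⟨c, hc⟩, _⟩ := h.exists_Ioo ⟨ht.1.le, ht.2⟩
  refine ⟨c, max ((l + t) / 2) (t - d / 2), ⟨lt_max_of_lt_left (by linarith [ht.1]),
    max_lt (by linarith [ht.1]) (by linarith)⟩, fun s hs => ?_⟩
  have h1 := le_max_left ((l + t) / 2) (t - d / 2)
  have h2 := le_max_right ((l + t) / 2) (t - d / 2)
  exact hc s (by linarith [hs.1, ht.1]) hs.2 (by linarith [hs.1])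

/-- Queue length without the constraint that it be nonnegative. -/
def netInput (q₀ : ℝ) (F : ℝ → ℝ) (m t : ℝ) : ℝ := q₀ + ∫ s in (0)..t, (F s - m)

/-- The amount by which the net input has to be reflected to stay nonnegative. -/
def regulator (q₀ : ℝ) (F : ℝ → ℝ) (m t : ℝ) : ℝ :=
  max 0 (sSup ((fun s => -netInput q₀ F m s) '' Icc 0 t))

/-- The length of a queue with initial length `q₀`, inflow `F` and maximal outflow `m`. -/
def queueLen (q₀ : ℝ) (F : ℝ → ℝ) (m t : ℝ) : ℝ := netInput q₀ F m t + regulator q₀ F m t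

/-- The outflow of a queue. -/
def queueOut (q F : ℝ → ℝ) (m t : ℝ) : ℝ := if q t = 0 then min (F t) m else m

section Queue

variable {q₀ m T : ℝ} {F : ℝ → ℝ}

theorem intervalIntegrable_sub_const (hF : IntervalIntegrable F volume 0 T) {s t : ℝ}
    (hs : s ∈ Icc 0 T) (ht : t ∈ Icc 0 T) (m : ℝ) :
    IntervalIntegrable (fun r => F r - m) volume s t :=
  (hF.mono_set (uIcc_subset_uIcc (by rw [uIcc_of_le (hs.1.trans hs.2)]; exact hs)
    (by rw [uIcc_of_le (hs.1.trans hs.2)]; exact ht))).sub intervalIntegrable_const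

theorem netInput_sub (hF : IntervalIntegrable F volume 0 T) {s t : ℝ}
    (hs : s ∈ Icc 0 T) (ht : t ∈ Icc 0 T) :
    netInput q₀ F m t - netInput q₀ F m s = ∫ r in s..t, (F r - m) := by
  have h0 : (0 : ℝ) ∈ Icc 0 T := ⟨le_rfl, hs.1.trans hs.2⟩
  rw [netInput, netInput, add_sub_add_left_eq_sub, intervalIntegral.integral_interval_sub_left
    (intervalIntegrable_sub_const hF h0 ht m) (intervalIntegrable_sub_const hF h0 hs m)]

theorem continuousOn_netInput (hF : IntervalIntegrable F volume 0 T) :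
    ContinuousOn (netInput q₀ F m) (Icc 0 T) := by
  by_cases hT : 0 ≤ T
  · have := intervalIntegral.continuousOn_primitive_interval'
      (intervalIntegrable_sub_const hF ⟨le_rfl, hT⟩ ⟨hT, le_rfl⟩ m) (left_mem_uIcc)
    rw [uIcc_of_le hT] at this
    exact continuousOn_const.add this
  · simp [Icc_eq_empty hT]

theorem neg_netInput_le_regulator (hF : IntervalIntegrable F volume 0 T) {s t : ℝ}
    (hs : 0 ≤ s) (hst : s ≤ t) (ht : t ≤ T) : -netInput q₀ F m s ≤ regulator q₀ F m t := by
  refine le_max_of_le_right (le_csSup ?_ (mem_image_of_mem _ ⟨hs, hst⟩))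
  exact (isCompact_Icc.image_of_continuousOn
    ((continuousOn_netInput hF).neg.mono (Icc_subset_Icc_right ht))).bddAbove

theorem regulator_nonneg (t : ℝ) : 0 ≤ regulator q₀ F m t := le_max_left _ _

theorem regulator_le {t c : ℝ} (ht : 0 ≤ t) (hc : 0 ≤ c)
    (h : ∀ s ∈ Icc 0 t, -netInput q₀ F m s ≤ c) : regulator q₀ F m t ≤ c := by
  refine max_le hc (csSup_le ⟨_, mem_image_of_mem _ ⟨le_rfl, ht⟩⟩ ?_)
  rintro _ ⟨s, hs, rfl⟩
  exact h s hs

theorem queueLen_nonneg (hF : IntervalIntegrable F volume 0 T) {t : ℝ} (ht : t ∈ Icc 0 T) :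
    0 ≤ queueLen q₀ F m t := by
  have := neg_netInput_le_regulator (q₀ := q₀) (m := m) hF ht.1 le_rfl ht.2
  rw [queueLen]; linarith

theorem queueLen_zero (hq : 0 ≤ q₀) : queueLen q₀ F m 0 = q₀ := by
  simp [queueLen, regulator, netInput, hq]

/-- While the inflow is constant the net input is linear, so its minimum over the stretch is at an
endpoint and the regulator after `s₀` is the larger of its old value and `-netInput` at `s`. This
explicit formula is the source of all later statements on queues. -/
theorem queueLen_of_const (hF : IntervalIntegrable F volume 0 T) {s₀ s₁ c : ℝ} (h0 : 0 ≤ s₀)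
    (h1 : s₁ ≤ T) (hc : ∀ s ∈ Ico s₀ s₁, F s = c) {s : ℝ} (hs : s ∈ Icc s₀ s₁) :
    queueLen q₀ F m s = max (queueLen q₀ F m s₀ + (c - m) * (s - s₀)) 0 := by
  have hX : ∀ r ∈ Icc s₀ s₁, netInput q₀ F m r = netInput q₀ F m s₀ + (c - m) * (r - s₀) := by
    intro r hr
    have h := netInput_sub (q₀ := q₀) (m := m) hF ⟨h0, hr.1.trans (hr.2.trans h1)⟩
      ⟨h0.trans hr.1, hr.2.trans h1⟩ 
    rw [intervalIntegral.integral_of_le hr.1, ← integral_Ico_eq_integral_Ioc,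
      setIntegral_congr_fun (g := fun _ => c - m) measurableSet_Ico (fun x hx => by
        simp only [hc x ⟨hx.1, hx.2.trans_le hr.2⟩])] at h
    simp only [integral_const, MeasurableSet.univ, measureReal_restrict_apply, univ_inter,
      Real.volume_real_Ico_of_le hr.1, smul_eq_mul] at h
    linarith
  have hM : regulator q₀ F m s = max (regulator q₀ F m s₀) (-netInput q₀ F m s) := by
    apply le_antisymm
    · refine regulator_le (h0.trans hs.1) (le_max_of_le_left (regulator_nonneg _)) fun r hr => ?_
      rcases le_total r s₀ with hr' | hr'
      · exact le_max_of_le_left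
          (neg_netInput_le_regulator hF hr.1 hr' (hs.1.trans (hs.2.trans h1)))
      · rw [hX r ⟨hr', hr.2.trans hs.2⟩, hX s hs]
        have := neg_netInput_le_regulator (q₀ := q₀) (m := m) hF h0 le_rfl
          (hs.1.trans (hs.2.trans h1))
        rcases le_total 0 (c - m) with hcm | hcm
        · refine le_max_of_le_left (le_trans ?_ this)
          nlinarith
        · refine le_max_of_le_right ?_
          nlinarith [hr.2]
    · refine max_le (regulator_le h0 (regulator_nonneg _) fun r hr => ?_)
        (neg_netInput_le_regulator hF (h0.trans hs.1) le_rfl (hs.2.trans h1))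
      exact neg_netInput_le_regulator hF hr.1 (hr.2.trans hs.1) (hs.2.trans h1)
  rw [queueLen, queueLen, hM, hX s hs, ← max_add_add_left]
  congr 1 <;> ring

/-- The reflected integral obeys the switching law of the model: to the right of `t` it is linear,
with slope `F t - m` when nonempty, and with the positive part of that slope when empty. -/
theorem hasDerivWithinAt_queueLen (hF : StepOn F 0 T) (hT : 0 ≤ T) {t : ℝ} (ht : t ∈ Ico 0 T) :
    HasDerivWithinAt (queueLen q₀ F m) (F t - queueOut (queueLen q₀ F m) F m t) (Ici t) t := by
  have hI := hF.intervalIntegrable hT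
  obtain ⟨t', ht', hc⟩ := hF.exists_right ht
  have hq : ∀ s ∈ Icc t t', queueLen q₀ F m s
      = max (queueLen q₀ F m t + (F t - m) * (s - t)) 0 := fun s hs =>
    queueLen_of_const hI ht.1 ht'.2 hc hs
  have hlin : ∀ k : ℝ, HasDerivWithinAt (fun s => queueLen q₀ F m t + k * (s - t)) k (Ici t) t :=
    fun k => by
      simpa using (((hasDerivAt_id t).sub_const t).const_mul k |>.const_add
        (queueLen q₀ F m t)).hasDerivWithinAt
  have hnear : ∀ᶠ s in 𝓝[≥] t, s ∈ Icc t t' := Icc_mem_nhdsGE ht'.1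
  have hpos := queueLen_nonneg (q₀ := q₀) (m := m) hI (t := t) ⟨ht.1, ht.2.le⟩
  rcases hpos.eq_or_lt with h | h
  · rw [queueOut, if_pos h.symm]
    refine (hlin _).congr_of_eventuallyEq ?_ (by simp)
    filter_upwards [hnear] with s hs
    rw [hq s hs, ← h, zero_add, zero_add]
    have hs0 : 0 ≤ s - t := sub_nonneg.2 hs.1
    rcases le_total (F t) m with hFm | hFm
    · rw [min_eq_left hFm, max_eq_right (by nlinarith)]; ring
    · rw [min_eq_right hFm, max_eq_left (by nlinarith)]
  · rw [queueOut, if_neg h.ne']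
    refine (hlin _).congr_of_eventuallyEq ?_ (by simp)
    have hcont : ContinuousWithinAt (fun s => queueLen q₀ F m t + (F t - m) * (s - t)) (Ici t) t :=
      (hlin _).continuousWithinAt
    have : ∀ᶠ s in 𝓝[≥] t, 0 < queueLen q₀ F m t + (F t - m) * (s - t) :=
      hcont.eventually (Ioi_mem_nhds (by simpa using h))
    filter_upwards [hnear, this] with s hs hs'
    rw [hq s hs, max_eq_left hs'.le]

theorem continuousOn_queueLen (hF : StepOn F 0 T) (hT : 0 ≤ T) :
    ContinuousOn (queueLen q₀ F m) (Icc 0 T) := by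
  have hI := hF.intervalIntegrable hT
  intro t ht
  have hr : ContinuousWithinAt (queueLen q₀ F m) (Icc t T) t := by
    rcases ht.2.eq_or_lt with rfl | h
    · simp [continuousWithinAt_singleton]
    · exact (hasDerivWithinAt_queueLen hF hT ⟨ht.1, h⟩).continuousWithinAt.mono Icc_subset_Ici_self
  have hl : ContinuousWithinAt (queueLen q₀ F m) (Icc 0 t) t := by
    rcases ht.1.eq_or_lt with rfl | h
    · simp [continuousWithinAt_singleton]
    · obtain ⟨c, t', ht', hc⟩ := hF.exists_left ⟨h, ht.2⟩
      have hq : ∀ s ∈ Icc t' t, queueLen q₀ F m s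
          = max (queueLen q₀ F m t' + (c - m) * (s - t')) 0 := fun s hs =>
        queueLen_of_const hI ht'.1.le ht.2 hc hs
      have : ContinuousWithinAt (fun s => max (queueLen q₀ F m t' + (c - m) * (s - t')) 0)
          (Icc 0 t) t := by fun_prop
      refine this.congr_of_eventuallyEq ?_ (hq t ⟨ht'.2.le, le_rfl⟩)
      filter_upwards [nhdsWithin_le_nhds (Ioi_mem_nhds ht'.2), self_mem_nhdsWithin] with s h1 h2
      exact hq s ⟨h1.le, h2.2⟩
  have := hl.union hr
  rwa [Icc_union_Icc_eq_Icc ht.1 ht.2] at this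

theorem queueOut_eq_of_pos {q : ℝ → ℝ} {t : ℝ} (h : 0 < q t) : queueOut q F m t = m := by
  rw [queueOut, if_neg h.ne']

theorem queueOut_eq_of_zero {q : ℝ → ℝ} {t : ℝ} (h : q t = 0) :
    queueOut q F m t = min (F t) m := by
  rw [queueOut, if_pos h]

theorem queueOut_le (q : ℝ → ℝ) (t : ℝ) : queueOut q F m t ≤ m := by
  unfold queueOut; split_ifs
  · exact min_le_right _ _
  · exact le_rfl

/-- While the inflow is constant, the queue is either empty or nonempty up to the final time. -/
theorem queueLen_left_dichotomy (hF : StepOn F 0 T) (hT : 0 ≤ T) {t : ℝ} (ht : t ∈ Ioc 0 T) :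
    (∀ᶠ s in 𝓝[<] t, 0 < queueLen q₀ F m s) ∨ ∀ᶠ s in 𝓝[<] t, queueLen q₀ F m s = 0 := by
  have hI := hF.intervalIntegrable hT
  obtain ⟨c, t', ht', hc⟩ := hF.exists_left ht
  have hq : ∀ s ∈ Icc t' t, queueLen q₀ F m s
      = max (queueLen q₀ F m t' + (c - m) * (s - t')) 0 := fun s hs =>
    queueLen_of_const hI ht'.1.le ht.2 hc hs
  set a := queueLen q₀ F m t' with ha
  have ha0 : 0 ≤ a := queueLen_nonneg hI ⟨ht'.1.le, ht'.2.le.trans ht.2⟩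
  have hnear : ∀ᶠ s in 𝓝[<] t, s ∈ Ioo t' t := Ioo_mem_nhdsLT ht'.2
  by_cases hcm : c - m < 0
  · rcases le_or_gt (a + (c - m) * (t - t')) 0 with h | h
    · rcases h.eq_or_lt with h | h
      · left
        filter_upwards [hnear] with s hs
        rw [hq s ⟨hs.1.le, hs.2.le⟩]
        exact lt_max_of_lt_left (by nlinarith [hs.2])
      · right
        have : ∀ᶠ s in 𝓝 t, a + (c - m) * (s - t') < 0 :=
          (Continuous.tendsto (by fun_prop) t).eventually (Iio_mem_nhds h)
        filter_upwards [hnear, nhdsWithin_le_nhds this] with s hs h'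
        rw [hq s ⟨hs.1.le, hs.2.le⟩, max_eq_right h'.le]
    · left
      filter_upwards [hnear] with s hs
      rw [hq s ⟨hs.1.le, hs.2.le⟩]
      exact lt_max_of_lt_left (by nlinarith [hs.2])
  · push Not at hcm
    by_cases h0 : a = 0 ∧ c - m = 0
    · right
      filter_upwards [hnear] with s hs
      rw [hq s ⟨hs.1.le, hs.2.le⟩, h0.1, h0.2]; simp
    · left
      filter_upwards [hnear] with s hs
      rw [hq s ⟨hs.1.le, hs.2.le⟩]
      have hs' : 0 < s - t' := sub_pos.2 hs.1
      apply lt_max_of_lt_left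
      rcases ha0.eq_or_lt with h | h
      · have : 0 < c - m := lt_of_le_of_ne hcm fun h' => h0 ⟨h.symm, h'.symm⟩
        nlinarith [mul_pos this hs']
      · nlinarith [mul_nonneg hcm hs'.le]

/-- The one delicate case is an empty queue that starts to fill at `t`: then `m < F t`, so `min (F
t) m` is already `m` and the change of formula causes no jump. -/
theorem queueOut_right (hF : StepOn F 0 T) (hT : 0 ≤ T) {t : ℝ} (ht : t ∈ Ico 0 T) :
    ∀ᶠ s in 𝓝[≥] t, queueOut (queueLen q₀ F m) F m s = queueOut (queueLen q₀ F m) F m t := by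
  have hI := hF.intervalIntegrable hT
  obtain ⟨t', ht', hc⟩ := hF.exists_right ht
  have hq : ∀ s ∈ Icc t t', queueLen q₀ F m s
      = max (queueLen q₀ F m t + (F t - m) * (s - t)) 0 := fun s hs =>
    queueLen_of_const hI ht.1 ht'.2 hc hs
  have hnear : ∀ᶠ s in 𝓝[≥] t, s ∈ Ico t t' := Ico_mem_nhdsGE ht'.1
  rcases (queueLen_nonneg (q₀ := q₀) (m := m) hI (t := t) ⟨ht.1, ht.2.le⟩).eq_or_lt with h | h
  · filter_upwards [hnear] with s hs
    rw [queueOut_eq_of_zero h.symm]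
    rcases le_or_gt (F t) m with hm | hm
    · rw [queueOut_eq_of_zero, hc s hs]
      rw [hq s ⟨hs.1, hs.2.le⟩, ← h, max_eq_right]
      nlinarith [hs.1]
    · rcases hs.1.eq_or_lt with rfl | hlt
      · rw [queueOut_eq_of_zero h.symm]
      · rw [queueOut_eq_of_pos, min_eq_right hm.le]
        rw [hq s ⟨hs.1, hs.2.le⟩]
        exact lt_max_of_lt_left (by nlinarith [mul_pos (sub_pos.2 hm) (sub_pos.2 hlt)])
  · have hcont := (hasDerivWithinAt_queueLen (q₀ := q₀) (m := m) hF hT ht).continuousWithinAt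
    filter_upwards [hcont.eventually (Ioi_mem_nhds h)] with s hs
    rw [queueOut_eq_of_pos h, queueOut_eq_of_pos hs]

theorem queueOut_left (hF : StepOn F 0 T) (hT : 0 ≤ T) {t : ℝ} (ht : t ∈ Ioc 0 T) :
    ∃ c, ∀ᶠ s in 𝓝[<] t, queueOut (queueLen q₀ F m) F m s = c := by
  obtain ⟨c, t', ht', hc⟩ := hF.exists_left ht
  rcases queueLen_left_dichotomy (q₀ := q₀) (m := m) hF hT ht with h | h
  · exact ⟨m, h.mono fun s hs => queueOut_eq_of_pos hs⟩
  · refine ⟨min c m, ?_⟩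
    filter_upwards [h, Ioo_mem_nhdsLT ht'.2] with s hs hs'
    rw [queueOut_eq_of_zero hs, hc s ⟨hs'.1.le, hs'.2⟩]

theorem stepOn_of_germs {f : ℝ → ℝ} {l r : ℝ}
    (hl : ∀ t ∈ Ioc l r, ∃ c, ∀ᶠ s in 𝓝[<] t, f s = c)
    (hr : ∀ t ∈ Ico l r, ∃ c, ∀ᶠ s in 𝓝[≥] t, f s = c) (hlr : l < r) : StepOn f l r where
  inner t ht := by
    obtain ⟨cL, hL⟩ := hl t ⟨ht.1, ht.2.le⟩
    obtain ⟨cR, hR⟩ := hr t ⟨ht.1.le, ht.2⟩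
    refine ⟨cL, cR, ?_⟩
    rw [← nhdsLT_sup_nhdsGE t, eventually_sup]
    constructor
    · filter_upwards [hL, self_mem_nhdsWithin] with s hs h
      rw [hs, if_pos (mem_Iio.1 h)]
    · filter_upwards [hR, self_mem_nhdsWithin] with s hs h
      rw [hs, if_neg (not_lt.2 h)]
  left_end := hr l ⟨le_rfl, hlr⟩
  right_end := hl r ⟨hlr, le_rfl⟩

/-- Queues map right-continuous step functions to such functions, which is what allows iteration
along the chain. -/
theorem stepOn_queueOut (hF : StepOn F 0 T) (hT : 0 < T) :
    StepOn (queueOut (queueLen q₀ F m) F m) 0 T :=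
  stepOn_of_germs (fun _ ht => queueOut_left hF hT.le ht)
    (fun _ ht => ⟨_, queueOut_right hF hT.le ht⟩) hT

theorem queueLen_eq_integral (hF : StepOn F 0 T) (hT : 0 < T) (hq : 0 ≤ q₀) {t : ℝ}
    (ht : t ∈ Icc 0 T) : queueLen q₀ F m t
      = q₀ + ∫ s in (0)..t, (F s - queueOut (queueLen q₀ F m) F m s) := by
  have hsub : Icc 0 t ⊆ Icc 0 T := Icc_subset_Icc_right ht.2
  rw [intervalIntegral.integral_eq_sub_of_hasDeriv_right (f := queueLen q₀ F m)]
  · rw [queueLen_zero hq]; ring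
  · rw [uIcc_of_le ht.1]
    exact (continuousOn_queueLen hF hT.le).mono hsub
  · intro x hx
    rw [min_eq_left ht.1, max_eq_right ht.1] at hx
    exact (hasDerivWithinAt_queueLen hF hT.le ⟨hx.1.le, hx.2.trans_le ht.2⟩).mono Ioi_subset_Ici_self
  · refine IntervalIntegrable.mono_set (a := 0) (b := T) ?_ ?_
    · exact (hF.intervalIntegrable hT.le).sub ((stepOn_queueOut hF hT).intervalIntegrable hT.le)
    · rwa [uIcc_of_le ht.1, uIcc_of_le hT.le]

/-- The net input and its running supremum each change by at most the `L¹` distance of the inflows,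
hence the factor two. Later this supplies the dominating function for difference quotients of
queues. -/
theorem abs_queueLen_sub_le {F' : ℝ → ℝ} (hF : IntervalIntegrable F volume 0 T)
    (hF' : IntervalIntegrable F' volume 0 T) {t : ℝ} (ht : t ∈ Icc 0 T) :
    |queueLen q₀ F m t - queueLen q₀ F' m t| ≤ 2 * ∫ s in (0)..T, |F s - F' s| := by
  have hT : 0 ≤ T := ht.1.trans ht.2
  have h0 : (0 : ℝ) ∈ Icc 0 T := ⟨le_rfl, hT⟩
  set I := ∫ s in (0)..T, |F s - F' s| with hI
  have hX : ∀ s ∈ Icc 0 T, |netInput q₀ F m s - netInput q₀ F' m s| ≤ I := by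
    intro s hs
    rw [netInput, netInput, add_sub_add_left_eq_sub, ← intervalIntegral.integral_sub
      (intervalIntegrable_sub_const hF h0 hs m) (intervalIntegrable_sub_const hF' h0 hs m)]
    simp only [sub_sub_sub_cancel_right]
    calc |∫ r in (0)..s, (F r - F' r)| ≤ ∫ r in (0)..s, |F r - F' r| :=
          intervalIntegral.abs_integral_le_integral_abs hs.1
      _ ≤ I := intervalIntegral.integral_mono_interval le_rfl hs.1 hs.2
          (Eventually.of_forall fun _ => abs_nonneg _) (hF.sub hF').abs
  have hI0 : 0 ≤ I := (abs_nonneg _).trans (hX 0 h0)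
  have hM : ∀ G G' : ℝ → ℝ, IntervalIntegrable G' volume 0 T →
      (∀ s ∈ Icc 0 T, |netInput q₀ G m s - netInput q₀ G' m s| ≤ I) →
      regulator q₀ G m t ≤ regulator q₀ G' m t + I := by
    intro G G' hG' h
    refine regulator_le ht.1 (add_nonneg (regulator_nonneg _) hI0) fun s hs => ?_
    have h1 := neg_netInput_le_regulator (q₀ := q₀) (m := m) hG' hs.1 hs.2 ht.2
    have h2 := abs_le.1 (h s ⟨hs.1, hs.2.trans ht.2⟩)
    linarith [h2.1]
  have h1 := hM F F' hF' hX
  have h2 := hM F' F hF fun s hs => by rw [abs_sub_comm]; exact hX s hs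
  have h3 := abs_le.1 (hX t ht)
  rw [queueLen, queueLen, abs_le]
  constructor <;> linarith [h3.1, h3.2]

/-- Suppose `p < q` at `t₁`, and let `t₀` be the last earlier time with `q ≤ p`. After `t₀` one has
`q > p ≥ 0`, so `q` is discharged at the maximal rate and `q - p` cannot increase. Used in both
directions, this gives uniqueness of the queue. -/
theorem le_of_queue_equation {F' q p : ℝ → ℝ} (hFF : ∀ᵐ t ∂volume.restrict (Ioo 0 T), F t = F' t)
    (hqI : IntervalIntegrable (fun s => F s - queueOut q F m s) volume 0 T)
    (hpI : IntervalIntegrable (fun s => F' s - queueOut p F' m s) volume 0 T)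
    (hp0 : ∀ t ∈ Icc 0 T, 0 ≤ p t)
    (hq : ∀ t ∈ Icc 0 T, q t = q₀ + ∫ s in (0)..t, (F s - queueOut q F m s))
    (hp : ∀ t ∈ Icc 0 T, p t = q₀ + ∫ s in (0)..t, (F' s - queueOut p F' m s)) :
    ∀ t ∈ Icc 0 T, q t ≤ p t := by
  intro t₁ ht₁
  by_contra! hlt
  have hT : 0 ≤ T := ht₁.1.trans ht₁.2
  have hcont : ∀ {f g : ℝ → ℝ}, IntervalIntegrable g volume 0 T →
      (∀ t ∈ Icc 0 T, f t = q₀ + ∫ s in (0)..t, g s) → ContinuousOn f (Icc 0 T) := by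
    intro f g hg h
    have := intervalIntegral.continuousOn_primitive_interval' hg left_mem_uIcc
    rw [uIcc_of_le hT] at this
    exact (continuousOn_const.add this).congr h
  have hqc := hcont hqI hq
  have hpc := hcont hpI hp
  set A := Icc 0 t₁ ∩ (fun s => p s - q s) ⁻¹' Ici 0 with hA
  have hAc : IsCompact A := isCompact_Icc.of_isClosed_subset
    (((hpc.sub hqc).mono (Icc_subset_Icc_right ht₁.2)).preimage_isClosed_of_isClosed
      isClosed_Icc isClosed_Ici) inter_subset_left
  have h0A : (0 : ℝ) ∈ A := by
    refine ⟨⟨le_rfl, ht₁.1⟩, ?_⟩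
    have h0 : (0 : ℝ) ∈ Icc 0 T := ⟨le_rfl, hT⟩
    simp [hq 0 h0, hp 0 h0]
  obtain ⟨t₀, ht₀⟩ := hAc.exists_isGreatest ⟨0, h0A⟩
  have hab : ∀ s ∈ Ioc t₀ t₁, p s < q s := fun s hs => by
    by_contra! hcon
    exact (ht₀.2 ⟨⟨ht₀.1.1.1.trans hs.1.le, hs.2⟩, sub_nonneg.2 hcon⟩).not_gt hs.1
  have ht01 : t₀ ≤ t₁ := ht₀.1.1.2
  have ht0T : t₀ ∈ Icc 0 T := ⟨ht₀.1.1.1, ht01.trans ht₁.2⟩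
  have hsub : ∀ {f g : ℝ → ℝ}, IntervalIntegrable g volume 0 T →
      (∀ t ∈ Icc 0 T, f t = q₀ + ∫ s in (0)..t, g s) → f t₁ - f t₀ = ∫ s in t₀..t₁, g s := by
    intro f g hg h
    rw [h t₁ ht₁, h t₀ ht0T, add_sub_add_left_eq_sub,
      intervalIntegral.integral_interval_sub_left]
    · exact hg.mono_set (uIcc_subset_uIcc left_mem_uIcc (by rwa [uIcc_of_le hT]))
    · exact hg.mono_set (uIcc_subset_uIcc left_mem_uIcc (by rwa [uIcc_of_le hT]))
  have hss : uIcc t₀ t₁ ⊆ uIcc 0 T :=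
    uIcc_subset_uIcc (by rwa [uIcc_of_le hT]) (by rwa [uIcc_of_le hT])
  have hmono : ∫ s in t₀..t₁, (F s - queueOut q F m s)
      ≤ ∫ s in t₀..t₁, (F' s - queueOut p F' m s) := by
    rw [intervalIntegral.integral_of_le ht01, intervalIntegral.integral_of_le ht01,
      integral_Ioc_eq_integral_Ioo, integral_Ioc_eq_integral_Ioo]
    have hr : Ioo t₀ t₁ ⊆ Ioo 0 T := Ioo_subset_Ioo ht0T.1 ht₁.2
    refine integral_mono_ae ((intervalIntegrable_iff_integrableOn_Ioo_of_le ht01).1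
      (hqI.mono_set hss)) ((intervalIntegrable_iff_integrableOn_Ioo_of_le ht01).1
      (hpI.mono_set hss)) ?_
    filter_upwards [ae_restrict_of_ae_restrict_of_subset hr hFF, ae_restrict_mem measurableSet_Ioo]
      with s hs hsI
    have h1 : 0 < q s := (hp0 s ⟨ht0T.1.trans hsI.1.le, hsI.2.le.trans ht₁.2⟩).trans_lt
      (hab s ⟨hsI.1, hsI.2.le⟩)
    have h2 := queueOut_le (F := F') (m := m) p s
    rw [queueOut_eq_of_pos h1, hs]
    linarith
  rw [← hsub hqI hq, ← hsub hpI hp] at hmono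
  have : 0 ≤ p t₀ - q t₀ := ht₀.1.2
  linarith

end Queue

/-! ### Transport along characteristics -/

section Transport

variable {a b v T : ℝ} {φ : ℝ × ℝ → ℝ}

theorem IsTest.eq_zero (hφ : IsTest φ b T) {p : ℝ × ℝ} (hp : b ≤ p.1 ∨ T ≤ p.2) : φ p = 0 :=
  image_eq_zero_of_notMem_tsupport fun h => by
    have := hφ.support h
    rcases hp with hp | hp
    · exact this.1.not_ge hp
    · exact this.2.not_ge hp

theorem IsTest.fderiv_eq_zero (hφ : IsTest φ b T) {p : ℝ × ℝ} (hp : b ≤ p.1 ∨ T ≤ p.2) :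
    fderiv ℝ φ p = 0 :=
  image_eq_zero_of_notMem_tsupport fun h => by
    have := hφ.support (tsupport_fderiv_subset ℝ h)
    rcases hp with hp | hp
    · exact this.1.not_ge hp
    · exact this.2.not_ge hp

theorem dt_add_mul_dx (φ : ℝ × ℝ → ℝ) (v : ℝ) (p : ℝ × ℝ) :
    dt φ p + v * dx φ p = fderiv ℝ φ p (v, 1) := by
  have : ((v, 1) : ℝ × ℝ) = (0, 1) + v • (1, 0) := by simp
  rw [this, map_add, map_smul, dt, dx, smul_eq_mul]

theorem IsTest.continuous_fderiv_apply (hφ : IsTest φ b T) (w : ℝ × ℝ) :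
    Continuous fun p => fderiv ℝ φ p w :=
  (hφ.contDiff.continuous_fderiv one_ne_zero).clm_apply continuous_const

theorem IsTest.hasCompactSupport_fderiv_apply (hφ : IsTest φ b T) (w : ℝ × ℝ) :
    HasCompactSupport fun p => fderiv ℝ φ p w :=
  (hφ.compact.fderiv ℝ).comp_left (g := fun L : ℝ × ℝ →L[ℝ] ℝ => L w) rfl

/-- The shear that straightens the characteristics. -/
def shear (a v : ℝ) : ℝ × ℝ ≃ₜ ℝ × ℝ where
  toFun p := (p.1, p.2 + (p.1 - a) / v)
  invFun p := (p.1, p.2 - (p.1 - a) / v)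
  left_inv p := by simp
  right_inv p := by simp
  continuous_toFun := by fun_prop
  continuous_invFun := by fun_prop

/-- Along the characteristic with label `s`, parametrised by position, the integrand is the
derivative of `v * φ`. -/
theorem integral_fderiv_characteristic (hφ : IsTest φ b T) (hv : 0 < v) (s m : ℝ) :
    ∫ x in Ioi m, fderiv ℝ φ (shear a v (x, s)) (v, 1) = -(v * φ (shear a v (m, s))) := by
  set g : ℝ → ℝ := fun x => v * φ (shear a v (x, s)) with hg
  have hgd : ∀ x, HasDerivAt g (fderiv ℝ φ (shear a v (x, s)) (v, 1)) x := by
    intro x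
    have h1 : HasDerivAt (fun x : ℝ => shear a v (x, s)) ((1 : ℝ), 1 / v) x :=
      (hasDerivAt_id x).prodMk ((((hasDerivAt_id x).sub_const a).div_const v).const_add s)
    have h2 := ((hφ.contDiff.differentiable one_ne_zero _).hasFDerivAt.comp_hasDerivAt x
      h1).const_mul v
    have h3 : v * fderiv ℝ φ (shear a v (x, s)) (1, 1 / v)
        = fderiv ℝ φ (shear a v (x, s)) (v, 1) := by
      rw [← smul_eq_mul, ← map_smul]
      congr 1
      ext <;> simp [hv.ne']
    rw [h3] at h2
    exact h2
  have hgc : ContDiff ℝ 1 g := by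
    refine contDiff_const.mul (hφ.contDiff.comp ?_)
    simp only [shear, Homeomorph.homeomorph_mk_coe, Equiv.coe_fn_mk]
    fun_prop
  have hgs : HasCompactSupport g := by
    have : HasCompactSupport (fun x => φ (shear a v (x, s))) := by
      refine HasCompactSupport.of_support_subset_isCompact (hφ.compact.isCompact.image continuous_fst)
        fun x hx => ⟨shear a v (x, s), subset_tsupport _ hx, rfl⟩
    exact this.mul_left (f := fun _ => v)
  rw [← hgs.integral_Ioi_deriv_eq hgc m]
  exact integral_congr_ae (Eventually.of_forall fun x => (hgd x).deriv.symm)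

/-- This is the weak formulation for a profile that is constant on characteristics. After the shear,
Fubini reduces it to one integral per characteristic, of which only the value of `φ` at the entry
point survives: the inflow boundary for positive labels, the initial line for negative ones. -/
theorem integral_transport (hφ : IsTest φ b T) (hv : 0 < v) {h : ℝ → ℝ}
    (hm : Measurable h) {M : ℝ} (hM : ∀ s, |h s| ≤ M) :
    (∫ p in Ioo a b ×ˢ Ioo 0 T, h (p.2 - (p.1 - a) / v) * (dt φ p + v * dx φ p))
      + (∫ x in Ioo a b, h ((a - x) / v) * φ (x, 0)) + v * ∫ t in Ioo 0 T, h t * φ (a, t) = 0 := by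
  set ψ : ℝ × ℝ → ℝ := fun p => fderiv ℝ φ p (v, 1) with hψ
  -- The quadrant may replace the rectangle, because the test function vanishes for `b ≤ x` and for
  -- `T ≤ t`.
  set Q : Set (ℝ × ℝ) := {p | a < p.1 ∧ 0 < p.2} with hQ
  have hQm : MeasurableSet Q := (measurableSet_lt measurable_const measurable_fst).inter
    (measurableSet_lt measurable_const measurable_snd)
  set G : ℝ × ℝ → ℝ := fun p => Q.indicator (fun p => h (p.2 - (p.1 - a) / v) * ψ p) p with hG
  have hψint : Integrable ψ :=
    (hφ.continuous_fderiv_apply _).integrable_of_hasCompactSupport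
      (hφ.hasCompactSupport_fderiv_apply _)
  have hGint : Integrable G := by
    refine Integrable.indicator (hψint.bdd_mul (c := M) ?_ (Eventually.of_forall fun p => ?_)) hQm
    · exact (hm.comp (by fun_prop)).aestronglyMeasurable
    · simpa using hM _
  have e1 : (∫ p in Ioo a b ×ˢ Ioo 0 T, h (p.2 - (p.1 - a) / v) * (dt φ p + v * dx φ p))
      = ∫ p, G p := by
    rw [← integral_indicator (measurableSet_Ioo.prod measurableSet_Ioo)]
    refine integral_congr_ae (Eventually.of_forall fun p => ?_)
    simp only [hG, indicator, hQ, mem_ofPred_eq, mem_prod, mem_Ioo, dt_add_mul_dx]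
    by_cases hp : b ≤ p.1 ∨ T ≤ p.2
    · simp [hψ, hφ.fderiv_eq_zero hp]
    · push Not at hp
      simp [hp.1, hp.2, hψ]
  set H : ℝ × ℝ → ℝ := fun p => G (shear a v p) with hH
  -- `max a (a - v * s)` is the position at which the characteristic with label `s` enters the
  -- quadrant.
  have hHv : ∀ x s, H (x, s) = (Ioi (max a (a - v * s))).indicator
      (fun x => h s * ψ (shear a v (x, s))) x := by
    intro x s
    have : (a < x ∧ 0 < s + (x - a) / v) ↔ max a (a - v * s) < x := by
      rw [max_lt_iff, and_congr_right_iff]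
      intro _
      rw [← sub_lt_iff_lt_add', zero_sub, lt_div_iff₀ hv]
      constructor <;> intro h <;> linarith
    simp only [hH, hG, indicator, hQ, mem_ofPred_eq, mem_Ioi, shear, Homeomorph.homeomorph_mk_coe,
      Equiv.coe_fn_mk, this, add_sub_cancel_right]
  have hHint : Integrable H := by
    have h1 : Integrable (fun p => ψ (shear a v p)) := by
      refine ((hφ.continuous_fderiv_apply _).comp (shear a v).continuous).integrable_of_hasCompactSupport
        ((hφ.hasCompactSupport_fderiv_apply _).comp_homeomorph (shear a v))
    have h2 : Integrable (fun p : ℝ × ℝ => h p.2 * ψ (shear a v p)) := by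
      refine h1.bdd_mul (c := M) (hm.comp measurable_snd).aestronglyMeasurable
        (Eventually.of_forall fun p => ?_)
      simpa using hM _
    have h3 : H = (shear a v ⁻¹' Q).indicator (fun p : ℝ × ℝ => h p.2 * ψ (shear a v p)) := by
      ext p
      simp only [hH, hG, indicator, mem_preimage]
      split_ifs
      · simp [shear]
      · rfl
    rw [h3]
    exact h2.indicator ((shear a v).continuous.measurable hQm)
  have e2 : ∫ p, G p = ∫ s, -(h s * (v * φ (shear a v (max a (a - v * s), s)))) := by
    have : ∫ p, G p = ∫ x, ∫ t, G (x, t) := integral_prod _ hGint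
    rw [this]
    have : ∀ x, ∫ t, G (x, t) = ∫ s, H (x, s) := fun x =>
      (integral_add_right_eq_self (fun t => G (x, t)) ((x - a) / v)).symm
    simp_rw [this]
    rw [integral_integral_swap (f := fun x s => H (x, s)) hHint]
    refine integral_congr_ae (Eventually.of_forall fun s => ?_)
    simp only [hHv]
    rw [integral_indicator measurableSet_Ioi, integral_const_mul,
      integral_fderiv_characteristic hφ hv]
    ring
  have hB : Integrable (fun s => h s * (v * φ (shear a v (max a (a - v * s), s)))) := by
    have := hHint.integral_prod_right
    have h' : (fun s => h s * (v * φ (shear a v (max a (a - v * s), s))))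
        = fun s => -∫ x, H (x, s) := by
      ext s
      simp only [hHv]
      rw [integral_indicator measurableSet_Ioi, integral_const_mul,
        integral_fderiv_characteristic hφ hv]
      ring
    rw [h']
    exact this.neg
  rw [e1, e2, integral_neg, ← integral_add_compl (measurableSet_Ioi (a := (0 : ℝ))) hB]
  have e3 : ∫ s in Ioi 0, h s * (v * φ (shear a v (max a (a - v * s), s)))
      = v * ∫ t in Ioo 0 T, h t * φ (a, t) := by
    rw [← integral_const_mul, ← integral_indicator measurableSet_Ioi,
      ← integral_indicator measurableSet_Ioo]
    refine integral_congr_ae (Eventually.of_forall fun s => ?_)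
    by_cases hs : 0 < s
    · have hmax : max a (a - v * s) = a := max_eq_left (by nlinarith)
      by_cases hsT : s < T
      · simp [indicator, hs, hsT, hmax, shear]; ring
      · simp [indicator, hs, hsT, hmax, shear, hφ.eq_zero (p := (a, s)) (Or.inr (not_lt.1 hsT))]
    · simp [indicator, hs]
  have e4 : ∫ s in (Ioi (0 : ℝ))ᶜ, h s * (v * φ (shear a v (max a (a - v * s), s)))
      = ∫ x in Ioo a b, h ((a - x) / v) * φ (x, 0) := by
    rw [compl_Ioi, integral_Iic_eq_integral_Iio, ← integral_indicator measurableSet_Iio,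
      ← integral_indicator measurableSet_Ioo]
    set K : ℝ → ℝ := (Ioo a b).indicator fun x => h ((a - x) / v) * φ (x, 0) with hK
    have : ∫ x, K x = v * ∫ s, K (a - v * s) := by
      have h1 := Measure.integral_comp_mul_left (fun y => K (a - y)) v
      rw [h1, integral_sub_left_eq_self, smul_eq_mul, abs_of_pos (inv_pos.2 hv), ← mul_assoc,
        mul_inv_cancel₀ hv.ne', one_mul]
    rw [this, ← integral_const_mul]
    refine integral_congr_ae (Eventually.of_forall fun s => ?_)
    by_cases hs : s < 0
    · have hmax : max a (a - v * s) = a - v * s := max_eq_right (by nlinarith)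
      have hdiv : (a - (a - v * s)) / v = s := by field_simp; ring
      have hsh : shear a v (a - v * s, s) = (a - v * s, 0) := by
        simp only [shear, Homeomorph.homeomorph_mk_coe, Equiv.coe_fn_mk, Prod.mk.injEq, true_and]
        field_simp; ring
      have hlt : a < a - v * s := by nlinarith
      have h1 : K (a - v * s) = h s * φ (a - v * s, 0) := by
        by_cases hsT : a - v * s < b
        · rw [hK, indicator_of_mem (mem_Ioo.2 ⟨hlt, hsT⟩), hdiv]
        · have : a - v * s ∉ Ioo a b := fun h => hsT h.2
          rw [hK, indicator_of_notMem this,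
            hφ.eq_zero (p := (a - v * s, 0)) (Or.inl (not_lt.1 hsT)), mul_zero]
      simp only [indicator_of_mem (mem_Iio.2 hs), hmax, hsh, h1]
      ring
    · have : a - v * s ∉ Ioo a b := fun h => by
        push Not at hs; nlinarith [mul_nonneg hv.le hs, h.1]
      have hs' : s ∉ Iio (0 : ℝ) := hs
      simp only [indicator_of_notMem hs', hK, indicator_of_notMem this, mul_zero]
  rw [e3, e4]
  ring

end Transport

/-! ### Transported profiles as entropy solutions -/

section TransportSolution

variable {a b v μ T : ℝ} {φ : ℝ × ℝ → ℝ}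

theorem IsTest.integrable_dx (hφ : IsTest φ b T) : Integrable (dx φ) :=
  (hφ.continuous_fderiv_apply _).integrable_of_hasCompactSupport
    (hφ.hasCompactSupport_fderiv_apply _)

theorem IsTest.integrable_dt (hφ : IsTest φ b T) : Integrable (dt φ) :=
  (hφ.continuous_fderiv_apply _).integrable_of_hasCompactSupport
    (hφ.hasCompactSupport_fderiv_apply _)

theorem IsTest.integrable_slice (hφ : IsTest φ b T) : Integrable (fun x => φ (x, 0)) := by
  refine (hφ.contDiff.continuous.comp (by fun_prop)).integrable_of_hasCompactSupport ?_
  exact HasCompactSupport.of_support_subset_isCompact (hφ.compact.isCompact.image continuous_fst)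
    fun x hx => ⟨(x, 0), subset_tsupport _ hx, rfl⟩

theorem apply_left_eq_zero (hφa : tsupport φ ⊆ {p | a < p.1}) (t : ℝ) : φ (a, t) = 0 :=
  image_eq_zero_of_notMem_tsupport fun h => lt_irrefl a (hφa h)

/-- The transport identity for the constant profile, written for the two velocities `1` and `2`, is
a linear system for these two quantities. -/
theorem integral_dx_dt_of_test (hφ : IsTest φ b T) (hφa : tsupport φ ⊆ {p | a < p.1}) :
    (∫ p in Ioo a b ×ˢ Ioo 0 T, dx φ p) = 0 ∧
      (∫ p in Ioo a b ×ˢ Ioo 0 T, dt φ p) + ∫ x in Ioo a b, φ (x, 0) = 0 := by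
  have h1 := integral_transport (a := a) hφ one_pos (h := fun _ => 1) measurable_const (M := 1)
    (by simp)
  have h2 := integral_transport (a := a) hφ two_pos (h := fun _ => 1) measurable_const (M := 1)
    (by simp)
  simp only [one_mul, apply_left_eq_zero hφa, mul_zero, integral_zero] at h1 h2
  rw [integral_add hφ.integrable_dt.integrableOn hφ.integrable_dx.integrableOn] at h1
  rw [integral_add hφ.integrable_dt.integrableOn (hφ.integrable_dx.const_mul 2).integrableOn,
    integral_const_mul] at h2
  constructor <;> linarith

theorem mem_characteristic (hv : 0 < v) {p : ℝ × ℝ} (hp : p ∈ Ioo a b ×ˢ Ioo 0 T) :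
    p.2 - (p.1 - a) / v ∈ Ioo (-((b - a) / v)) T := by
  obtain ⟨⟨h1, h2⟩, h3, h4⟩ := hp
  have h5 : (p.1 - a) / v < (b - a) / v := div_lt_div_of_pos_right (by linarith) hv
  have h6 : 0 < (p.1 - a) / v := div_pos (by linarith) hv
  constructor <;> linarith

theorem sign_mul_self_eq_abs (r : ℝ) : Real.sign r * r = |r| := by
  rcases lt_trichotomy r 0 with h | h | h
  · rw [Real.sign_of_neg h, abs_of_neg h]; ring
  · simp [h]
  · rw [Real.sign_of_pos h, abs_of_pos h]; ring

/-- Transport of a piecewise constant profile with values below capacity. -/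
theorem isEntropySolution_transport (hv : 0 < v) (hμ : 0 ≤ μ) (hab : a < b) (hT : 0 < T)
    {E r₀ rin : ℝ → ℝ}
    (hE : IsPiecewiseConstant E (-((b - a) / v)) T)
    (hE0 : ∀ s ∈ Ioo (-((b - a) / v)) T, E s ∈ Icc 0 μ)
    (hr₀ : ∀ᵐ x ∂volume.restrict (Ioo a b), v * r₀ x = E ((a - x) / v))
    (hrin : ∀ t ∈ Ioo 0 T, v * rin t = E t) :
    IsEntropySolution (fun r => min μ (v * r)) a b T r₀ rin (fun x t => E (t - (x - a) / v) / v) := by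
  obtain ⟨g₀, hg₀, -, hEg₀⟩ := hE.exists_measurable
  -- A measurable representative, truncated so that the bounds hold for all labels and not only for
  -- those that occur in the rectangle.
  set g : ℝ → ℝ := fun s => max 0 (min (g₀ s) μ) with hgdef
  have hg : Measurable g := measurable_const.max (hg₀.min measurable_const)
  have hgI : ∀ s, g s ∈ Icc 0 μ := fun s => ⟨le_max_left _ _, max_le hμ (min_le_right _ _)⟩
  have hEg : ∀ s ∈ Ioo (-((b - a) / v)) T, E s = g s := fun s hs => by
    have := hE0 s hs
    rw [hgdef]; simp only
    rw [← hEg₀ s hs, min_eq_left this.2, max_eq_right this.1]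
  have hτ : 0 < (b - a) / v := div_pos (by linarith) hv
  have hΩ : MeasurableSet (Ioo a b ×ˢ Ioo 0 T) := measurableSet_Ioo.prod measurableSet_Ioo
  set h : ℝ → ℝ := fun s => g s / v with hh
  have hhm : Measurable h := hg.div_const v
  have hhI : ∀ s, h s ∈ Icc 0 (μ / v) := fun s =>
    ⟨div_nonneg (hgI s).1 hv.le, div_le_div_of_nonneg_right (hgI s).2 hv.le⟩
  have hvh : ∀ s, v * h s = g s := fun s => by simp only [hh]; field_simp
  have hflux : ∀ s, min μ (v * h s) = v * h s := fun s => by rw [hvh]; exact min_eq_right (hgI s).2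
  have hr : ∀ p ∈ Ioo a b ×ˢ Ioo 0 T, E (p.2 - (p.1 - a) / v) / v = h (p.2 - (p.1 - a) / v) :=
    fun p hp => by simp only [hEg _ (mem_characteristic hv hp), hh]
  have hr₀' : ∀ᵐ x ∂volume.restrict (Ioo a b), r₀ x = h ((a - x) / v) := by
    filter_upwards [hr₀, ae_restrict_mem measurableSet_Ioo] with x hx hxI
    have hm : (a - x) / v ∈ Ioo (-((b - a) / v)) T := by
      have h1 : (a - x) / v < 0 := div_neg_of_neg_of_pos (by linarith [hxI.1]) hv
      have h2 : (a - b) / v < (a - x) / v := div_lt_div_of_pos_right (by linarith [hxI.2]) hv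
      rw [show -((b - a) / v) = (a - b) / v by ring]
      exact ⟨h2, h1.trans hT⟩
    rw [hEg _ hm, ← hvh] at hx
    exact mul_left_cancel₀ hv.ne' hx
  have hrin' : ∀ t ∈ Ioo 0 T, v * rin t = v * h t := fun t ht => by
    rw [hrin t ht, hvh, hEg t ⟨by linarith [ht.1], ht.2⟩]
  have hhb : ∀ s, |h s| ≤ μ / v := fun s => by rw [abs_of_nonneg (hhI s).1]; exact (hhI s).2
  constructor
  · refine (((hhm.comp (f := fun p : ℝ × ℝ => p.2 - (p.1 - a) / v)
      (by fun_prop))).aestronglyMeasurable).congr ?_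
    filter_upwards [ae_restrict_mem hΩ] with p hp using (hr p hp).symm
  · refine ⟨μ / v, ?_⟩
    filter_upwards [ae_restrict_mem hΩ] with p hp
    rw [hr p hp]; exact hhI _
  · filter_upwards [ae_restrict_mem measurableSet_Ioo] with t ht
    have h1 : BoundedVariationOn (fun x => E (t - (x - a) / v)) (Ioo a b) := by
      refine ne_top_of_le_ne_top hE.boundedVariationOn
        (eVariationOn.comp_le_of_antitoneOn E (fun x => t - (x - a) / v) ?_ ?_)
      · intro x _ y _ hxy
        have : (x - a) / v ≤ (y - a) / v := div_le_div_of_nonneg_right (by linarith) hv.le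
        simp only; linarith
      · intro x hx
        exact mem_characteristic hv (p := (x, t)) ⟨hx, ht⟩
    have h2 := (lipschitzWith_iff_dist_le_mul.2 fun x y => le_of_eq (by
      rw [Real.dist_eq, Real.dist_eq, ← sub_div, abs_div, div_eq_inv_mul]
      simp only [coe_nnnorm, Real.norm_eq_abs, abs_inv]) :
        LipschitzWith ‖v⁻¹‖₊ fun x : ℝ => x / v).comp_boundedVariationOn h1
    exact h2
  · intro φ hφ
    have := integral_transport (a := a) hφ hv hhm hhb
    rw [← integral_const_mul] at this
    refine Eq.trans ?_ this
    congr 1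
    · congr 1
      · refine setIntegral_congr_fun hΩ fun p hp => ?_
        rw [hr p hp, hflux]; ring
      · refine integral_congr_ae ?_
        filter_upwards [hr₀'] with x hx using by rw [hx]
    · refine setIntegral_congr_fun measurableSet_Ioo fun t ht => ?_
      rw [hrin' t ht, hflux]; ring
  · intro k φ hφ hφa hφ0
    have hφa0 := apply_left_eq_zero hφa
    rcases le_or_gt k (μ / v) with hk | hk
    · have hk' : min μ (v * k) = v * k := min_eq_right (by rwa [le_div_iff₀' hv] at hk)
      have := integral_transport (a := a) hφ hv (h := fun s => |h s - k|)
        ((hhm.sub_const k).abs) (M := μ / v + |k|) (fun s => by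
          rw [abs_abs]; exact (abs_sub _ _).trans (by linarith [hhb s]))
      simp only [hφa0, mul_zero, integral_zero, add_zero] at this
      refine (Eq.trans ?_ this).ge
      congr 1
      · refine setIntegral_congr_fun hΩ fun p hp => ?_
        rw [hr p hp, hflux, hk', ← mul_sub, ← sign_mul_self_eq_abs]; ring
      · refine integral_congr_ae ?_
        filter_upwards [hr₀'] with x hx using by rw [hx]
    · have hk' : min μ (v * k) = μ := min_eq_left (by
        rw [div_lt_iff₀' hv] at hk; exact hk.le)
      have h1 := integral_transport (a := a) hφ hv hhm hhb
      obtain ⟨h2, h3⟩ := integral_dx_dt_of_test hφ hφa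
      simp only [hφa0, mul_zero, integral_zero, add_zero] at h1
      have e1 : ∀ p ∈ Ioo a b ×ˢ Ioo 0 T, |E (p.2 - (p.1 - a) / v) / v - k| * dt φ p
          + Real.sign (E (p.2 - (p.1 - a) / v) / v - k)
            * (min μ (v * (E (p.2 - (p.1 - a) / v) / v)) - min μ (v * k)) * dx φ p
          = (k * dt φ p + μ * dx φ p)
            - h (p.2 - (p.1 - a) / v) * (dt φ p + v * dx φ p) := fun p hp => by
        have hlt : h (p.2 - (p.1 - a) / v) - k < 0 := by linarith [(hhI (p.2 - (p.1 - a) / v)).2]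
        rw [hr p hp, hflux, hk', abs_of_neg hlt, Real.sign_of_neg hlt]
        ring
      have e2 : ∀ᵐ x ∂volume.restrict (Ioo a b), |r₀ x - k| * φ (x, 0)
          = k * φ (x, 0) - h ((a - x) / v) * φ (x, 0) := by
        filter_upwards [hr₀'] with x hx
        rw [hx, abs_of_neg (by linarith [(hhI ((a - x) / v)).2])]
        ring
      have i1 : IntegrableOn (fun p : ℝ × ℝ => h (p.2 - (p.1 - a) / v) * (dt φ p + v * dx φ p))
          (Ioo a b ×ˢ Ioo 0 T) :=
        ((hφ.integrable_dt.add (hφ.integrable_dx.const_mul v)).bdd_mul (c := μ / v)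
          (hhm.comp (f := fun p : ℝ × ℝ => p.2 - (p.1 - a) / v) (by fun_prop)).aestronglyMeasurable
          (Eventually.of_forall fun p => hhb _)).integrableOn
      have i2 : IntegrableOn (fun x => h ((a - x) / v) * φ (x, 0)) (Ioo a b) :=
        (hφ.integrable_slice.bdd_mul (c := μ / v)
          (hhm.comp (f := fun x : ℝ => (a - x) / v) (by fun_prop)).aestronglyMeasurable
          (Eventually.of_forall fun p => hhb _)).integrableOn
      rw [setIntegral_congr_fun hΩ e1, integral_congr_ae e2,
        integral_sub (f := fun p => k * dt φ p + μ * dx φ p)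
          ((hφ.integrable_dt.const_mul k).add (hφ.integrable_dx.const_mul μ)).integrableOn i1,
        integral_add (hφ.integrable_dt.const_mul k).integrableOn
          (hφ.integrable_dx.const_mul μ).integrableOn,
        integral_sub (hφ.integrable_slice.const_mul k).integrableOn i2,
        integral_const_mul, integral_const_mul, integral_const_mul]
      rw [h2]
      linarith [congrArg (k * ·) h3]

end TransportSolution

/-! ### Uniqueness of outflow traces -/

section Uniqueness

variable {a b v μ T : ℝ}

/-- The tail is the integral of `g` from `x` to `U`. It serves to build test functions with a
prescribed derivative that vanish near the terminal boundary. -/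
theorem exists_tail {g : ℝ → ℝ} (hg : Continuous g) {U : ℝ} (hU : ∀ x, U ≤ x → g x = 0) :
    ∃ θ : ℝ → ℝ, ContDiff ℝ 1 θ ∧ (∀ x, HasDerivAt θ (-g x) x) ∧ (∀ x, U ≤ x → θ x = 0) ∧
      ((∀ x, 0 ≤ g x) → ∀ x, 0 ≤ θ x) := by
  have hd : ∀ x, HasDerivAt (fun x => ∫ y in x..U, g y) (-g x) x := fun x =>
    intervalIntegral.integral_hasDerivAt_left (hg.intervalIntegrable _ _)
      (hg.stronglyMeasurableAtFilter _ _) hg.continuousAt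
  have h0 : ∀ x, U ≤ x → ∫ y in x..U, g y = 0 := fun x hx => by
    rw [intervalIntegral.integral_symm, intervalIntegral.integral_congr (g := fun _ => 0)]
    · simp
    · intro y hy
      rw [uIcc_of_le hx] at hy
      exact hU y hy.1
  refine ⟨fun x => ∫ y in x..U, g y, ?_, hd, h0, fun hpos x => ?_⟩
  · rw [contDiff_one_iff_deriv]
    refine ⟨fun x => (hd x).differentiableAt, ?_⟩
    rw [funext fun x => (hd x).deriv]
    exact hg.neg
  · rcases le_total x U with h | h
    · exact intervalIntegral.integral_nonneg h fun y _ => hpos y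
    · exact (h0 x h).ge

theorem exists_Icc_of_tsupport_subset {g : ℝ → ℝ} {l u : ℝ} (hlu : l < u)
    (hg : HasCompactSupport g) (h : tsupport g ⊆ Ioo l u) :
    ∃ s₁ s₂, l < s₁ ∧ s₂ < u ∧ ∀ x, x ∉ Icc s₁ s₂ → g x = 0 := by
  rcases (tsupport g).eq_empty_or_nonempty with he | hne
  · refine ⟨(l + u) / 2, (l + u) / 2, by linarith, by linarith, fun x _ => ?_⟩
    exact image_eq_zero_of_notMem_tsupport (by simp [he])
  · obtain ⟨s₁, h1⟩ := hg.isCompact.exists_isLeast hne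
    obtain ⟨s₂, h2⟩ := hg.isCompact.exists_isGreatest hne
    exact ⟨s₁, s₂, (h h1.1).1, (h h2.1).2, fun x hx =>
      image_eq_zero_of_notMem_tsupport fun hx' => hx ⟨h1.2 hx', h2.2 hx'⟩⟩

/-- A cutoff that equals one at nonnegative times and vanishes before time `-1`. -/
def pastCutoff (t : ℝ) : ℝ := Real.smoothTransition (t + 1)

theorem pastCutoff_of_nonneg {t : ℝ} (ht : 0 ≤ t) : pastCutoff t = 1 :=
  Real.smoothTransition.one_of_one_le (by linarith)

theorem pastCutoff_of_le {t : ℝ} (ht : t ≤ -1) : pastCutoff t = 0 :=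
  Real.smoothTransition.zero_of_nonpos (by linarith)

theorem contDiff_pastCutoff : ContDiff ℝ 1 pastCutoff :=
  (Real.smoothTransition.contDiff (n := 1)).comp (contDiff_id.add contDiff_const)

theorem fderiv_apply_of_line {φ : ℝ × ℝ → ℝ} (hφ : ContDiff ℝ 1 φ) (p w : ℝ × ℝ) {g : ℝ → ℝ} {g' : ℝ}
    (hg : HasDerivAt g g' 0) (h : ∀ᶠ s in 𝓝 (0 : ℝ), φ (p + s • w) = g s) :
    fderiv ℝ φ p w = g' := by
  have h1 : HasDerivAt (fun s : ℝ => p + s • w) w 0 := by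
    simpa using ((hasDerivAt_id (0 : ℝ)).smul_const w).const_add p
  have h2 : HasDerivAt (fun s : ℝ => φ (p + s • w)) (fderiv ℝ φ p w) 0 := by
    have h3 := (hφ.differentiable one_ne_zero (p + (0 : ℝ) • w)).hasFDerivAt.comp_hasDerivAt (0 : ℝ) h1
    rw [zero_smul, add_zero] at h3
    exact h3
  exact h2.unique (hg.congr_of_eventuallyEq h)

theorem restrict_prod_eq (a b T : ℝ) : (volume : Measure (ℝ × ℝ)).restrict (Ioo a b ×ˢ Ioo 0 T)
    = (volume.restrict (Ioo a b)).prod (volume.restrict (Ioo 0 T)) := by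
  rw [Measure.volume_eq_prod, Measure.prod_restrict]

theorem IsEntropySolution.integrableOn_mul {f r₀ rin : ℝ → ℝ} {r : ℝ → ℝ → ℝ}
    (hr : IsEntropySolution f a b T r₀ rin r) (g : ℝ → ℝ) (hg : Continuous g) {c : ℝ × ℝ → ℝ}
    (hc : Integrable c) :
    IntegrableOn (fun p : ℝ × ℝ => g (r p.1 p.2) * c p) (Ioo a b ×ˢ Ioo 0 T) := by
  obtain ⟨M, hM⟩ := hr.bounded
  obtain ⟨K, hK⟩ := (isCompact_Icc (a := (0 : ℝ)) (b := M)).exists_bound_of_continuousOn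
    hg.continuousOn
  refine hc.integrableOn.bdd_mul (c := K) (hg.comp_aestronglyMeasurable hr.measurable) ?_
  filter_upwards [hM] with p hp using hK _ hp

/-- Add the weak formulation to the entropy inequality at the critical density `k = μ / v`. The
densities combine to `2 * max (r - k) 0 + k`, while the fluxes combine to the constant `μ` and drop
out. Hence the excess over capacity is not transported and can only decrease in time; initially
there is none. -/
theorem IsEntropySolution.integral_excess_nonneg {r₀ rin : ℝ → ℝ} {r : ℝ → ℝ → ℝ} (hv : 0 < v)
    (hr : IsEntropySolution (fun r => min μ (v * r)) a b T r₀ rin r)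
    (hr₀m : AEStronglyMeasurable r₀ (volume.restrict (Ioo a b)))
    (hr₀ : ∀ᵐ x ∂volume.restrict (Ioo a b), r₀ x ∈ Icc 0 (μ / v))
    {φ : ℝ × ℝ → ℝ} (hφ : IsTest φ b T) (hφa : tsupport φ ⊆ {p | a < p.1}) (hφ0 : ∀ p, 0 ≤ φ p) :
    0 ≤ ∫ p in Ioo a b ×ˢ Ioo 0 T, max (r p.1 p.2 - μ / v) 0 * dt φ p := by
  set k := μ / v with hk
  have hvk : v * k = μ := by rw [hk]; field_simp
  have hw := hr.weak φ hφ
  have he := hr.entropy k φ hφ hφa hφ0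
  obtain ⟨h2, h3⟩ := integral_dx_dt_of_test hφ hφa
  simp only [apply_left_eq_zero hφa, mul_zero, integral_zero, add_zero] at hw
  have hfk : min μ (v * k) = μ := by rw [hvk, min_self]
  have hsgn : ∀ s : ℝ, Real.sign (s - k) * (min μ (v * s) - μ) = v * max (k - s) 0 := by
    intro s
    rcases lt_trichotomy s k with h | h | h
    · have : v * s ≤ μ := by rw [← hvk]; exact mul_le_mul_of_nonneg_left h.le hv.le
      rw [Real.sign_of_neg (by linarith), min_eq_right this, max_eq_left (by linarith), ← hvk]
      ring
    · simp [h]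
    · have : μ ≤ v * s := by rw [← hvk]; exact mul_le_mul_of_nonneg_left h.le hv.le
      rw [min_eq_left this, max_eq_right (by linarith)]; ring
  simp only [hfk, hsgn] at he
  have i1 := hr.integrableOn_mul (fun s => |s - k|) (by fun_prop) hφ.integrable_dt
  have i2 := hr.integrableOn_mul (fun s => v * max (k - s) 0) (by fun_prop) hφ.integrable_dx
  have i3 := hr.integrableOn_mul (fun s => s) (by fun_prop) hφ.integrable_dt
  have i4 := hr.integrableOn_mul (fun s => min μ (v * s)) (by fun_prop) hφ.integrable_dx
  have i5 := hr.integrableOn_mul (fun s => max (s - k) 0) (by fun_prop) hφ.integrable_dt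
  have j1 : IntegrableOn (fun x => r₀ x * φ (x, 0)) (Ioo a b) := by
    refine hφ.integrable_slice.integrableOn.bdd_mul (c := k) hr₀m ?_
    filter_upwards [hr₀] with x hx
    rw [Real.norm_eq_abs, abs_of_nonneg hx.1]; exact hx.2
  have e1 : (∫ x in Ioo a b, |r₀ x - k| * φ (x, 0))
      = k * (∫ x in Ioo a b, φ (x, 0)) - ∫ x in Ioo a b, r₀ x * φ (x, 0) := by
    rw [← integral_const_mul, ← integral_sub (hφ.integrable_slice.const_mul k).integrableOn j1]
    refine integral_congr_ae ?_
    filter_upwards [hr₀] with x hx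
    rw [abs_of_nonpos (by linarith [hx.2])]; ring
  have e2 : (∫ p in Ioo a b ×ˢ Ioo 0 T, (|r p.1 p.2 - k| * dt φ p + v * max (k - r p.1 p.2) 0 * dx φ p))
      + (∫ p in Ioo a b ×ˢ Ioo 0 T, (r p.1 p.2 * dt φ p + min μ (v * r p.1 p.2) * dx φ p))
      = 2 * (∫ p in Ioo a b ×ˢ Ioo 0 T, max (r p.1 p.2 - k) 0 * dt φ p)
        + k * (∫ p in Ioo a b ×ˢ Ioo 0 T, dt φ p) + μ * ∫ p in Ioo a b ×ˢ Ioo 0 T, dx φ p := by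
    have l1 := integral_add (i1.add i2) (i3.add i4)
    have l2 := integral_add ((i5.const_mul 2).add (hφ.integrable_dt.const_mul k).integrableOn)
      (hφ.integrable_dx.const_mul μ).integrableOn
    have l3 := integral_add (i5.const_mul 2) (hφ.integrable_dt.const_mul k).integrableOn
    simp only [Pi.add_apply] at l1 l2
    rw [← integral_const_mul, ← integral_const_mul, ← integral_const_mul, ← l3, ← l2, ← l1]
    refine integral_congr_ae (Eventually.of_forall fun p => ?_)
    beta_reduce
    rcases le_total (r p.1 p.2) k with h | h
    · have : v * r p.1 p.2 ≤ μ := by rw [← hvk]; exact mul_le_mul_of_nonneg_left h hv.le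
      rw [abs_of_nonpos (by linarith), max_eq_left (by linarith), max_eq_right (by linarith),
        min_eq_right this, ← hvk]
      ring
    · have : μ ≤ v * r p.1 p.2 := by rw [← hvk]; exact mul_le_mul_of_nonneg_left h hv.le
      rw [abs_of_nonneg (by linarith), max_eq_right (by linarith), max_eq_left (by linarith),
        min_eq_left this]
      ring
  rw [e1] at he
  rw [h2] at e2
  linarith [congrArg (k * ·) h3]

/-- Near any point choose a test function whose time derivative is minus a product of two bumps. The
integral of the excess against it is nonnegative by `integral_excess_nonneg` and nonpositive by
sign, so the excess vanishes where the bumps are positive. -/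
theorem IsEntropySolution.le_capacity {r₀ rin : ℝ → ℝ} {r : ℝ → ℝ → ℝ} (hv : 0 < v)
    (hr : IsEntropySolution (fun r => min μ (v * r)) a b T r₀ rin r)
    (hr₀m : AEStronglyMeasurable r₀ (volume.restrict (Ioo a b)))
    (hr₀ : ∀ᵐ x ∂volume.restrict (Ioo a b), r₀ x ∈ Icc 0 (μ / v)) :
    ∀ᵐ p : ℝ × ℝ ∂volume.restrict (Ioo a b ×ˢ Ioo 0 T), v * r p.1 p.2 ≤ μ := by
  have hΩ : MeasurableSet (Ioo a b ×ˢ Ioo 0 T) := measurableSet_Ioo.prod measurableSet_Ioo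
  set s : Set (ℝ × ℝ) := {p | p ∈ Ioo a b ×ˢ Ioo 0 T ∧ μ / v < r p.1 p.2} with hs
  suffices h : volume s = 0 by
    rw [ae_restrict_iff' hΩ]
    filter_upwards [measure_eq_zero_iff_ae_notMem.1 h] with p hp hpΩ
    by_contra! hcon
    exact hp ⟨hpΩ, by rwa [div_lt_iff₀' hv]⟩
  apply measure_null_of_locally_null
  rintro p ⟨hpΩ, -⟩
  obtain ⟨ε₁, hε₁, hb₁⟩ := Metric.isOpen_iff.1 isOpen_Ioo p.1 hpΩ.1
  obtain ⟨ε₂, hε₂, hb₂⟩ := Metric.isOpen_iff.1 isOpen_Ioo p.2 hpΩ.2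
  let α : ContDiffBump p.1 := ⟨ε₁ / 4, ε₁ / 2, by linarith, by linarith⟩
  let g : ContDiffBump p.2 := ⟨ε₂ / 4, ε₂ / 2, by linarith, by linarith⟩
  have hα : tsupport α ⊆ Ioo a b := by
    rw [α.tsupport_eq]
    exact (Metric.closedBall_subset_ball (by simp only [α]; linarith)).trans hb₁
  have hg : tsupport g ⊆ Ioo 0 T := by
    rw [g.tsupport_eq]
    exact (Metric.closedBall_subset_ball (by simp only [g]; linarith)).trans hb₂
  obtain ⟨s₁, s₂, hs₁, hs₂, hgs⟩ := exists_Icc_of_tsupport_subset (hpΩ.2.1.trans hpΩ.2.2)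
    g.hasCompactSupport hg
  set U := (s₂ + T) / 2 with hU
  obtain ⟨θ, hθc, hθd, hθ0, hθpos⟩ := exists_tail (g := g) g.continuous (U := U)
    fun x hx => hgs x fun h => by linarith [h.2]
  -- The tail `θ` does not vanish at early times; `pastCutoff` makes the support compact without
  -- changing `φ` for `0 ≤ t`.
  set φ : ℝ × ℝ → ℝ := fun p => α p.1 * (pastCutoff p.2 * θ p.2) with hφdef
  have hφK : ∀ q, φ q ≠ 0 → q ∈ tsupport α ×ˢ Icc (-1) U := by
    intro q hq
    refine ⟨subset_tsupport _ fun h => hq (by simp [hφdef, h]), ?_, ?_⟩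
    · by_contra! h
      exact hq (by simp [hφdef, pastCutoff_of_le h.le])
    · by_contra! h
      exact hq (by simp [hφdef, hθ0 _ h.le])
  have hKc : IsCompact (tsupport α ×ˢ Icc (-1) U) := α.hasCompactSupport.isCompact.prod isCompact_Icc
  have hφt : tsupport φ ⊆ tsupport α ×ˢ Icc (-1) U := closure_minimal hφK hKc.isClosed
  have hφ : IsTest φ b T := by
    refine ⟨?_, HasCompactSupport.of_support_subset_isCompact hKc hφK, fun q hq => ?_⟩
    · exact ((α.contDiff (n := 1)).comp contDiff_fst).mul
        ((contDiff_pastCutoff.comp contDiff_snd).mul (hθc.comp contDiff_snd))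
    · have := hφt hq
      exact ⟨(hα this.1).2, by linarith [this.2.2]⟩
  have hφ0 : ∀ q, 0 ≤ φ q := fun q => mul_nonneg (α.nonneg) (mul_nonneg
    (Real.smoothTransition.nonneg _) (hθpos (fun _ => g.nonneg) _))
  have hdt : ∀ q ∈ Ioo a b ×ˢ Ioo 0 T, dt φ q = -(α q.1 * g q.2) := by
    intro q hq
    refine fderiv_apply_of_line hφ.contDiff q (0, 1) (g := fun s => α q.1 * θ (q.2 + s)) ?_ ?_
    · have h1 : HasDerivAt (fun s => θ (q.2 + s)) (-g q.2) 0 := by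
        have := (hθd (q.2 + 0)).comp_const_add q.2 0
        simpa using this
      rw [← mul_neg]
      exact h1.const_mul _
    · filter_upwards [Ioi_mem_nhds (neg_lt_zero.2 hq.2.1)] with s hs
      have : 0 ≤ q.2 + s := by linarith [mem_Ioi.1 hs]
      simp [hφdef, pastCutoff_of_nonneg this]
  have hint := hr.integral_excess_nonneg hv hr₀m hr₀ hφ (fun q hq => (hα (hφt hq).1).1) hφ0
  have hi := hr.integrableOn_mul (fun s => max (s - μ / v) 0) (by fun_prop) hφ.integrable_dt
  have hzero : (fun q : ℝ × ℝ => -(max (r q.1 q.2 - μ / v) 0 * dt φ q))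
      =ᵐ[volume.restrict (Ioo a b ×ˢ Ioo 0 T)] 0 := by
    have hnn : 0 ≤ᵐ[volume.restrict (Ioo a b ×ˢ Ioo 0 T)]
        (fun q : ℝ × ℝ => -(max (r q.1 q.2 - μ / v) 0 * dt φ q)) := by
      filter_upwards [ae_restrict_mem hΩ] with q hq
      rw [hdt q hq, Pi.zero_apply, mul_neg, neg_neg]
      exact mul_nonneg (le_max_right _ _) (mul_nonneg α.nonneg g.nonneg)
    rw [← integral_eq_zero_iff_of_nonneg_ae hnn hi.neg]
    refine le_antisymm ?_ (integral_nonneg_of_ae hnn)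
    rw [integral_neg]
    linarith
  refine ⟨s ∩ (Metric.ball p.1 α.rOut ×ˢ Metric.ball p.2 g.rOut), inter_mem self_mem_nhdsWithin
    (nhdsWithin_le_nhds (prod_mem_nhds (Metric.ball_mem_nhds _ α.rOut_pos)
      (Metric.ball_mem_nhds _ g.rOut_pos))), ?_⟩
  rw [measure_eq_zero_iff_ae_notMem]
  rw [EventuallyEq, ae_restrict_iff' hΩ] at hzero
  filter_upwards [hzero] with q hq hqs
  have h1 := hq hqs.1.1
  rw [hdt q hqs.1.1, Pi.zero_apply, mul_neg, neg_neg] at h1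
  have h2 : 0 < max (r q.1 q.2 - μ / v) 0 := lt_max_of_lt_left (sub_pos.2 hqs.1.2)
  exact (mul_pos h2 (mul_pos (α.pos_of_mem_ball hqs.2.1) (g.pos_of_mem_ball hqs.2.2))).ne' h1

end Uniqueness

/-! ### Essential limits and uniqueness of the outflow trace -/

section Traces

variable {a b v μ T : ℝ}

/-- A one-sided neighbourhood has positive measure and thus meets every conull set. Nontriviality of
the filter is what makes the limits in `essLeft` unique. -/
theorem neBot_nhdsLT_inf_ae (t : ℝ) : (𝓝[<] t ⊓ ae (volume : Measure ℝ)).NeBot := by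
  rw [inf_neBot_iff]
  intro s hs s' hs'
  obtain ⟨l, hl, hls⟩ := mem_nhdsLT_iff_exists_Ioo_subset.1 hs
  by_contra hcon
  rw [not_nonempty_iff_eq_empty] at hcon
  have h1 : Ioo l t ⊆ s'ᶜ := fun x hx hx' => by
    have : x ∈ s ∩ s' := ⟨hls hx, hx'⟩
    rw [hcon] at this; exact this
  have h2 := measure_mono_null h1 (mem_ae_iff.1 hs')
  rw [Real.volume_Ioo, ENNReal.ofReal_eq_zero] at h2
  linarith [mem_Iio.1 hl]

theorem neBot_nhdsGT_inf_ae (t : ℝ) : (𝓝[>] t ⊓ ae (volume : Measure ℝ)).NeBot := by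
  rw [inf_neBot_iff]
  intro s hs s' hs'
  obtain ⟨u, hu, hus⟩ := mem_nhdsGT_iff_exists_Ioo_subset.1 hs
  by_contra hcon
  rw [not_nonempty_iff_eq_empty] at hcon
  have h1 : Ioo t u ⊆ s'ᶜ := fun x hx hx' => by
    have : x ∈ s ∩ s' := ⟨hus hx, hx'⟩
    rw [hcon] at this; exact this
  have h2 := measure_mono_null h1 (mem_ae_iff.1 hs')
  rw [Real.volume_Ioo, ENNReal.ofReal_eq_zero] at h2
  linarith [mem_Ioi.1 hu]

theorem exists_seq_of_ae_restrict {P : ℝ → Prop} (hab : a < b)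
    (h : ∀ᵐ x ∂volume.restrict (Ioo a b), P x) :
    ∃ x : ℕ → ℝ, Tendsto x atTop (𝓝[<] b) ∧ ∀ n, x n ∈ Ioo a b ∧ P (x n) := by
  rw [ae_restrict_iff' measurableSet_Ioo] at h
  have := neBot_nhdsLT_inf_ae b
  have h1 : ∀ᶠ x in 𝓝[<] b ⊓ ae (volume : Measure ℝ), x ∈ Ioo a b ∧ P x := by
    filter_upwards [mem_inf_of_left (Ioo_mem_nhdsLT hab), mem_inf_of_right h] with x h1 h2
      using ⟨h1, h2 h1⟩
  exact exists_seq_forall_of_frequently (h1.frequently.filter_mono inf_le_left)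

theorem _root_.BoundedVariationOn.tendsto_leftLim_Ioo {f : ℝ → ℝ} (hab : a < b)
    (hf : BoundedVariationOn f (Ioo a b)) :
    Tendsto f (𝓝[<] b) (𝓝 (Function.leftLim f b)) := by
  apply tendsto_leftLim_of_tendsto
  have := hf.exists_tendsto_left b
  have he : Ioo a b ∩ Iio b = Ioo a b := inter_eq_left.2 fun x hx => hx.2
  rwa [he, nhdsWithin_Ioo_eq_nhdsLT hab] at this

/-- Below capacity the flux is linear, so the difference of two solutions with the same data solves
the homogeneous transport equation weakly. -/
theorem IsEntropySolution.integral_sub_mul_fderiv {r₀ rin₁ rin₂ : ℝ → ℝ} {r₁ r₂ : ℝ → ℝ → ℝ}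
    (h₁ : IsEntropySolution (fun r => min μ (v * r)) a b T r₀ rin₁ r₁)
    (h₂ : IsEntropySolution (fun r => min μ (v * r)) a b T r₀ rin₂ r₂) 
    (hc₁ : ∀ᵐ p : ℝ × ℝ ∂volume.restrict (Ioo a b ×ˢ Ioo 0 T), v * r₁ p.1 p.2 ≤ μ)
    (hc₂ : ∀ᵐ p : ℝ × ℝ ∂volume.restrict (Ioo a b ×ˢ Ioo 0 T), v * r₂ p.1 p.2 ≤ μ)
    (hrin : ∀ᵐ t ∂volume.restrict (Ioo 0 T), rin₁ t = rin₂ t) {φ : ℝ × ℝ → ℝ}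
    (hφ : IsTest φ b T) :
    ∫ p in Ioo a b ×ˢ Ioo 0 T, (r₁ p.1 p.2 - r₂ p.1 p.2) * fderiv ℝ φ p (v, 1) = 0 := by
  have hint : Integrable (fun p => fderiv ℝ φ p (v, 1)) :=
    (hφ.continuous_fderiv_apply _).integrable_of_hasCompactSupport
      (hφ.hasCompactSupport_fderiv_apply _)
  have key : ∀ {r : ℝ → ℝ → ℝ}, (∀ᵐ p : ℝ × ℝ ∂volume.restrict (Ioo a b ×ˢ Ioo 0 T),
      v * r p.1 p.2 ≤ μ) → (∫ p in Ioo a b ×ˢ Ioo 0 T,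
        (r p.1 p.2 * dt φ p + min μ (v * r p.1 p.2) * dx φ p))
      = ∫ p in Ioo a b ×ˢ Ioo 0 T, r p.1 p.2 * fderiv ℝ φ p (v, 1) := by
    intro r hr
    refine integral_congr_ae ?_
    filter_upwards [hr] with p hp
    rw [min_eq_right hp, ← dt_add_mul_dx]; ring
  have e1 := h₁.weak φ hφ
  have e2 := h₂.weak φ hφ
  rw [key hc₁] at e1
  rw [key hc₂] at e2
  have e3 : (∫ t in Ioo 0 T, min μ (v * rin₁ t) * φ (a, t))
      = ∫ t in Ioo 0 T, min μ (v * rin₂ t) * φ (a, t) := by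
    refine integral_congr_ae ?_
    filter_upwards [hrin] with t ht using by rw [ht]
  have i1 := h₁.integrableOn_mul (fun s => s) continuous_id hint
  have i2 := h₂.integrableOn_mul (fun s => s) continuous_id hint
  have := integral_sub i1 i2
  rw [show (∫ p in Ioo a b ×ˢ Ioo 0 T, (r₁ p.1 p.2 - r₂ p.1 p.2) * fderiv ℝ φ p (v, 1))
    = ∫ p in Ioo a b ×ˢ Ioo 0 T, (r₁ p.1 p.2 * fderiv ℝ φ p (v, 1)
      - r₂ p.1 p.2 * fderiv ℝ φ p (v, 1)) by simp only [sub_mul], this]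
  linarith

/-- Averages over characteristics of a solution of the homogeneous transport equation. -/
theorem ae_integral_characteristic_eq_zero (hv : 0 < v) (hab : a < b) {w : ℝ × ℝ → ℝ}
    (hw : IntegrableOn w (Ioo a b ×ˢ Ioo 0 T))
    (hwφ : ∀ φ : ℝ × ℝ → ℝ, IsTest φ b T →
      ∫ p in Ioo a b ×ˢ Ioo 0 T, w p * fderiv ℝ φ p (v, 1) = 0)
    {A : ℝ → ℝ} (hA : ContDiff ℝ 1 A) (hAc : HasCompactSupport A) (hT : 0 < T)
    (hAs : tsupport A ⊆ Ioo (-((b - a) / v)) (T - (b - a) / v)) :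
    ∀ᵐ x ∂volume.restrict (Ioo a b), ∫ t in Ioo 0 T, w (x, t) * A (t - (x - a) / v) = 0 := by
  have hΩ : MeasurableSet (Ioo a b ×ˢ Ioo 0 T) := measurableSet_Ioo.prod measurableSet_Ioo
  obtain ⟨KA, hKA⟩ := hA.continuous.bounded_above_of_compact_support hAc
  have hwA : IntegrableOn (fun p : ℝ × ℝ => w p * A (p.2 - (p.1 - a) / v))
      (Ioo a b ×ˢ Ioo 0 T) := by
    refine hw.mul_bdd (c := KA) ?_ (Eventually.of_forall fun p => hKA _)
    exact (hA.continuous.comp (by fun_prop)).aestronglyMeasurable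
  set k : ℝ → ℝ := fun x => ∫ t in Ioo 0 T, w (x, t) * A (t - (x - a) / v) with hk
  have hkint : IntegrableOn k (Ioo a b) := by
    rw [IntegrableOn, restrict_prod_eq] at hwA
    exact hwA.integral_prod_left
  rw [ae_restrict_iff' measurableSet_Ioo]
  refine isOpen_Ioo.ae_eq_zero_of_integral_contDiff_smul_eq_zero hkint.locallyIntegrableOn
    fun Θ hΘ hΘc hΘs => ?_
  obtain ⟨x₁, x₂, hx₁, hx₂, hΘ0⟩ := exists_Icc_of_tsupport_subset hab hΘc hΘs
  obtain ⟨s₁, s₂, hs₁, hs₂, hA0⟩ := exists_Icc_of_tsupport_subset (by linarith) hAc hAs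
  set U := (x₂ + b) / 2 with hU
  obtain ⟨θ, hθc, hθd, hθ0, -⟩ := exists_tail hΘ.continuous (U := U)
    fun x hx => hΘ0 x fun h => by linarith [h.2]
  -- The factor `A` is constant on characteristics, so differentiation along `(v, 1)` hits only the
  -- tail `θ` of `Θ`. The support condition on `A` selects labels that reach `b` before `T`, which
  -- keeps the support below `T`.
  set φ : ℝ × ℝ → ℝ := fun p => A (p.2 - (p.1 - a) / v) * (pastCutoff p.2 * θ p.1) with hφdef
  set K : Set (ℝ × ℝ) := {p | p.2 - (p.1 - a) / v ∈ Icc s₁ s₂ ∧ -1 ≤ p.2 ∧ p.1 ≤ U} with hKdef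
  have hKcl : IsClosed K := by
    refine (isClosed_Icc.preimage (by fun_prop)).inter (IsClosed.inter ?_ ?_)
    · exact isClosed_le continuous_const continuous_snd
    · exact isClosed_le continuous_fst continuous_const
  have hKT : ∀ p ∈ K, p.1 < b ∧ p.2 < T := by
    rintro p ⟨h1, -, h3⟩
    have : (p.1 - a) / v < (b - a) / v := div_lt_div_of_pos_right (by linarith) hv
    exact ⟨by linarith, by linarith [h1.2]⟩
  have hKc : IsCompact K := by
    refine (isCompact_Icc (a := a + v * (-1 - s₂)) (b := b)).prod
      (isCompact_Icc (a := (-1 : ℝ)) (b := T)) |>.of_isClosed_subset hKcl fun p hp => ?_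
    have h1 := hKT p hp
    refine ⟨⟨?_, h1.1.le⟩, hp.2.1, h1.2.le⟩
    have h2 : -1 - s₂ ≤ (p.1 - a) / v := by linarith [hp.1.2, hp.2.1]
    rw [le_div_iff₀ hv] at h2
    linarith
  have hφK : ∀ q, φ q ≠ 0 → q ∈ K := by
    intro q hq
    refine ⟨?_, ?_, ?_⟩
    · by_contra h
      exact hq (by simp [hφdef, hA0 _ h])
    · by_contra! h
      exact hq (by simp [hφdef, pastCutoff_of_le h.le])
    · by_contra! h
      exact hq (by simp [hφdef, hθ0 _ h.le])
  have hφ : IsTest φ b T := by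
    refine ⟨?_, HasCompactSupport.of_support_subset_isCompact hKc hφK, fun q hq => ?_⟩
    · exact (hA.comp (contDiff_snd.sub ((contDiff_fst.sub contDiff_const).div_const v))).mul
        ((contDiff_pastCutoff.comp contDiff_snd).mul (hθc.comp contDiff_fst))
    · exact hKT q (closure_minimal hφK hKcl hq)
  have hd : ∀ q ∈ Ioo a b ×ˢ Ioo 0 T, fderiv ℝ φ q (v, 1)
      = -v * (A (q.2 - (q.1 - a) / v) * Θ q.1) := by
    intro q hq
    refine fderiv_apply_of_line hφ.contDiff q (v, 1)
      (g := fun s => A (q.2 - (q.1 - a) / v) * θ (q.1 + s * v)) ?_ ?_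
    · have h1 : HasDerivAt (fun s => θ (q.1 + s * v)) (-Θ q.1 * v) 0 := by
        have h2 : HasDerivAt (fun s : ℝ => q.1 + s * v) v 0 := by
          simpa using ((hasDerivAt_id (0 : ℝ)).mul_const v).const_add q.1
        have h3 := (hθd (q.1 + 0 * v)).comp (0 : ℝ) h2
        rw [zero_mul, add_zero] at h3
        exact h3
      rw [show -v * (A (q.2 - (q.1 - a) / v) * Θ q.1) = A (q.2 - (q.1 - a) / v) * (-Θ q.1 * v) by
        ring]
      exact h1.const_mul _
    · filter_upwards [Ioi_mem_nhds (neg_lt_zero.2 hq.2.1)] with s hs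
      have h0 : 0 ≤ q.2 + s := by linarith [mem_Ioi.1 hs]
      have h1 : q.2 + s - (q.1 + s * v - a) / v = q.2 - (q.1 - a) / v := by field_simp; ring
      simp [hφdef, pastCutoff_of_nonneg h0, h1]
  have h0 := hwφ φ hφ
  rw [setIntegral_congr_fun (g := fun q => -v * (w q * A (q.2 - (q.1 - a) / v) * Θ q.1)) hΩ
    (fun q hq => by simp only [hd q hq]; ring), integral_const_mul] at h0
  have h1 : (∫ q in Ioo a b ×ˢ Ioo 0 T, w q * A (q.2 - (q.1 - a) / v) * Θ q.1) = 0 :=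
    (mul_eq_zero.1 h0).resolve_left (neg_ne_zero.2 hv.ne')
  obtain ⟨KΘ, hKΘ⟩ := hΘ.continuous.bounded_above_of_compact_support hΘc
  have hI : Integrable (fun q : ℝ × ℝ => w q * A (q.2 - (q.1 - a) / v) * Θ q.1)
      ((volume.restrict (Ioo a b)).prod (volume.restrict (Ioo 0 T))) := by
    rw [← restrict_prod_eq]
    exact hwA.mul_bdd (c := KΘ) (hΘ.continuous.comp continuous_fst).aestronglyMeasurable
      (Eventually.of_forall fun p => hKΘ _)
  rw [restrict_prod_eq, integral_prod _ hI] at h1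
  simp only [integral_mul_const] at h1
  have h2 : ∫ x, Θ x • k x = ∫ x in Ioo a b, k x * Θ x := by
    rw [← integral_indicator measurableSet_Ioo]
    refine integral_congr_ae (Eventually.of_forall fun x => ?_)
    by_cases hx : x ∈ Ioo a b
    · simp only [indicator_of_mem hx, smul_eq_mul, mul_comm]
    · have : Θ x = 0 := image_eq_zero_of_notMem_tsupport fun h => hx (hΘs h)
      simp [indicator_of_notMem hx, this]
  rw [h2]
  exact h1

/-- Averages over characteristics of the difference vanish on almost every cross section. Along
cross sections tending to `b` the slices converge, by bounded variation, to the difference of the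
traces, and dominated convergence transfers the vanishing to it. -/
theorem IsEntropySolution.leftLim_eq {r₀ rin₁ rin₂ : ℝ → ℝ} {r₁ r₂ : ℝ → ℝ → ℝ}
    (hv : 0 < v) (hab : a < b) (hT : 0 < T)
    (h₁ : IsEntropySolution (fun r => min μ (v * r)) a b T r₀ rin₁ r₁)
    (h₂ : IsEntropySolution (fun r => min μ (v * r)) a b T r₀ rin₂ r₂)
    (hr₀m : AEStronglyMeasurable r₀ (volume.restrict (Ioo a b)))
    (hr₀ : ∀ᵐ x ∂volume.restrict (Ioo a b), r₀ x ∈ Icc 0 (μ / v))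
    (hrin : ∀ᵐ t ∂volume.restrict (Ioo 0 T), rin₁ t = rin₂ t) :
    ∀ᵐ t ∂volume.restrict (Ioo 0 T),
      Function.leftLim (fun x => r₁ x t) b = Function.leftLim (fun x => r₂ x t) b := by
  obtain ⟨M₁, hM₁⟩ := h₁.bounded
  obtain ⟨M₂, hM₂⟩ := h₂.bounded
  set w : ℝ × ℝ → ℝ := fun p => r₁ p.1 p.2 - r₂ p.1 p.2 with hwdef
  have hwm : AEStronglyMeasurable w (volume.restrict (Ioo a b ×ˢ Ioo 0 T)) :=
    h₁.measurable.sub h₂.measurable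
  have hwM : ∀ᵐ p ∂volume.restrict (Ioo a b ×ˢ Ioo 0 T), ‖w p‖ ≤ M₁ + M₂ := by
    filter_upwards [hM₁, hM₂] with p hp1 hp2
    rw [Real.norm_eq_abs, abs_le]
    constructor <;> simp only [hwdef] <;> linarith [hp1.1, hp1.2, hp2.1, hp2.2]
  have hfin : volume (Ioo a b ×ˢ Ioo 0 T) ≠ ⊤ := by
    rw [Measure.volume_eq_prod, Measure.prod_prod]; simp [ENNReal.mul_eq_top]
  have hwi : IntegrableOn w (Ioo a b ×ˢ Ioo 0 T) :=
    haveI := isFiniteMeasure_restrict.2 hfin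
    Integrable.of_bound hwm _ hwM
  have hwφ := fun φ hφ => h₁.integral_sub_mul_fderiv (φ := φ) h₂ (h₁.le_capacity hv hr₀m hr₀)
    (h₂.le_capacity hv hr₀m hr₀) hrin hφ
  rw [restrict_prod_eq] at hwm hwM
  have hx1 := hwm.prodMk_left
  have hx2 := Measure.ae_ae_of_ae_prod hwM
  set D : ℝ → ℝ := fun t => Function.leftLim (fun x => r₁ x t) b
    - Function.leftLim (fun x => r₂ x t) b with hD
  have hlim : ∀ᵐ t ∂volume.restrict (Ioo 0 T), Tendsto (fun x => w (x, t)) (𝓝[<] b) (𝓝 (D t)) := by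
    filter_upwards [h₁.bv, h₂.bv] with t ht1 ht2
    exact (ht1.tendsto_leftLim_Ioo hab).sub (ht2.tendsto_leftLim_Ioo hab)
  have hDint : IntegrableOn D (Ioo 0 T) := by
    obtain ⟨x, hx, hxP⟩ := exists_seq_of_ae_restrict hab (hx1.and hx2)
    have hlim' : ∀ᵐ t ∂volume.restrict (Ioo 0 T),
        Tendsto (fun n => w (x n, t)) atTop (𝓝 (D t)) := hlim.mono fun t ht => ht.comp hx
    refine Integrable.of_bound
      (aestronglyMeasurable_of_tendsto_ae atTop (fun n => (hxP n).2.1) hlim') (M₁ + M₂) ?_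
    filter_upwards [hlim', ae_all_iff.2 fun n => (hxP n).2.2] with t ht1 ht2
    exact le_of_tendsto ht1.norm (Eventually.of_forall ht2)
  suffices h : ∀ᵐ t, t ∈ Ioo 0 T → D t = 0 by
    rw [ae_restrict_iff' measurableSet_Ioo]
    exact h.mono fun t ht hI => sub_eq_zero.1 (ht hI)
  refine isOpen_Ioo.ae_eq_zero_of_integral_contDiff_smul_eq_zero hDint.locallyIntegrableOn
    fun g hg hgc hgs => ?_
  -- The test function at the outlet is pulled back to labels: a label reaches `b` after the travel
  -- time `(b - a) / v`.
  set A : ℝ → ℝ := fun s => g (s + (b - a) / v) with hAdef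
  have hA : ContDiff ℝ 1 A := (hg.of_le (by exact_mod_cast le_top)).comp
    (contDiff_id.add contDiff_const)
  have hAc : HasCompactSupport A := hgc.comp_homeomorph (Homeomorph.addRight ((b - a) / v))
  have hAs : tsupport A ⊆ Ioo (-((b - a) / v)) (T - (b - a) / v) := by
    intro s hs
    have := hgs (tsupport_comp_subset_preimage g (f := fun s => s + (b - a) / v) (by fun_prop) hs)
    exact ⟨by linarith [this.1], by linarith [this.2]⟩
  have hk := ae_integral_characteristic_eq_zero hv hab hwi hwφ hA hAc hT hAs
  obtain ⟨x, hx, hxP⟩ := exists_seq_of_ae_restrict hab ((hx1.and hx2).and hk)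
  obtain ⟨KA, hKA⟩ := hA.continuous.bounded_above_of_compact_support hAc
  have hconv : Tendsto (fun n => ∫ t in Ioo 0 T, w (x n, t) * A (t - (x n - a) / v)) atTop
      (𝓝 (∫ t in Ioo 0 T, D t * A (t - (b - a) / v))) := by
    refine tendsto_integral_of_dominated_convergence (fun _ => (M₁ + M₂) * KA) (fun n => ?_)
      (integrable_const _) (fun n => ?_) ?_
    · exact (hxP n).2.1.1.mul (hA.continuous.comp (by fun_prop)).aestronglyMeasurable
    · filter_upwards [(hxP n).2.1.2] with t ht
      rw [norm_mul]
      exact mul_le_mul ht (hKA _) (norm_nonneg _) ((norm_nonneg _).trans ht)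
    · filter_upwards [hlim] with t ht
      refine (ht.comp hx).mul ?_
      have : Continuous fun y => A (t - (y - a) / v) := hA.continuous.comp (by fun_prop)
      exact (this.tendsto b).comp (hx.mono_right nhdsWithin_le_nhds)
  have hz : (∫ t in Ioo 0 T, D t * A (t - (b - a) / v)) = 0 :=
    tendsto_nhds_unique hconv (by simp [(hxP _).2.2])
  rw [← hz, ← integral_indicator measurableSet_Ioo]
  refine integral_congr_ae (Eventually.of_forall fun t => ?_)
  by_cases ht : t ∈ Ioo 0 T
  · simp [indicator_of_mem ht, hAdef, mul_comm]
  · have : g t = 0 := image_eq_zero_of_notMem_tsupport fun h => ht (hgs h)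
    simp [indicator_of_notMem ht, this]

end Traces

/-! ### The canonical solution -/

theorem leftLim_eq_of_eventually {f : ℝ → ℝ} {x c : ℝ} (h : ∀ᶠ y in 𝓝[<] x, f y = c) :
    Function.leftLim f x = c :=
  leftLim_eq_of_tendsto
    (tendsto_const_nhds.congr' (h.mono fun _ hy => hy.symm))

theorem IsPiecewiseConstant.leftLim_left {f : ℝ → ℝ} {a b x : ℝ}
    (h : IsPiecewiseConstant f a b) (hx : x ∈ Ioc a b) :
    (∀ᶠ y in 𝓝[<] x, f y = Function.leftLim f x) ∧
      ∀ᶠ y in 𝓝[≤] x, Function.leftLim f y = Function.leftLim f x := by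
  obtain ⟨c, hc⟩ := h.eventually_left hx
  rw [leftLim_eq_of_eventually hc]
  refine ⟨hc, ?_⟩
  obtain ⟨l, hl, hls⟩ := mem_nhdsLT_iff_exists_Ioo_subset.1 hc
  filter_upwards [Ioc_mem_nhdsLE (mem_Iio.1 hl)] with y hy
  apply leftLim_eq_of_eventually
  filter_upwards [Ioo_mem_nhdsLT hy.1] with z hz using hls ⟨hz.1, hz.2.trans_le hy.2⟩

theorem IsPiecewiseConstant.leftLim_right {f : ℝ → ℝ} {a b x : ℝ}
    (h : IsPiecewiseConstant f a b) (hx : x ∈ Ico a b) :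
    ∃ c, ∀ᶠ y in 𝓝[>] x, Function.leftLim f y = c := by
  obtain ⟨c, hc⟩ := h.eventually_right hx
  refine ⟨c, ?_⟩
  obtain ⟨u, hu, hus⟩ := mem_nhdsGT_iff_exists_Ioo_subset.1 hc
  filter_upwards [Ioo_mem_nhdsGT (mem_Ioi.1 hu)] with y hy
  apply leftLim_eq_of_eventually
  filter_upwards [Ioo_mem_nhdsLT hy.1] with z hz using hus ⟨hz.1, hz.2.trans hy.2⟩

theorem IsPiecewiseConstant.ae_leftLim_eq {f : ℝ → ℝ} {a b : ℝ}
    (h : IsPiecewiseConstant f a b) :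
    ∀ᵐ x ∂volume.restrict (Ioo a b), Function.leftLim f x = f x := by
  obtain ⟨K, hK⟩ := h
  have h0 : volume (K : Set ℝ) = 0 := K.finite_toSet.measure_zero _
  filter_upwards [ae_restrict_mem measurableSet_Ioo,
    ae_restrict_of_ae (measure_eq_zero_iff_ae_notMem.1 h0)] with x hx hxK
  apply leftLim_eq_of_eventually
  obtain ⟨d, hd, hd'⟩ := Metric.isOpen_iff.1 K.finite_toSet.isClosed.isOpen_compl x hxK
  filter_upwards [Ioo_mem_nhdsLT hx.1, Ioo_mem_nhdsLT (sub_lt_self x hd)] with y hy hy'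
  refine hK y x hy.1 hy.2.le hx.2 fun z hz hzI => hd' ?_ hz
  rw [Metric.mem_ball, Real.dist_eq, abs_lt]
  constructor <;> linarith [hzI.1, hzI.2, hy'.1]

section Chain

variable (C : Chain) (D : InitialData)

/-- Flux through the cross section of processor `j` that is labelled by the time `s` of its passage
at `a j`, where negative labels refer to the initial density and `g` is the inflow. -/
def entry (j : ℕ) (g : ℝ → ℝ) (s : ℝ) : ℝ :=
  if 0 ≤ s then g s else C.v j * Function.leftLim (D.ρ₀ j) (C.a j - C.v j * s)

/-- The inflow of processor `j` for the control `u`. -/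
def inflow (u : ℝ → ℝ) : ℕ → ℝ → ℝ
  | 0 => u
  | 1 => u
  | n + 2 => queueOut
      (queueLen (D.q₀ (n + 2)) (fun t => entry C D (n + 1) (inflow u (n + 1)) (t - C.procTime (n + 1)))
        (C.μ (n + 2)))
      (fun t => entry C D (n + 1) (inflow u (n + 1)) (t - C.procTime (n + 1))) (C.μ (n + 2))

/-- The outflow of processor `j` for the control `u`. -/
def outflow (u : ℝ → ℝ) (j : ℕ) (t : ℝ) : ℝ := entry C D j (inflow C D u j) (t - C.procTime j)

/-- The queue in front of processor `j` for the control `u`. -/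
def queueAt (u : ℝ → ℝ) (j : ℕ) : ℝ → ℝ := queueLen (D.q₀ j) (outflow C D u (j - 1)) (C.μ j)

theorem inflow_one (u : ℝ → ℝ) : inflow C D u 1 = u := by rw [inflow]

theorem inflow_succ (u : ℝ → ℝ) {n : ℕ} (hn : 1 ≤ n) : inflow C D u (n + 1)
    = queueOut (queueAt C D u (n + 1)) (outflow C D u n) (C.μ (n + 1)) := by
  obtain ⟨m, rfl⟩ := Nat.exists_eq_add_of_le' hn
  rw [inflow]
  rfl

/-- The solution obtained by transporting inflows along characteristics. -/
def canonicalState (u : ℝ → ℝ) : State where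
  ρ j x t := entry C D j (inflow C D u j) (t - (x - C.a j) / C.v j) / C.v j
  q := queueAt C D u

variable {C D}

theorem Chain.v_pos {j : ℕ} (hj : j ∈ Finset.Icc 1 C.P) : 0 < C.v j :=
  div_pos (sub_pos.2 (C.a_lt_b j hj)) (C.procTime_pos j hj)

theorem Chain.length_div_v {j : ℕ} (hj : j ∈ Finset.Icc 1 C.P) :
    (C.b j - C.a j) / C.v j = C.procTime j := by
  have := sub_pos.2 (C.a_lt_b j hj)
  rw [Chain.v]; field_simp

theorem Chain.v_mul_procTime {j : ℕ} (hj : j ∈ Finset.Icc 1 C.P) :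
    C.v j * C.procTime j = C.b j - C.a j := by
  rw [← C.length_div_v hj, mul_div_cancel₀ _ (C.v_pos hj).ne']

variable {T : ℝ}

theorem label_mem {j : ℕ} (hj : j ∈ Finset.Icc 1 C.P) {s : ℝ} (hs : s ∈ Ico (-C.procTime j) 0) :
    C.a j - C.v j * s ∈ Ioc (C.a j) (C.b j) := by
  have hv := C.v_pos hj
  have h1 := C.v_mul_procTime hj
  constructor
  · nlinarith [hs.2]
  · nlinarith [hs.1]

theorem leftLim_initial_mem (hD : D.Admissible C) {j : ℕ} (hj : j ∈ Finset.Icc 1 C.P) {x : ℝ}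
    (hx : x ∈ Ioc (C.a j) (C.b j)) :
    C.v j * Function.leftLim (D.ρ₀ j) x ∈ Icc 0 (C.μ j) := by
  obtain ⟨y, hy, hyI⟩ := (((hD.pc j hj).leftLim_left hx).1.and (Ioo_mem_nhdsLT hx.1)).exists
  rw [← hy]
  have hyI' : y ∈ Ioo (C.a j) (C.b j) := ⟨hyI.1, hyI.2.trans_le hx.2⟩
  exact ⟨mul_nonneg (C.v_pos hj).le (hD.nonneg j hj y hyI'), hD.below j hj y hyI'⟩

/-- The label `s` sits at position `a - v * s`, so increasing labels move to the left. This is why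
`entry` takes left limits of the initial density: they become right-continuity in `s`. -/
theorem entry_right_of_neg (hD : D.Admissible C) {j : ℕ} (hj : j ∈ Finset.Icc 1 C.P) {s : ℝ}
    (hs : s ∈ Ico (-C.procTime j) 0) :
    ∃ c, ∀ᶠ r in 𝓝[≥] s, r < 0 ∧ C.v j * Function.leftLim (D.ρ₀ j) (C.a j - C.v j * r) = c := by
  have hv := C.v_pos hj
  have h := ((hD.pc j hj).leftLim_left (label_mem hj hs)).2
  have ht : Tendsto (fun r => C.a j - C.v j * r) (𝓝[≥] s) (𝓝[≤] (C.a j - C.v j * s)) := by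
    apply tendsto_nhdsWithin_of_tendsto_nhds_of_eventually_within
    · exact ((by fun_prop : Continuous fun r => C.a j - C.v j * r).tendsto s).mono_left
        nhdsWithin_le_nhds
    · filter_upwards [self_mem_nhdsWithin] with r hr
      have : C.v j * s ≤ C.v j * r := mul_le_mul_of_nonneg_left hr hv.le
      exact sub_le_sub_left this (C.a j)
  refine ⟨C.v j * Function.leftLim (D.ρ₀ j) (C.a j - C.v j * s), ?_⟩
  filter_upwards [ht.eventually h, nhdsWithin_le_nhds (Iio_mem_nhds hs.2)] with r h1 h2
  exact ⟨h2, by rw [h1]⟩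

theorem entry_left_of_nonpos (hD : D.Admissible C) {j : ℕ} (hj : j ∈ Finset.Icc 1 C.P) {s : ℝ}
    (hs : s ∈ Ioc (-C.procTime j) 0) :
    ∃ c, ∀ᶠ r in 𝓝[<] s, C.v j * Function.leftLim (D.ρ₀ j) (C.a j - C.v j * r) = c := by
  have hv := C.v_pos hj
  have h1 := C.v_mul_procTime hj
  have hx : C.a j - C.v j * s ∈ Ico (C.a j) (C.b j) := by
    constructor
    · nlinarith [hs.2]
    · nlinarith [hs.1]
  obtain ⟨c, hc⟩ := (hD.pc j hj).leftLim_right hx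
  have ht : Tendsto (fun r => C.a j - C.v j * r) (𝓝[<] s) (𝓝[>] (C.a j - C.v j * s)) := by
    apply tendsto_nhdsWithin_of_tendsto_nhds_of_eventually_within
    · exact ((by fun_prop : Continuous fun r => C.a j - C.v j * r).tendsto s).mono_left
        nhdsWithin_le_nhds
    · filter_upwards [self_mem_nhdsWithin] with r hr
      have : C.v j * r < C.v j * s := mul_lt_mul_of_pos_left hr hv
      exact sub_lt_sub_left this (C.a j)
  refine ⟨C.v j * c, ?_⟩
  filter_upwards [ht.eventually hc] with r h1
  rw [h1]

theorem stepOn_entry (hD : D.Admissible C) {j : ℕ} (hj : j ∈ Finset.Icc 1 C.P) (hT : 0 < T)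
    {g : ℝ → ℝ} (hg : StepOn g 0 T) : StepOn (entry C D j g) (-C.procTime j) T := by
  have hp := C.procTime_pos j hj
  apply stepOn_of_germs _ _ (by linarith)
  · intro t ht
    rcases le_or_gt t 0 with h0 | h0
    · obtain ⟨c, hc⟩ := entry_left_of_nonpos hD hj ⟨ht.1, h0⟩
      refine ⟨c, ?_⟩
      filter_upwards [hc, self_mem_nhdsWithin] with s hs hst
      rw [entry, if_neg (not_le.2 (lt_of_lt_of_le hst h0)), hs]
    · obtain ⟨c, t', ht', hc⟩ := hg.exists_left ⟨h0, ht.2⟩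
      refine ⟨c, ?_⟩
      filter_upwards [Ioo_mem_nhdsLT ht'.2] with s hs
      rw [entry, if_pos (ht'.1.le.trans hs.1.le), hc s ⟨hs.1.le, hs.2⟩]
  · intro t ht
    rcases lt_or_ge t 0 with h0 | h0
    · obtain ⟨c, hc⟩ := entry_right_of_neg hD hj ⟨ht.1, h0⟩
      exact ⟨c, hc.mono fun s hs => by rw [entry, if_neg (not_le.2 hs.1), hs.2]⟩
    · obtain ⟨t', ht', hc⟩ := hg.exists_right ⟨h0, ht.2⟩
      refine ⟨g t, ?_⟩
      filter_upwards [Ico_mem_nhdsGE ht'.1] with s hs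
      rw [entry, if_pos (h0.trans hs.1), hc s hs]

theorem entry_mem (hD : D.Admissible C) {j : ℕ} (hj : j ∈ Finset.Icc 1 C.P)
    {g : ℝ → ℝ} (hg : ∀ s ∈ Ico 0 T, g s ∈ Icc 0 (C.μ j)) {s : ℝ}
    (hs : s ∈ Ico (-C.procTime j) T) : entry C D j g s ∈ Icc 0 (C.μ j) := by
  rw [entry]
  split_ifs with h
  · exact hg s ⟨h, hs.2⟩
  · exact leftLim_initial_mem hD hj (label_mem hj ⟨hs.1, not_le.1 h⟩)

theorem StepOn.comp_sub {f : ℝ → ℝ} {l r d l' r' : ℝ} (h : StepOn f l r) (hl : l ≤ l' - d)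
    (hr : r' - d ≤ r) (hlr : l' < r') : StepOn (fun t => f (t - d)) l' r' := by
  apply stepOn_of_germs _ _ hlr
  · intro t ht
    obtain ⟨c, t', ht', hc⟩ := h.exists_left (t := t - d) ⟨by linarith [ht.1], by linarith [ht.2]⟩
    refine ⟨c, ?_⟩
    filter_upwards [Ioo_mem_nhdsLT (show t' + d < t by linarith [ht'.2])] with s hs
    exact hc _ ⟨by linarith [hs.1], by linarith [hs.2]⟩
  · intro t ht
    obtain ⟨t', ht', hc⟩ := h.exists_right (t := t - d) ⟨by linarith [ht.1], by linarith [ht.2]⟩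
    refine ⟨f (t - d), ?_⟩
    filter_upwards [Ico_mem_nhdsGE (show t < t' + d by linarith [ht'.1])] with s hs
    exact hc _ ⟨by linarith [hs.1], by linarith [hs.2]⟩

/-- Controls with right-continuous steps and values in `[0, μ_1]`. -/
structure IsStepControl (C : Chain) (T : ℝ) (u : ℝ → ℝ) : Prop where
  steps : StepOn u 0 T
  range : ∀ s ∈ Ico 0 T, u s ∈ Icc 0 (C.μ 1)

variable {u : ℝ → ℝ}

theorem inflow_spec (hD : D.Admissible C) (hT : 0 < T) (hu : IsStepControl C T u) {n : ℕ}
    (hn : n ∈ Finset.Icc 1 C.P) :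
    StepOn (inflow C D u n) 0 T ∧ ∀ s ∈ Ico 0 T, inflow C D u n s ∈ Icc 0 (C.μ n) := by
  rw [Finset.mem_Icc] at hn
  obtain ⟨hn1, hnP⟩ := hn
  induction n, hn1 using Nat.le_induction with
  | base => rw [inflow_one]; exact ⟨hu.steps, hu.range⟩
  | succ n hn1 ih =>
    have hn : n ∈ Finset.Icc 1 C.P := Finset.mem_Icc.2 ⟨hn1, by omega⟩
    obtain ⟨h1, h2⟩ := ih (by omega)
    have hp := C.procTime_pos n hn
    have hF : StepOn (outflow C D u n) 0 T :=
      (stepOn_entry hD hn hT h1).comp_sub (by linarith) (by linarith) hT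
    rw [inflow_succ C D u hn1]
    refine ⟨stepOn_queueOut hF hT, fun s hs => ⟨?_, queueOut_le _ _⟩⟩
    have hμ := (C.μ_pos (n + 1) (Finset.mem_Icc.2 ⟨by omega, hnP⟩)).le
    unfold queueOut
    split_ifs
    · exact le_min (entry_mem hD hn h2 ⟨by linarith [hs.1], by linarith [hs.2]⟩).1 hμ
    · exact hμ

theorem stepOn_entry_inflow (hD : D.Admissible C) (hT : 0 < T) (hu : IsStepControl C T u) {n : ℕ}
    (hn : n ∈ Finset.Icc 1 C.P) : StepOn (entry C D n (inflow C D u n)) (-C.procTime n) T :=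
  stepOn_entry hD hn hT (inflow_spec hD hT hu hn).1

theorem stepOn_outflow (hD : D.Admissible C) (hT : 0 < T) (hu : IsStepControl C T u) {n : ℕ}
    (hn : n ∈ Finset.Icc 1 C.P) : StepOn (outflow C D u n) 0 T :=
  (stepOn_entry_inflow hD hT hu hn).comp_sub (by linarith)
    (by linarith [C.procTime_pos n hn]) hT

theorem outflow_mem (hD : D.Admissible C) (hT : 0 < T) (hu : IsStepControl C T u) {n : ℕ}
    (hn : n ∈ Finset.Icc 1 C.P) {t : ℝ} (ht : t ∈ Icc 0 T) :
    outflow C D u n t ∈ Icc 0 (C.μ n) :=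
  entry_mem hD hn (inflow_spec hD hT hu hn).2
    ⟨by linarith [ht.1], by linarith [C.procTime_pos n hn, ht.2]⟩

/-- Approaching `b` from the left means approaching the label `t - procTime` from the right, where
`entry` is continuous; so the trace formula holds at every time, not only almost everywhere. -/
theorem outDensity_canonicalState (hD : D.Admissible C) (hT : 0 < T) (hu : IsStepControl C T u)
    {n : ℕ} (hn : n ∈ Finset.Icc 1 C.P) {t : ℝ} (ht : t ∈ Icc 0 T) :
    (canonicalState C D u).outDensity C n t = outflow C D u n t / C.v n := by
  have hv := C.v_pos hn
  have hp := C.procTime_pos n hn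
  apply leftLim_eq_of_eventually
  obtain ⟨t', ht', hc⟩ := (stepOn_entry_inflow hD hT hu hn).exists_right (t := t - C.procTime n)
    ⟨by linarith [ht.1], by linarith [ht.2]⟩
  have h1 : Tendsto (fun x => t - (x - C.a n) / C.v n) (𝓝[<] C.b n)
      (𝓝[≥] (t - C.procTime n)) := by
    apply tendsto_nhdsWithin_of_tendsto_nhds_of_eventually_within
    · have : Continuous fun x => t - (x - C.a n) / C.v n := by fun_prop
      have h2 := this.tendsto (C.b n)
      rw [C.length_div_v hn] at h2
      exact h2.mono_left nhdsWithin_le_nhds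
    · filter_upwards [self_mem_nhdsWithin] with x hx
      have : (x - C.a n) / C.v n ≤ (C.b n - C.a n) / C.v n :=
        div_le_div_of_nonneg_right (by linarith [mem_Iio.1 hx]) hv.le
      rw [C.length_div_v hn] at this
      exact sub_le_sub_left this t
  filter_upwards [h1.eventually (Ico_mem_nhdsGE ht'.1)] with x hx
  simp only [canonicalState, hc _ hx, outflow]

theorem outFlux_canonicalState (hD : D.Admissible C) (hT : 0 < T) (hu : IsStepControl C T u)
    {n : ℕ} (hn : n ∈ Finset.Icc 1 C.P) {t : ℝ} (ht : t ∈ Icc 0 T) :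
    (canonicalState C D u).outFlux C n t = outflow C D u n t := by
  rw [State.outFlux, outDensity_canonicalState hD hT hu hn ht, Chain.flux,
    mul_div_cancel₀ _ (C.v_pos hn).ne', min_eq_right (outflow_mem hD hT hu hn ht).2]

theorem State.inFlux_one (S : State) (t : ℝ) : S.inFlux C u 1 t = u t := by
  rw [State.inFlux, if_pos rfl]

theorem State.inFlux_succ (S : State) {n : ℕ} (hn : 1 ≤ n) (t : ℝ) :
    S.inFlux C u (n + 1) t = queueOut (S.q (n + 1)) (S.outFlux C n) (C.μ (n + 1)) t := by
  rw [State.inFlux, if_neg (by omega)]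
  rfl

theorem inFlux_canonicalState (hD : D.Admissible C) (hT : 0 < T) (hu : IsStepControl C T u)
    {n : ℕ} (hn : n ∈ Finset.Icc 1 C.P) {t : ℝ} (ht : t ∈ Icc 0 T) :
    (canonicalState C D u).inFlux C u n t = inflow C D u n t := by
  obtain ⟨hn1, hnP⟩ := Finset.mem_Icc.1 hn
  rcases hn1.eq_or_lt with rfl | h
  · rw [State.inFlux_one, inflow_one]
  · obtain ⟨m, rfl⟩ := Nat.exists_eq_add_of_lt h
    rw [show 1 + m + 1 = (m + 1) + 1 by ring, State.inFlux_succ _ (by omega),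
      inflow_succ C D u (by omega)]
    unfold queueOut
    rw [outFlux_canonicalState hD hT hu (Finset.mem_Icc.2 ⟨by omega, by omega⟩) ht]
    rfl

theorem isEntropySolution_canonicalState (hD : D.Admissible C) (hT : 0 < T)
    (hu : IsStepControl C T u) {n : ℕ} (hn : n ∈ Finset.Icc 1 C.P) :
    IsEntropySolution (C.flux n) (C.a n) (C.b n) T (D.ρ₀ n)
      (fun t => (canonicalState C D u).inFlux C u n t / C.v n) ((canonicalState C D u).ρ n) := by
  have hv := C.v_pos hn
  have hstep := stepOn_entry_inflow hD hT hu hn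
  rw [← C.length_div_v hn] at hstep
  refine isEntropySolution_transport hv (C.μ_pos n hn).le (C.a_lt_b n hn) hT
    hstep.isPiecewiseConstant (fun s hs => ?_) ?_ fun t ht => ?_
  · rw [C.length_div_v hn] at hs
    exact entry_mem hD hn (inflow_spec hD hT hu hn).2 ⟨hs.1.le, hs.2⟩
  · filter_upwards [(hD.pc n hn).ae_leftLim_eq, ae_restrict_mem measurableSet_Ioo] with x hx hxI
    have h0 : ¬ 0 ≤ (C.a n - x) / C.v n :=
      not_le.2 (div_neg_of_neg_of_pos (by linarith [hxI.1]) hv)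
    rw [entry, if_neg h0, mul_div_cancel₀ _ hv.ne', sub_sub_cancel, hx]
  · rw [mul_div_cancel₀ _ hv.ne', inFlux_canonicalState hD hT hu hn (Ioo_subset_Icc_self ht), entry,
      if_pos ht.1.le]

theorem isSolution_canonicalState (hD : D.Admissible C) (hT : 0 < T) (hu : IsStepControl C T u) :
    IsSolution C D T u (canonicalState C D u) := by
  have key : ∀ j ∈ Finset.Icc 2 C.P, ∃ n, j = n + 1 ∧ n ∈ Finset.Icc 1 C.P ∧ 1 ≤ n := by
    intro j hj
    rw [Finset.mem_Icc] at hj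
    exact ⟨j - 1, by omega, Finset.mem_Icc.2 ⟨by omega, by omega⟩, by omega⟩
  have hcongr : ∀ n ∈ Finset.Icc 1 C.P, n + 1 ∈ Finset.Icc 1 C.P → ∀ s ∈ Icc 0 T,
      (canonicalState C D u).outFlux C n s - (canonicalState C D u).inFlux C u (n + 1) s
        = outflow C D u n s
          - queueOut (queueAt C D u (n + 1)) (outflow C D u n) (C.μ (n + 1)) s := by
    intro n hn hn' s hs
    rw [outFlux_canonicalState hD hT hu hn hs, inFlux_canonicalState hD hT hu hn' hs,
      inflow_succ C D u (Finset.mem_Icc.1 hn).1]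
  refine ⟨fun j hj => isEntropySolution_canonicalState hD hT hu hj, ?_, ?_, ?_⟩
  · intro j hj
    have hj' : j ∈ Finset.Icc 1 C.P := Finset.Icc_subset_Icc_left (by norm_num) hj
    obtain ⟨n, rfl, hn, hn1⟩ := key j hj
    have hF := stepOn_outflow hD hT hu hn
    have hI := (hF.intervalIntegrable hT.le).sub ((stepOn_queueOut (q₀ := D.q₀ (n + 1))
      (m := C.μ (n + 1)) hF hT).intervalIntegrable hT.le)
    refine hI.congr fun s hs => ?_
    rw [uIoc_of_le hT.le] at hs
    exact (hcongr n hn hj' s ⟨hs.1.le, hs.2⟩).symm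
  · intro j hj t ht
    obtain ⟨n, rfl, hn, hn1⟩ := key j hj
    exact queueLen_nonneg ((stepOn_outflow hD hT hu hn).intervalIntegrable hT.le) ht
  · intro j hj t ht
    have hj' : j ∈ Finset.Icc 1 C.P := Finset.Icc_subset_Icc_left (by norm_num) hj
    have hq := hD.queue_nonneg j hj
    obtain ⟨n, rfl, hn, hn1⟩ := key j hj
    refine (queueLen_eq_integral (stepOn_outflow hD hT hu hn) hT hq ht).trans ?_
    congr 1
    refine intervalIntegral.integral_congr fun s hs => ?_
    rw [uIcc_of_le ht.1] at hs
    exact (hcongr n hn hj' s ⟨hs.1, hs.2.trans ht.2⟩).symm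

/-- Any two solutions have the same queues and, almost everywhere, the same in- and outflows. -/
theorem IsSolution.eq_canonical (hD : D.Admissible C) (hT : 0 < T) (hu : IsStepControl C T u)
    {S : State} (hS : IsSolution C D T u S) {n : ℕ} (hn : n ∈ Finset.Icc 1 C.P) :
    (∀ᵐ t ∂volume.restrict (Ioo 0 T), S.outDensity C n t = outflow C D u n t / C.v n) ∧
      (∀ᵐ t ∂volume.restrict (Ioo 0 T), S.inFlux C u n t = inflow C D u n t) ∧
      (2 ≤ n → ∀ t ∈ Icc 0 T, S.q n t = queueAt C D u n t) := by
  -- One half of the induction along the chain: equal inflows give equal outflow traces. The other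
  -- half, equal inflows of the next processor, is the uniqueness of its queue.
  have houts : ∀ n ∈ Finset.Icc 1 C.P,
      (∀ᵐ t ∂volume.restrict (Ioo 0 T), S.inFlux C u n t = inflow C D u n t) →
      ∀ᵐ t ∂volume.restrict (Ioo 0 T), S.outDensity C n t = outflow C D u n t / C.v n := by
    intro n hn hin
    have hv := C.v_pos hn
    have hr₀m : AEStronglyMeasurable (D.ρ₀ n) (volume.restrict (Ioo (C.a n) (C.b n))) := by
      obtain ⟨g, hg, -, hgf⟩ := (hD.pc n hn).exists_measurable
      refine hg.aestronglyMeasurable.congr ?_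
      filter_upwards [ae_restrict_mem measurableSet_Ioo] with x hx using (hgf x hx).symm
    have hr₀ : ∀ᵐ x ∂volume.restrict (Ioo (C.a n) (C.b n)),
        D.ρ₀ n x ∈ Icc 0 (C.μ n / C.v n) := by
      filter_upwards [ae_restrict_mem measurableSet_Ioo] with x hx
      exact ⟨hD.nonneg n hn x hx, by rw [le_div_iff₀' hv]; exact hD.below n hn x hx⟩
    have h := IsEntropySolution.leftLim_eq hv (C.a_lt_b n hn) hT (hS.density n hn)
      (isEntropySolution_canonicalState hD hT hu hn) hr₀m hr₀ (by
        filter_upwards [hin, ae_restrict_mem measurableSet_Ioo] with t ht htI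
        rw [ht, inFlux_canonicalState hD hT hu hn (Ioo_subset_Icc_self htI)])
    filter_upwards [h, ae_restrict_mem measurableSet_Ioo] with t ht htI
    rw [← outDensity_canonicalState hD hT hu hn (Ioo_subset_Icc_self htI)]
    exact ht
  suffices h : (∀ᵐ t ∂volume.restrict (Ioo 0 T), S.inFlux C u n t = inflow C D u n t) ∧
      (2 ≤ n → ∀ t ∈ Icc 0 T, S.q n t = queueAt C D u n t) from ⟨houts n hn h.1, h⟩
  rw [Finset.mem_Icc] at hn
  obtain ⟨hn1, hnP⟩ := hn
  induction n, hn1 using Nat.le_induction with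
  | base =>
    refine ⟨Eventually.of_forall fun t => ?_, fun h => absurd h (by norm_num)⟩
    rw [State.inFlux_one, inflow_one]
  | succ n hn1 ih =>
    have hn : n ∈ Finset.Icc 1 C.P := Finset.mem_Icc.2 ⟨hn1, by omega⟩
    have hn' : n + 1 ∈ Finset.Icc 1 C.P := Finset.mem_Icc.2 ⟨by omega, hnP⟩
    have hj : n + 1 ∈ Finset.Icc 2 C.P := Finset.mem_Icc.2 ⟨by omega, hnP⟩
    have hout := houts n hn (ih (by omega)).1
    have hflux : ∀ᵐ t ∂volume.restrict (Ioo 0 T), S.outFlux C n t = outflow C D u n t := by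
      filter_upwards [hout, ae_restrict_mem measurableSet_Ioo] with t ht htI
      rw [State.outFlux, ht, Chain.flux, mul_div_cancel₀ _ (C.v_pos hn).ne',
        min_eq_right (outflow_mem hD hT hu hn (Ioo_subset_Icc_self htI)).2]
    have hF := stepOn_outflow hD hT hu hn
    have hI := hS.queue_integrable (n + 1) hj
    have hq := hS.queue (n + 1) hj
    simp only [State.inFlux_succ S hn1, Nat.add_sub_cancel] at hI hq
    have hI' : IntervalIntegrable (fun s => outflow C D u n s
        - queueOut (queueAt C D u (n + 1)) (outflow C D u n) (C.μ (n + 1)) s) volume 0 T :=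
      (hF.intervalIntegrable hT.le).sub ((stepOn_queueOut hF hT).intervalIntegrable hT.le)
    have hq' : ∀ t ∈ Icc 0 T, queueAt C D u (n + 1) t = D.q₀ (n + 1) + ∫ s in (0)..t,
        (outflow C D u n s - queueOut (queueAt C D u (n + 1)) (outflow C D u n) (C.μ (n + 1)) s) :=
      fun t ht => queueLen_eq_integral hF hT (hD.queue_nonneg _ hj) ht
    have hqq : ∀ t ∈ Icc 0 T, S.q (n + 1) t = queueAt C D u (n + 1) t := fun t ht =>
      le_antisymm
        (le_of_queue_equation hflux hI hI'
          (fun t ht => queueLen_nonneg (hF.intervalIntegrable hT.le) ht) hq hq' t ht)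
        (le_of_queue_equation (hflux.mono fun _ h => h.symm) hI' hI
          (hS.queue_nonneg (n + 1) hj) hq' hq t ht)
    refine ⟨?_, fun _ => hqq⟩
    filter_upwards [hflux, ae_restrict_mem measurableSet_Ioo] with t ht htI
    rw [State.inFlux_succ S hn1, inflow_succ C D u hn1]
    unfold queueOut
    rw [hqq t (Ioo_subset_Icc_self htI), ht]

end Chain

/-! ### Families of step functions with moving jumps -/

/-- Near time `t` and parameter `0`, the functions `F ε` jump from `cL` to `cR` at `t + ε β`. -/
def JumpAt (F : ℝ → ℝ → ℝ) (t cL cR β : ℝ) : Prop :=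
  ∀ᶠ p : ℝ × ℝ in 𝓝 (0, t), F p.1 p.2 = if p.2 < t + p.1 * β then cL else cR

/-- Near parameter `0`, the value of `q ε` at `s` is affine in `ε` with slope `η`. -/
def ShiftAt (q : ℝ → ℝ → ℝ) (s η : ℝ) : Prop := ∀ᶠ ε in 𝓝 (0 : ℝ), q ε s = q 0 s + ε * η

/-- The rules for queue shifts, in terms of fluxes `cL`, `cR` before and after an arrival, and of
displacements of arrival times. -/
structure FluxRule (q : ℝ → ℝ) (t m cL cR β η ηp βo : ℝ) : Prop where
  none : cL = cR → ¬ Empties q t → ηp = η ∧ βo = 0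
  below : cL ≠ cR → ¬ Empties q t → q t = 0 → cR ≤ m → βo = β ∧ ηp = 0
  above : cL ≠ cR → ¬ Empties q t → q t = 0 → m < cR → βo = β ∧ ηp = η - β * (cR - m)
  nonempty : cL ≠ cR → 0 < q t → βo = 0 ∧ ηp = η + β * (cL - cR)
  emptying : Empties q t → ηp = 0 ∧ βo = -η / (cL - m)

/-- Passes from joint neighbourhoods, in which `JumpAt` is stated, to a fixed time with a range of
`ε` depending on it, as in `ShiftAt`. -/
theorem eventually_slices {P : ℝ × ℝ → Prop} {t : ℝ} (h : ∀ᶠ p in 𝓝 ((0 : ℝ), t), P p) :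
    ∀ᶠ s in 𝓝 t, ∀ᶠ ε in 𝓝 (0 : ℝ), P (ε, s) := by
  have h1 : Tendsto (fun s : ℝ => ((0 : ℝ), s)) (𝓝 t) (𝓝 (0, t)) :=
    (Continuous.prodMk continuous_const continuous_id).tendsto t
  filter_upwards [h1.eventually (eventually_eventually_nhds.2 h)] with s hs
  have h2 : Tendsto (fun ε : ℝ => (ε, s)) (𝓝 0) (𝓝 (0, s)) :=
    (Continuous.prodMk continuous_id continuous_const).tendsto 0
  exact h2.eventually hs

theorem eventually_fst {P : ℝ → Prop} {t : ℝ} (h : ∀ᶠ ε in 𝓝 (0 : ℝ), P ε) :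
    ∀ᶠ p in 𝓝 ((0 : ℝ), t), P p.1 :=
  (continuous_fst.tendsto ((0 : ℝ), t)).eventually h

theorem eventually_pos_of_continuous {f : ℝ × ℝ → ℝ} (hf : Continuous f) {t : ℝ} (h : 0 < f (0, t)) :
    ∀ᶠ p in 𝓝 ((0 : ℝ), t), 0 < f p :=
  (hf.tendsto _).eventually (Ioi_mem_nhds h)

theorem JumpAt.exists_box {F : ℝ → ℝ → ℝ} {t cL cR β : ℝ} (h : JumpAt F t cL cR β) :
    ∃ d > 0, ∀ ε s, |ε| < d → |s - t| < d → F ε s = if s < t + ε * β then cL else cR := by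
  obtain ⟨d, hd, h'⟩ := Metric.eventually_nhds_iff.1 h
  refine ⟨d, hd, fun ε s h1 h2 => h' (y := (ε, s)) ?_⟩
  rw [Prod.dist_eq, max_lt_iff, Real.dist_eq, Real.dist_eq, sub_zero]
  exact ⟨h1, h2⟩

theorem ShiftAt.unique {q : ℝ → ℝ → ℝ} {s η η' : ℝ} (h : ShiftAt q s η) (h' : ShiftAt q s η') :
    η = η' := by
  have h1 : ∀ᶠ ε in 𝓝[≠] (0 : ℝ), q ε s = q 0 s + ε * η ∧ q ε s = q 0 s + ε * η' ∧ ε ≠ 0 := by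
    filter_upwards [nhdsWithin_le_nhds h, nhdsWithin_le_nhds h', self_mem_nhdsWithin] with ε a b c
      using ⟨a, b, c⟩
  obtain ⟨ε, h1, h2, h3⟩ := h1.exists
  exact mul_left_cancel₀ h3 (add_left_cancel (h1.symm.trans h2))

/-- An affine function of `ε` that vanishes at `0` and is nonnegative on both sides has slope zero.
Hence an empty queue carries no shift. -/
theorem ShiftAt.eq_zero {q : ℝ → ℝ → ℝ} {s η : ℝ} (h : ShiftAt q s η) (h0 : q 0 s = 0)
    (hq : ∀ᶠ ε in 𝓝 (0 : ℝ), 0 ≤ q ε s) : η = 0 := by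
  have h1 : ∀ᶠ ε in 𝓝 (0 : ℝ), 0 ≤ ε * η := by
    filter_upwards [h, hq] with ε h1 h2
    rw [h1, h0, zero_add] at h2; exact h2
  have h2 : ∀ᶠ ε in 𝓝[>] (0 : ℝ), 0 ≤ ε * η ∧ 0 < ε :=
    by filter_upwards [nhdsWithin_le_nhds h1, self_mem_nhdsWithin] with e a b using ⟨a, b⟩
  have h3 : ∀ᶠ ε in 𝓝[<] (0 : ℝ), 0 ≤ ε * η ∧ ε < 0 :=
    by filter_upwards [nhdsWithin_le_nhds h1, self_mem_nhdsWithin] with e a b using ⟨a, b⟩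
  obtain ⟨e, he, he'⟩ := h2.exists
  obtain ⟨f, hf, hf'⟩ := h3.exists
  nlinarith

section QueueFamily

variable {q₀ m T : ℝ} {F : ℝ → ℝ → ℝ}

/-- Just before `t` the inflow is `cL` for all small `ε`, so one time with affine dependence
determines the rest: a positive queue carries its slope along linearly, and an empty one has slope
zero. A single such time in each left neighbourhood suffices, which is the form needed at limit
times of the induction. -/
theorem queueFamily_left (hF : ∀ᶠ ε in 𝓝 (0 : ℝ), StepOn (F ε) 0 T) {t cL cR β : ℝ}
    (ht : t ∈ Ioc 0 T) (hJ : JumpAt F t cL cR β)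
    (h : ∃ᶠ s in 𝓝[<] t, ∃ η, ShiftAt (fun ε => queueLen q₀ (F ε) m) s η) :
    ∃ η, ∀ᶠ s in 𝓝[<] t, ShiftAt (fun ε => queueLen q₀ (F ε) m) s η := by
  have hT : 0 ≤ T := ht.1.le.trans ht.2
  obtain ⟨d, hd, hbox⟩ := hJ.exists_box
  have hnear : ∀ᶠ s in 𝓝[<] t, s ∈ Ioo (max 0 (t - d)) t :=
    Ioo_mem_nhdsLT (max_lt ht.1 (by linarith))
  have hF0 := hF.self_of_nhds
  have key : ∀ s₁ s, s₁ ∈ Ioo (max 0 (t - d)) t → s ∈ Ioo s₁ t → ∀ᶠ ε in 𝓝 (0 : ℝ),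
      0 ≤ queueLen q₀ (F ε) m s₁ ∧
      queueLen q₀ (F ε) m s = max (queueLen q₀ (F ε) m s₁ + (cL - m) * (s - s₁)) 0 := by
    intro s₁ s hs₁ hs
    have h1 : ∀ᶠ ε in 𝓝 (0 : ℝ), s < t + ε * β :=
      (Continuous.tendsto (by fun_prop : Continuous fun ε : ℝ => t + ε * β) 0).eventually
        (Ioi_mem_nhds (by simpa using hs.2))
    have hs₁0 : 0 < s₁ := (le_max_left _ _).trans_lt hs₁.1
    have hs₁d : t - d < s₁ := (le_max_right _ _).trans_lt hs₁.1
    filter_upwards [h1, hF, Metric.ball_mem_nhds (0 : ℝ) hd] with ε hε1 hε2 hε3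
    rw [Metric.mem_ball, dist_zero_right, Real.norm_eq_abs] at hε3
    have hI := hε2.intervalIntegrable hT
    refine ⟨queueLen_nonneg hI ⟨hs₁0.le, hs₁.2.le.trans ht.2⟩, queueLen_of_const hI hs₁0.le
      (hs.2.le.trans ht.2) (fun r hr => ?_) ⟨hs.1.le, le_rfl⟩⟩
    rw [hbox ε r hε3 (by rw [abs_lt]; constructor <;> linarith [hr.1, hr.2, hs.2]),
      if_pos (hr.2.trans hε1)]
  rcases queueLen_left_dichotomy (q₀ := q₀) (m := m) hF0 hT ht with hq | hq
  · obtain ⟨l, hl, hls⟩ := mem_nhdsLT_iff_exists_Ioo_subset.1 (hnear.and hq)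
    obtain ⟨s₁, ⟨η, hη⟩, hs₁l⟩ := (h.and_eventually (Ioo_mem_nhdsLT hl)).exists
    refine ⟨η, ?_⟩
    filter_upwards [Ioo_mem_nhdsLT hs₁l.2] with s hs
    have hk := key s₁ s (hls hs₁l).1 hs
    have h0 := hk.self_of_nhds.2
    have hpos : 0 < queueLen q₀ (F 0) m s := (hls ⟨hs₁l.1.trans hs.1, hs.2⟩).2
    have h0' : queueLen q₀ (F 0) m s = queueLen q₀ (F 0) m s₁ + (cL - m) * (s - s₁) := by
      rcases max_choice (queueLen q₀ (F 0) m s₁ + (cL - m) * (s - s₁)) 0 with h' | h'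
      · rw [h0, h']
      · rw [h0, h'] at hpos; exact absurd hpos (lt_irrefl _)
    have h1 : ∀ᶠ ε in 𝓝 (0 : ℝ), 0 < queueLen q₀ (F 0) m s + ε * η :=
      (Continuous.tendsto (by fun_prop : Continuous fun ε : ℝ => queueLen q₀ (F 0) m s + ε * η)
        0).eventually (Ioi_mem_nhds (by simpa using hpos))
    filter_upwards [hk, hη, h1] with ε e1 e2 e3
    rw [e1.2, e2, max_eq_left (by linarith), h0']
    ring
  · obtain ⟨l, hl, hls⟩ := mem_nhdsLT_iff_exists_Ioo_subset.1 (hnear.and hq)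
    obtain ⟨s₁, ⟨η, hη⟩, hs₁l⟩ := (h.and_eventually (Ioo_mem_nhdsLT hl)).exists
    have hz : queueLen q₀ (F 0) m s₁ = 0 := (hls hs₁l).2
    refine ⟨0, ?_⟩
    filter_upwards [Ioo_mem_nhdsLT hs₁l.2] with s hs
    have hk := key s₁ s (hls hs₁l).1 hs
    have hη0 := hη.eq_zero hz (hk.mono fun ε h => h.1)
    have h0 := hk.self_of_nhds.2
    filter_upwards [hk, hη] with ε e1 e2
    rw [e1.2, e2, hη0, h0]
    simp

/-- The formula for constant inflow is applied on the two sides of the moving jump, with a start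
time `s₀` at which the dependence on `ε` is already affine. -/
theorem queueFamily_form (hF : ∀ᶠ ε in 𝓝 (0 : ℝ), StepOn (F ε) 0 T) {t cL cR β η : ℝ}
    (ht : t ∈ Ioo 0 T) (hJ : JumpAt F t cL cR β)
    (h : ∀ᶠ s in 𝓝[<] t, ShiftAt (fun ε => queueLen q₀ (F ε) m) s η) :
    ∀ᶠ s₀ in 𝓝[<] t, ∀ᶠ p : ℝ × ℝ in 𝓝 (0, t),
      (p.2 ≤ t + p.1 * β → queueLen q₀ (F p.1) m p.2
        = max (queueLen q₀ (F 0) m s₀ + p.1 * η + (cL - m) * (p.2 - s₀)) 0) ∧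
      (t + p.1 * β ≤ p.2 → queueLen q₀ (F p.1) m p.2
        = max (max (queueLen q₀ (F 0) m s₀ + p.1 * η + (cL - m) * (t + p.1 * β - s₀)) 0
          + (cR - m) * (p.2 - t - p.1 * β)) 0) := by
  have hT : 0 ≤ T := ht.1.le.trans ht.2.le
  obtain ⟨d, hd, hbox⟩ := hJ.exists_box
  filter_upwards [h, Ioo_mem_nhdsLT (show max 0 (t - d) < t from max_lt ht.1 (by linarith))]
    with s₀ hs hs₀
  have hs₀0 : 0 < s₀ := (le_max_left _ _).trans_lt hs₀.1
  have hs₀d : t - d < s₀ := (le_max_right _ _).trans_lt hs₀.1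
  have e1 := eventually_pos_of_continuous (f := fun p => t + p.1 * β - s₀) (by fun_prop) (t := t)
    (by simpa using hs₀.2)
  have e2 := eventually_pos_of_continuous (f := fun p => min T (t + d) - (t + p.1 * β))
    (by fun_prop) (t := t) (by simpa using ⟨ht.2, hd⟩)
  have e3 := eventually_pos_of_continuous (f := fun p => min T (t + d) - p.2)
    (by fun_prop) (t := t) (by simpa using ⟨ht.2, hd⟩)
  have e4 := eventually_pos_of_continuous (f := fun p => p.2 - s₀) (by fun_prop) (t := t)
    (by simpa using hs₀.2)
  filter_upwards [e1, e2, e3, e4, eventually_fst hs, eventually_fst hF,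
    eventually_fst (Metric.ball_mem_nhds (0 : ℝ) hd)] with p e1 e2 e3 e4 hs hF hp
  rw [dist_zero_right, Real.norm_eq_abs] at hp
  have hI := hF.intervalIntegrable hT
  have hmT := min_le_left T (t + d)
  have hmd := min_le_right T (t + d)
  have hL : ∀ s ∈ Icc s₀ (t + p.1 * β), queueLen q₀ (F p.1) m s
      = max (queueLen q₀ (F 0) m s₀ + p.1 * η + (cL - m) * (s - s₀)) 0 := by
    intro s hs'
    rw [← hs]
    refine queueLen_of_const hI hs₀0.le (by linarith) (fun r hr => ?_) hs'
    rw [hbox p.1 r hp (by rw [abs_lt]; constructor <;> linarith [hr.1, hr.2]), if_pos hr.2]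
  refine ⟨fun hp2 => hL p.2 ⟨by linarith, hp2⟩, fun hp2 => ?_⟩
  rw [← hL (t + p.1 * β) ⟨by linarith, le_rfl⟩, sub_sub]
  refine queueLen_of_const (s₁ := min T (t + d)) hI (by linarith) hmT (fun r hr => ?_)
    ⟨hp2, by linarith⟩
  rw [hbox p.1 r hp (by rw [abs_lt]; constructor <;> linarith [hr.1, hr.2]),
    if_neg (not_lt.2 hr.1)]

/-- The interaction rules are derived here. The explicit formula of `queueFamily_form` is examined
in three regimes: the queue empties at `t`, it has been empty before `t`, or it is positive at `t`.
In each the reflection terms simplify, and both the queue after `t` and the jump of its outflow can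
be read off. -/
theorem queueFamily_step (hF : ∀ᶠ ε in 𝓝 (0 : ℝ), StepOn (F ε) 0 T) {t cL cR β η : ℝ}
    (ht : t ∈ Ioo 0 T) (hJ : JumpAt F t cL cR β)
    (h : ∀ᶠ s in 𝓝[<] t, ShiftAt (fun ε => queueLen q₀ (F ε) m) s η)
    (hsim : Empties (queueLen q₀ (F 0) m) t → cL = cR) :
    ∃ ηp βo cL' cR', (∀ᶠ s in 𝓝[>] t, ShiftAt (fun ε => queueLen q₀ (F ε) m) s ηp) ∧
      JumpAt (fun ε => queueOut (queueLen q₀ (F ε) m) (F ε) m) t cL' cR' βo ∧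
      FluxRule (queueLen q₀ (F 0) m) t m cL cR β η ηp βo := by
  have hT : 0 ≤ T := ht.1.le.trans ht.2.le
  have hF0 := hF.self_of_nhds
  have hform := queueFamily_form hF ht hJ h
  have hnn : 0 ≤ queueLen q₀ (F 0) m t :=
    queueLen_nonneg (hF0.intervalIntegrable hT) ⟨ht.1.le, ht.2.le⟩
  rcases hnn.eq_or_lt with hz | hpos
  · rcases queueLen_left_dichotomy (q₀ := q₀) (m := m) hF0 hT ⟨ht.1, ht.2.le⟩ with hq | hq
    · -- the queue empties
      have hE : Empties (queueLen q₀ (F 0) m) t := ⟨hz.symm, hq⟩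
      -- With no arrival at this time, the queue reaches zero with the single slope `cL - m`, so
      -- that the emptying time is affine in `ε`. A simultaneous jump could give different slopes
      -- for the two signs of `ε`.
      obtain rfl := hsim hE
      obtain ⟨l, hl, hls⟩ := mem_nhdsLT_iff_exists_Ioo_subset.1 (hform.and hq)
      have hl : l < t := hl
      set s₀ := (l + t) / 2 with hs₀
      obtain ⟨hP, ha⟩ := hls (a := s₀) ⟨by linarith, by linarith⟩
      set a := queueLen q₀ (F 0) m s₀ with hadef
      -- One inequality holds because the queue is empty at `t`, the other is the limit of its
      -- positivity before `t`.
      have hat : a + (cL - m) * (t - s₀) = 0 := by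
        have h1 : a + (cL - m) * (t - s₀) ≤ 0 := by
          have := hP.self_of_nhds.1 (by simp)
          simp only [zero_mul, add_zero] at this
          rw [← hz] at this
          exact (le_max_left _ _).trans this.ge
        refine le_antisymm h1 ?_
        have hsl := eventually_slices hP
        have h2 : ∀ᶠ s in 𝓝[<] t, 0 ≤ a + (cL - m) * (s - s₀) := by
          filter_upwards [nhdsWithin_le_nhds hsl, hq, self_mem_nhdsWithin] with s e1 e2 e3
          have := e1.self_of_nhds.1 (by simpa using (mem_Iio.1 e3).le)
          simp only [zero_mul, add_zero] at this
          by_contra! hc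
          rw [this, max_eq_right hc.le] at e2
          exact lt_irrefl _ e2
        have hc : Tendsto (fun s => a + (cL - m) * (s - s₀)) (𝓝[<] t)
            (𝓝 (a + (cL - m) * (t - s₀))) :=
          ((by fun_prop : Continuous fun s => a + (cL - m) * (s - s₀)).tendsto t).mono_left
            nhdsWithin_le_nhds
        exact ge_of_tendsto hc h2
      have hst : 0 < t - s₀ := by linarith
      have hneg : cL - m < 0 := by
        by_contra! hc
        nlinarith [mul_nonneg hc hst.le]
      -- Since the rate is the same on both sides of the moving point and negative, an emptied queue
      -- stays empty and the two pieces merge. The zero of the linear expression moves with velocity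
      -- `-η / (cL - m)`.
      have hq' : ∀ᶠ p : ℝ × ℝ in 𝓝 (0, t),
          queueLen q₀ (F p.1) m p.2 = max ((cL - m) * (p.2 - t) + p.1 * η) 0 := by
        filter_upwards [hP] with p hp
        rcases le_total p.2 (t + p.1 * β) with h1 | h1
        · rw [hp.1 h1]; congr 1; linarith
        · rw [hp.2 h1]
          have e1 : a + p.1 * η + (cL - m) * (t + p.1 * β - s₀) = p.1 * η + (cL - m) * (p.1 * β) := by
            linarith
          have e2 : (cL - m) * (p.2 - t - p.1 * β) ≤ 0 :=
            mul_nonpos_of_nonpos_of_nonneg hneg.le (by linarith)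
          rw [e1]
          rcases le_total 0 (p.1 * η + (cL - m) * (p.1 * β)) with h2 | h2
          · rw [max_eq_left h2]; congr 1; ring
          · rw [max_eq_right h2, zero_add, max_eq_right e2, max_eq_right]
            linarith
      refine ⟨0, -η / (cL - m), m, cL, ?_, ?_, ?_⟩
      · filter_upwards [nhdsWithin_le_nhds (eventually_slices hq'), self_mem_nhdsWithin] with s e1 e2
        have e3 : (cL - m) * (s - t) < 0 := mul_neg_of_neg_of_pos hneg (sub_pos.2 e2)
        have e4 : ∀ᶠ ε in 𝓝 (0 : ℝ), (cL - m) * (s - t) + ε * η < 0 :=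
          (Continuous.tendsto (by fun_prop : Continuous fun ε : ℝ => (cL - m) * (s - t) + ε * η)
            0).eventually (Iio_mem_nhds (by simpa using e3))
        have e5 := e1.self_of_nhds
        simp only [zero_mul, add_zero, max_eq_right e3.le] at e5
        filter_upwards [e1, e4] with ε e1 e4
        rw [e1, e5, max_eq_right e4.le]; ring
      · filter_upwards [hq', hJ] with p e1 e2
        rw [ite_self] at e2
        have hiff : p.2 < t + p.1 * (-η / (cL - m)) ↔ 0 < (cL - m) * (p.2 - t) + p.1 * η := by
          rw [← sub_lt_iff_lt_add', mul_div_assoc', lt_div_iff_of_neg hneg]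
          constructor <;> intro h <;> linarith
        by_cases hlt : p.2 < t + p.1 * (-η / (cL - m))
        · rw [if_pos hlt, queueOut_eq_of_pos]
          rw [e1]; exact lt_max_of_lt_left (hiff.1 hlt)
        · rw [if_neg hlt, queueOut_eq_of_zero, e2, min_eq_left (by linarith)]
          rw [e1, max_eq_right]
          exact not_lt.1 fun h => hlt (hiff.2 h)
      · exact ⟨fun _ h => absurd hE h, fun h => absurd rfl h, fun h => absurd rfl h,
          fun h => absurd rfl h, fun _ => ⟨rfl, rfl⟩⟩
    · -- the queue has been empty
      have hE : ¬ Empties (queueLen q₀ (F 0) m) t := fun hE => by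
        obtain ⟨s, h1, h2⟩ := (hE.2.and hq).exists
        exact h1.ne' h2
      have hη : η = 0 := by
        obtain ⟨s, h1, h2, h3⟩ := (h.and (hq.and (Ioo_mem_nhdsLT ht.1))).exists
        refine h1.eq_zero h2 ?_
        filter_upwards [hF] with ε hε
        exact queueLen_nonneg (hε.intervalIntegrable hT) ⟨h3.1.le, h3.2.le.trans ht.2.le⟩
      subst hη
      obtain ⟨l, hl, hls⟩ := mem_nhdsLT_iff_exists_Ioo_subset.1 (hform.and hq)
      have hl : l < t := hl
      set s₀ := (l + t) / 2 with hs₀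
      obtain ⟨hP, ha⟩ := hls (a := s₀) ⟨by linarith, by linarith⟩
      have hcL : cL - m ≤ 0 := by
        have := hP.self_of_nhds.1 (by simp)
        simp only [zero_mul, add_zero] at this
        rw [← hz, ha, zero_add] at this
        by_contra! hc
        have h1 : 0 < (cL - m) * (t - s₀) := mul_pos hc (by linarith)
        rw [max_eq_left h1.le] at this
        exact h1.ne this
      simp only [ha, mul_zero, zero_add] at hP
      have hq1 : ∀ᶠ p : ℝ × ℝ in 𝓝 (0, t),
          (p.2 ≤ t + p.1 * β → queueLen q₀ (F p.1) m p.2 = 0) ∧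
          (t + p.1 * β ≤ p.2 → queueLen q₀ (F p.1) m p.2 
            = max ((cR - m) * (p.2 - t - p.1 * β)) 0) := by
        have e1 := eventually_pos_of_continuous (f := fun p => t + p.1 * β - s₀) (by fun_prop)
          (t := t) (by simp; linarith)
        have e4 := eventually_pos_of_continuous (f := fun p => p.2 - s₀) (by fun_prop) (t := t)
          (by simp; linarith)
        filter_upwards [hP, e1, e4] with p hp e1 e4
        refine ⟨fun h1 => ?_, fun h1 => ?_⟩
        · rw [hp.1 h1, max_eq_right]
          exact mul_nonpos_of_nonpos_of_nonneg hcL e4.le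
        · rw [hp.2 h1, max_eq_right (mul_nonpos_of_nonpos_of_nonneg hcL e1.le), zero_add]
      have hafter : ∀ s, t < s → ∀ᶠ ε in 𝓝 (0 : ℝ), t + ε * β < s := fun s hs =>
        (Continuous.tendsto (by fun_prop : Continuous fun ε : ℝ => t + ε * β)
            0).eventually (Iio_mem_nhds (by simpa using hs))
      rcases le_or_gt cR m with hcR | hcR
      · have hq2 : ∀ᶠ p : ℝ × ℝ in 𝓝 (0, t), queueLen q₀ (F p.1) m p.2 = 0 := by
          filter_upwards [hq1] with p hp
          rcases le_total p.2 (t + p.1 * β) with h1 | h1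
          · exact hp.1 h1
          · rw [hp.2 h1, max_eq_right]
            exact mul_nonpos_of_nonpos_of_nonneg (by linarith) (by linarith)
        have hG : ∀ᶠ p : ℝ × ℝ in 𝓝 (0, t), queueOut (queueLen q₀ (F p.1) m) (F p.1) m p.2
            = if p.2 < t + p.1 * β then cL else cR := by
          filter_upwards [hq2, hJ] with p e1 e2
          rw [queueOut_eq_of_zero e1, e2]
          split_ifs
          · exact min_eq_left (by linarith)
          · exact min_eq_left hcR
        -- If nothing jumps, the velocity is arbitrary for `JumpAt`, but the rule without
        -- interaction requires it to be zero.
        refine ⟨0, if cL = cR then 0 else β, cL, cR, ?_, ?_, ?_⟩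
        · filter_upwards [nhdsWithin_le_nhds (eventually_slices hq2)] with s e1
          have e2 := e1.self_of_nhds
          filter_upwards [e1] with ε e1
          rw [e1, e2]; ring
        · filter_upwards [hG] with p hp
          rw [hp]
          by_cases hc : cL = cR
          · simp [hc]
          · simp [hc]
        · refine ⟨fun hc _ => by simp [hc], fun hc _ _ _ => by simp [hc],
            fun _ _ _ hc => absurd hcR hc.not_ge, fun _ hc => absurd hz hc.ne,
            fun hc => absurd hc hE⟩
      · have hc : cL ≠ cR := by intro hc; linarith
        -- An arrival later by `ε * β` costs that much time of filling at rate `cR - m`. The outflow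
        -- is capped at `m`, but its jump occurs at the arrival itself.
        refine ⟨0 - β * (cR - m), β, cL, m, ?_, ?_, ?_⟩
        · filter_upwards [nhdsWithin_le_nhds (eventually_slices hq1), self_mem_nhdsWithin]
            with s e1 e2
          have e3 := e1.self_of_nhds.2 (by simpa using (mem_Ioi.1 e2).le)
          simp only [zero_mul, sub_zero] at e3
          rw [max_eq_left (mul_nonneg (by linarith) (by linarith [mem_Ioi.1 e2]))] at e3
          filter_upwards [e1, hafter s e2] with ε e1 e4
          rw [e1.2 e4.le, e3, max_eq_left (mul_nonneg (by linarith) (by linarith))]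
          ring
        · filter_upwards [hq1, hJ] with p e1 e2
          by_cases hlt : p.2 < t + p.1 * β
          · rw [if_pos hlt] at e2 ⊢
            rw [queueOut_eq_of_zero (e1.1 hlt.le), e2, min_eq_left (by linarith)]
          · rw [if_neg hlt] at e2 ⊢
            rcases (not_lt.1 hlt).eq_or_lt with h1 | h1
            · rw [queueOut_eq_of_zero (e1.1 h1.ge), e2, min_eq_right hcR.le]
            · rw [queueOut_eq_of_pos]
              rw [e1.2 h1.le]
              exact lt_max_of_lt_left (mul_pos (by linarith) (by linarith))
        · exact ⟨fun h => absurd h hc, fun _ _ _ h => absurd hcR h.not_gt,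
            fun _ _ _ _ => ⟨rfl, rfl⟩, fun _ h => absurd hz h.ne, fun h => absurd h hE⟩
  · -- the queue is not empty
    have hE : ¬ Empties (queueLen q₀ (F 0) m) t := fun hE => hpos.ne' hE.1
    obtain ⟨s₀, hP⟩ := hform.exists
    set a := queueLen q₀ (F 0) m s₀ with hadef
    have hat : 0 < a + (cL - m) * (t - s₀) := by
      have := hP.self_of_nhds.1 (by simp)
      simp only [zero_mul, add_zero] at this
      by_contra! hc
      rw [max_eq_right hc] at this
      exact hpos.ne' this
    have e1 := eventually_pos_of_continuous
      (f := fun p => a + p.1 * η + (cL - m) * (p.2 - s₀)) (by fun_prop) (t := t) (by simpa using hat)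
    have e2 := eventually_pos_of_continuous
      (f := fun p => a + p.1 * η + (cL - m) * (t + p.1 * β - s₀)) (by fun_prop) (t := t)
      (by simpa using hat)
    have e3 := eventually_pos_of_continuous
      (f := fun p => a + p.1 * η + (cL - m) * (t + p.1 * β - s₀) + (cR - m) * (p.2 - t - p.1 * β))
      (by fun_prop) (t := t) (by simpa using hat)
    have hq1 : ∀ᶠ p : ℝ × ℝ in 𝓝 (0, t), 0 < queueLen q₀ (F p.1) m p.2 ∧
        (t + p.1 * β ≤ p.2 → queueLen q₀ (F p.1) m p.2
          = a + p.1 * η + (cL - m) * (t + p.1 * β - s₀) + (cR - m) * (p.2 - t - p.1 * β)) := by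
      filter_upwards [hP, e1, e2, e3] with p hp e1 e2 e3
      have h2 : t + p.1 * β ≤ p.2 → queueLen q₀ (F p.1) m p.2
          = a + p.1 * η + (cL - m) * (t + p.1 * β - s₀) + (cR - m) * (p.2 - t - p.1 * β) :=
        fun h1 => by rw [hp.2 h1, max_eq_left e2.le, max_eq_left e3.le]
      refine ⟨?_, h2⟩
      rcases le_total p.2 (t + p.1 * β) with h1 | h1
      · rw [hp.1 h1]; exact lt_max_of_lt_left e1
      · rw [h2 h1]; exact e3
    -- For the extra time `ε * β` the inflow is `cL` in place of `cR`. The outflow is `m` on both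
    -- sides, so no wave leaves.
    refine ⟨η + β * (cL - cR), 0, m, m, ?_, ?_, ?_⟩
    · filter_upwards [nhdsWithin_le_nhds (eventually_slices hq1), self_mem_nhdsWithin] with s e1 e2
      have e3 := e1.self_of_nhds.2 (by simpa using (mem_Ioi.1 e2).le)
      have e4 : ∀ᶠ ε in 𝓝 (0 : ℝ), t + ε * β < s :=
        (Continuous.tendsto (by fun_prop : Continuous fun ε : ℝ => t + ε * β)
            0).eventually (Iio_mem_nhds (by simpa using e2))
      filter_upwards [e1, e4] with ε e1 e4
      rw [e1.2 e4.le, e3]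
      ring
    · filter_upwards [hq1] with p hp
      rw [queueOut_eq_of_pos hp.1, ite_self]
    · exact ⟨fun h _ => by simp [h], fun _ _ h => absurd h hpos.ne', fun _ _ h => absurd h hpos.ne',
        fun _ _ => ⟨rfl, rfl⟩, fun h => absurd h hE⟩

/-- Near time `0` the inflow does not depend on `ε`, hence neither do the queue and its outflow.
This starts the induction over time. -/
theorem queueFamily_initial (hF : ∀ᶠ ε in 𝓝 (0 : ℝ), StepOn (F ε) 0 T) (hT : 0 < T) (hq₀ : 0 ≤ q₀)
    (h0 : ∃ c, ∀ᶠ p : ℝ × ℝ in 𝓝 (0, 0), 0 ≤ p.2 → F p.1 p.2 = c) :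
    (∀ᶠ s in 𝓝[>] 0, ShiftAt (fun ε => queueLen q₀ (F ε) m) s 0) ∧
      ∃ c, ∀ᶠ p : ℝ × ℝ in 𝓝 (0, 0), 0 ≤ p.2 →
        queueOut (queueLen q₀ (F p.1) m) (F p.1) m p.2 = c := by
  obtain ⟨c, hc⟩ := h0
  obtain ⟨d, hd, hd'⟩ := Metric.eventually_nhds_iff.1 hc
  have hbox : ∀ ε s, |ε| < d → s ∈ Ico 0 d → F ε s = c := fun ε s h1 h2 => by
    refine hd' (y := (ε, s)) ?_ h2.1
    rw [Prod.dist_eq, max_lt_iff, Real.dist_eq, Real.dist_eq, sub_zero, sub_zero]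
    exact ⟨h1, by rw [abs_of_nonneg h2.1]; exact h2.2⟩
  have hF0 := hF.self_of_nhds
  have hq : ∀ᶠ ε in 𝓝 (0 : ℝ), ∀ s ∈ Ico 0 (min d T),
      queueLen q₀ (F ε) m s = queueLen q₀ (F 0) m s ∧ F ε s = F 0 s := by
    filter_upwards [hF, Metric.ball_mem_nhds (0 : ℝ) hd] with ε h1 h2 s hs
    rw [Metric.mem_ball, dist_zero_right, Real.norm_eq_abs] at h2
    have hsd : s < d := hs.2.trans_le (min_le_left _ _)
    have h00 : |(0 : ℝ)| < d := by simpa using hd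
    have key : ∀ ε, |ε| < d → StepOn (F ε) 0 T →
        queueLen q₀ (F ε) m s = max (q₀ + (c - m) * (s - 0)) 0 := fun ε h2 h1 => by
      rw [queueLen_of_const (h1.intervalIntegrable hT.le) le_rfl (min_le_right d T)
        (fun r hr => hbox ε r h2 ⟨hr.1, hr.2.trans_le (min_le_left _ _)⟩) ⟨hs.1, hs.2.le⟩,
        queueLen_zero hq₀]
    exact ⟨by rw [key ε h2 h1, key 0 h00 hF0], by
      rw [hbox ε s h2 ⟨hs.1, hsd⟩, hbox 0 s h00 ⟨hs.1, hsd⟩]⟩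
  refine ⟨?_, queueOut (queueLen q₀ (F 0) m) (F 0) m 0, ?_⟩
  · filter_upwards [Ioo_mem_nhdsGT (lt_min hd hT)] with s hs
    filter_upwards [hq] with ε hε
    rw [(hε s ⟨hs.1.le, hs.2⟩).1]; ring
  · have hr := queueOut_right (q₀ := q₀) (m := m) hF0 hT.le (t := 0) ⟨le_rfl, hT⟩
    rw [eventually_nhdsWithin_iff] at hr
    have hr' := (continuous_snd.tendsto ((0 : ℝ), (0 : ℝ))).eventually hr
    have e := eventually_pos_of_continuous (f := fun p => min d T - p.2) (by fun_prop) (t := 0)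
      (by simpa using ⟨hd, hT⟩)
    filter_upwards [hr', e, eventually_fst hq] with p h1 h2 h3 h4
    have h5 := h3 p.2 ⟨h4, by linarith⟩
    rw [← h1 h4]
    unfold queueOut
    rw [h5.1, h5.2]

/-- Induction along `(0, T]`: `queueFamily_left` handles limit times, and `queueFamily_step` passes
beyond each time. -/
theorem queueFamily_exists_left (hF : ∀ᶠ ε in 𝓝 (0 : ℝ), StepOn (F ε) 0 T) (hT : 0 < T)
    (hq₀ : 0 ≤ q₀) (h0 : ∃ c, ∀ᶠ p : ℝ × ℝ in 𝓝 (0, 0), 0 ≤ p.2 → F p.1 p.2 = c)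
    (hJ : ∀ t ∈ Ioc 0 T, ∃ cL cR β, JumpAt F t cL cR β)
    (hsim : ∀ t ∈ Ioo 0 T, ∀ cL cR β, JumpAt F t cL cR β →
      Empties (queueLen q₀ (F 0) m) t → cL = cR) :
    ∀ t ∈ Ioc 0 T, ∃ η, ∀ᶠ s in 𝓝[<] t, ShiftAt (fun ε => queueLen q₀ (F ε) m) s η := by
  have hspread : ∀ t η, (∀ᶠ s in 𝓝[>] t, ShiftAt (fun ε => queueLen q₀ (F ε) m) s η) →
      ∀ᶠ s in 𝓝[>] t, ∃ η, ∀ᶠ r in 𝓝[<] s, ShiftAt (fun ε => queueLen q₀ (F ε) m) r η := by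
    intro t η h
    obtain ⟨u, hu, hus⟩ := mem_nhdsGT_iff_exists_Ioo_subset.1 h
    filter_upwards [Ioo_mem_nhdsGT (mem_Ioi.1 hu)] with s hs
    refine ⟨η, ?_⟩
    filter_upwards [Ioo_mem_nhdsLT hs.1] with r hr using hus ⟨hr.1, hr.2.trans hs.2⟩
  refine forall_Ioc_of_left_right (hspread 0 0 (queueFamily_initial hF hT hq₀ h0).1) ?_ ?_
  · intro t ht hs
    obtain ⟨cL, cR, β, hβ⟩ := hJ t ht
    refine queueFamily_left hF ht hβ fun hcon => ?_
    obtain ⟨l, hl, hls⟩ := mem_nhdsLT_iff_exists_Ioo_subset.1 hcon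
    have hlt : max 0 l < t := max_lt ht.1 hl
    obtain ⟨s, hs1, hs2⟩ := exists_between hlt
    obtain ⟨η, hη⟩ := hs s ⟨(le_max_left _ _).trans_lt hs1, hs2⟩
    obtain ⟨r, hr, hr'⟩ := (hη.and (Ioo_mem_nhdsLT hs1)).exists
    exact hls ⟨(le_max_right _ _).trans_lt hr'.1, hr'.2.trans hs2⟩ ⟨η, hr⟩
  · rintro t ht ⟨η, hη⟩
    obtain ⟨cL, cR, β, hβ⟩ := hJ t ⟨ht.1, ht.2.le⟩
    obtain ⟨ηp, -, -, -, h, -⟩ := queueFamily_step hF ht hβ hη (hsim t ht cL cR β hβ)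
    exact hspread t ηp h

end QueueFamily

/-! ### The family of displaced controls -/

section Control

variable {T : ℝ} {δ : ℕ} {τ ξ : Fin δ → ℝ} {c : Fin (δ + 1) → ℝ}

theorem nodes_zero : nodes T τ 0 = 0 := rfl

theorem nodes_last : nodes T τ (Fin.last (δ + 1)) = T := by
  rw [nodes, ← Fin.succ_last, Fin.cons_succ, Fin.snoc_last]

theorem nodes_castSucc_succ (k : Fin δ) : nodes T τ k.castSucc.succ = τ k := by
  rw [nodes, Fin.cons_succ, Fin.snoc_castSucc]

/-- `nodes 0 ξ` serves as the vector of velocities of the nodes. Both end nodes are fixed, hence the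
final time is replaced by `0`. -/
theorem nodes_add_mul (ε : ℝ) (i : Fin (δ + 2)) :
    nodes T (fun k => τ k + ε * ξ k) i = nodes T τ i + ε * nodes 0 ξ i := by
  refine Fin.cases ?_ (fun i => ?_) i
  · simp [nodes_zero]
  · refine Fin.lastCases ?_ (fun i => ?_) i
    · simp [nodes_last]
    · simp only [nodes_castSucc_succ]

theorem strictMono_nodes (hT : 0 < T) (hτ : StrictMono τ) (hmem : ∀ k, τ k ∈ Ioo 0 T) :
    StrictMono (nodes T τ) := by
  have hsucc : ∀ (k : Fin (δ + 1)) (a : ℝ), a < T → (∀ m : Fin δ, m.castSucc = k → a < τ m) →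
      a < nodes T τ k.succ := by
    intro k a
    refine Fin.lastCases (fun h _ => ?_) (fun m _ h => ?_) k
    · rwa [Fin.succ_last, nodes_last]
    · rw [nodes_castSucc_succ]
      exact h m rfl
  rw [Fin.strictMono_iff_lt_succ]
  refine fun i => hsucc i _ ?_ ?_
  · refine Fin.cases hT (fun k => ?_) i
    rw [Fin.castSucc_succ, nodes_castSucc_succ]
    exact (hmem k).2
  · refine Fin.cases (fun m _ => (hmem m).1) (fun k m hm => ?_) i
    rw [Fin.castSucc_succ, nodes_castSucc_succ]
    refine hτ ?_
    rw [← Fin.castSucc_lt_castSucc_iff, hm]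
    exact Fin.castSucc_lt_succ

theorem pcControl_eq (h : StrictMono (nodes T τ)) {k : Fin (δ + 1)} {s : ℝ}
    (hs : s ∈ Ico (nodes T τ k.castSucc) (nodes T τ k.succ)) : pcControl T τ c s = c k := by
  rw [pcControl, Finset.sum_eq_single k, indicator_of_mem hs]
  · intro l _ hl
    refine indicator_of_notMem (fun hsl => ?_) _
    rcases lt_or_gt_of_ne hl with hlk | hlk
    · have := h.monotone (show l.succ ≤ k.castSucc from Fin.succ_le_castSucc_iff.2 hlk)
      exact absurd hsl.2 (not_lt.2 (this.trans hs.1))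
    · have := h.monotone (show k.succ ≤ l.castSucc from Fin.succ_le_castSucc_iff.2 hlk)
      exact absurd hs.2 (not_lt.2 (this.trans hsl.1))
  · exact fun h => absurd (Finset.mem_univ k) h

theorem exists_nodes_Ico {s : ℝ} (hs : s ∈ Ico 0 T) :
    ∃ k : Fin (δ + 1), s ∈ Ico (nodes T τ k.castSucc) (nodes T τ k.succ) := by
  by_contra! hc
  have : ∀ i, nodes T τ i ≤ s := fun i => by
    induction i using Fin.induction with
    | zero => exact hs.1
    | succ i ih => exact not_lt.1 fun h => hc i ⟨ih, h⟩
  have := this (Fin.last _)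
  rw [nodes_last] at this
  exact absurd hs.2 (not_lt.2 this)

theorem exists_nodes_Ioc {s : ℝ} (hs : s ∈ Ioc 0 T) :
    ∃ k : Fin (δ + 1), s ∈ Ioc (nodes T τ k.castSucc) (nodes T τ k.succ) := by
  by_contra! hc
  have : ∀ i, nodes T τ i < s := fun i => by
    induction i using Fin.induction with
    | zero => exact hs.1
    | succ i ih => exact not_le.1 fun h => hc i ⟨ih, h⟩
  have := this (Fin.last _)
  rw [nodes_last] at this
  exact absurd hs.2 (not_le.2 this)

theorem isStepControl_pcControl {C : Chain} (hT : 0 < T) (h : StrictMono (nodes T τ))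
    (hc : ∀ k, c k ∈ Icc 0 (C.μ 1)) : IsStepControl C T (pcControl T τ c) := by
  refine ⟨stepOn_of_germs (fun t ht => ?_) (fun t ht => ?_) hT, fun s hs => ?_⟩
  · obtain ⟨k, hk⟩ := exists_nodes_Ioc (τ := τ) ht
    refine ⟨c k, ?_⟩
    filter_upwards [Ioo_mem_nhdsLT hk.1] with s hs
    exact pcControl_eq h ⟨hs.1.le, hs.2.trans_le hk.2⟩
  · obtain ⟨k, hk⟩ := exists_nodes_Ico (τ := τ) ht
    refine ⟨c k, ?_⟩
    filter_upwards [Ico_mem_nhdsGE hk.2] with s hs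
    exact pcControl_eq h ⟨hk.1.trans hs.1, hs.2⟩
  · obtain ⟨k, hk⟩ := exists_nodes_Ico (τ := τ) hs
    rw [pcControl_eq h hk]
    exact hc k

theorem eventually_strictMono_nodes (h : StrictMono (nodes T τ)) :
    ∀ᶠ ε in 𝓝 (0 : ℝ), StrictMono (nodes T fun k => τ k + ε * ξ k) := by
  simp only [Fin.strictMono_iff_lt_succ, nodes_add_mul, eventually_all]
  intro i
  have h1 : Continuous fun ε : ℝ =>
      nodes T τ i.succ + ε * nodes 0 ξ i.succ - (nodes T τ i.castSucc + ε * nodes 0 ξ i.castSucc) := by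
    fun_prop
  filter_upwards [(h1.tendsto 0).eventually (Ioi_mem_nhds (a := 0) (by
    simpa using h i.castSucc_lt_succ))] with ε hε
  exact sub_pos.1 hε

theorem shiftedControl_zero : shiftedControl T τ c ξ 0 = pcControl T τ c := by
  simp [shiftedControl]

theorem jumpAt_shiftedControl_node (h : StrictMono (nodes T τ)) (k : Fin δ) :
    JumpAt (shiftedControl T τ c ξ) (τ k) (c k.castSucc) (c k.succ) (ξ k) := by
  have e1 := eventually_pos_of_continuous (t := τ k) (f := fun p =>
    p.2 - (nodes T τ k.castSucc.castSucc + p.1 * nodes 0 ξ k.castSucc.castSucc)) (by fun_prop) (by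
      have := h (Fin.castSucc_lt_succ (i := k.castSucc))
      rw [nodes_castSucc_succ] at this
      simpa using this)
  have e2 := eventually_pos_of_continuous (t := τ k) (f := fun p =>
    nodes T τ k.succ.succ + p.1 * nodes 0 ξ k.succ.succ - p.2) (by fun_prop) (by
      have := h (Fin.castSucc_lt_succ (i := k.succ))
      rw [Fin.castSucc_succ, nodes_castSucc_succ] at this
      simpa using this)
  filter_upwards [e1, e2, eventually_fst (eventually_strictMono_nodes (ξ := ξ) h)] with p e1 e2 e3
  simp only [← nodes_add_mul] at e1 e2
  split_ifs with hlt
  · refine pcControl_eq e3 ⟨by linarith, ?_⟩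
    rw [nodes_castSucc_succ]
    exact hlt
  · refine pcControl_eq e3 ⟨?_, by linarith⟩
    rw [Fin.castSucc_succ, nodes_castSucc_succ]
    exact not_lt.1 hlt

theorem jumpAt_shiftedControl (h : StrictMono (nodes T τ)) {t : ℝ} (ht : t ∈ Ioo 0 T) :
    (∃ k, t = τ k) ∨ ∃ a, JumpAt (shiftedControl T τ c ξ) t a a 0 := by
  obtain ⟨k, hk⟩ := exists_nodes_Ico (τ := τ) (Ioo_subset_Ico_self ht)
  rcases hk.1.eq_or_lt with heq | hlt
  · left
    induction k using Fin.cases with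
    | zero => exact absurd ht.1 (by rw [← heq]; exact lt_irrefl _)
    | succ i => exact ⟨i, by rw [← heq, Fin.castSucc_succ, nodes_castSucc_succ]⟩
  · right
    refine ⟨c k, ?_⟩
    have e1 := eventually_pos_of_continuous (t := t) (f := fun p =>
      p.2 - (nodes T τ k.castSucc + p.1 * nodes 0 ξ k.castSucc)) (by fun_prop) (by simpa using hlt)
    have e2 := eventually_pos_of_continuous (t := t) (f := fun p =>
      nodes T τ k.succ + p.1 * nodes 0 ξ k.succ - p.2) (by fun_prop) (by simpa using hk.2)
    filter_upwards [e1, e2, eventually_fst (eventually_strictMono_nodes (ξ := ξ) h)] with p e1 e2 e3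
    simp only [← nodes_add_mul] at e1 e2
    rw [ite_self]
    exact pcControl_eq e3 ⟨by linarith, by linarith⟩

theorem shiftedControl_initial (h : StrictMono (nodes T τ)) :
    ∃ a, ∀ᶠ p : ℝ × ℝ in 𝓝 (0, 0), 0 ≤ p.2 → shiftedControl T τ c ξ p.1 p.2 = a := by
  refine ⟨c 0, ?_⟩
  have e2 := eventually_pos_of_continuous (t := 0) (f := fun p =>
    nodes T τ (Fin.succ 0) + p.1 * nodes 0 ξ (Fin.succ 0) - p.2) (by fun_prop) (by
      have := h (Fin.castSucc_lt_succ (i := (0 : Fin (δ + 1))))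
      simpa [nodes_zero] using this)
  filter_upwards [e2, eventually_fst (eventually_strictMono_nodes (ξ := ξ) h)] with p e2 e3 hp
  simp only [← nodes_add_mul] at e2
  exact pcControl_eq e3 ⟨hp, by linarith⟩

end Control

/-! ### The families along the chain -/

section Families

variable {C : Chain} {D : InitialData} {T : ℝ}

theorem JumpAt.comp_sub {F : ℝ → ℝ → ℝ} {t d cL cR β : ℝ} (h : JumpAt F (t - d) cL cR β) :
    JumpAt (fun ε s => F ε (s - d)) t cL cR β := by
  have h1 : Tendsto (fun p : ℝ × ℝ => (p.1, p.2 - d)) (𝓝 (0, t)) (𝓝 (0, t - d)) :=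
    (by fun_prop : Continuous fun p : ℝ × ℝ => (p.1, p.2 - d)).tendsto (0, t)
  filter_upwards [h1.eventually h] with p hp
  rw [hp]
  exact if_congr (by constructor <;> intro h <;> linarith) rfl rfl

theorem jumpAt_of_germs {F : ℝ → ℝ → ℝ} {t cL cR : ℝ}
    (hL : ∀ᶠ p in 𝓝 ((0 : ℝ), t), p.2 < t → F p.1 p.2 = cL)
    (hR : ∀ᶠ p in 𝓝 ((0 : ℝ), t), t ≤ p.2 → F p.1 p.2 = cR) : JumpAt F t cL cR 0 := by
  filter_upwards [hL, hR] with p h1 h2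
  rw [mul_zero, add_zero]
  split_ifs with h
  · exact h1 h
  · exact h2 (not_lt.1 h)

theorem eventually_snd_of_nhdsWithin {P : ℝ → Prop} {s : Set ℝ} {t : ℝ} (h : ∀ᶠ r in 𝓝[s] t, P r) :
    ∀ᶠ p in 𝓝 ((0 : ℝ), t), p.2 ∈ s → P p.2 :=
  (continuous_snd.tendsto ((0 : ℝ), t)).eventually (eventually_nhdsWithin_iff.1 h)

/-- Waves issuing from the initial density do not move with `ε`. This includes the wave with label
`0`, because the inflow near time `0` is the same constant for all small `ε`. -/
theorem jumpAt_entry_of_nonpos (hD : D.Admissible C) {j : ℕ} (hj : j ∈ Finset.Icc 1 C.P)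
    {g : ℝ → ℝ → ℝ} (h0 : ∃ c, ∀ᶠ p : ℝ × ℝ in 𝓝 (0, 0), 0 ≤ p.2 → g p.1 p.2 = c) {s : ℝ}
    (hs : s ∈ Ioc (-C.procTime j) 0) : ∃ cL cR, JumpAt (fun ε => entry C D j (g ε)) s cL cR 0 := by
  obtain ⟨cL, hL⟩ := entry_left_of_nonpos hD hj hs
  have hL' : ∀ᶠ p in 𝓝 ((0 : ℝ), s), p.2 < s → entry C D j (g p.1) p.2 = cL := by
    filter_upwards [eventually_snd_of_nhdsWithin hL] with p hp h
    rw [entry, if_neg (by linarith [hs.2]), hp h]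
  rcases hs.2.eq_or_lt with rfl | hneg
  · obtain ⟨c, hc⟩ := h0
    refine ⟨cL, c, jumpAt_of_germs hL' ?_⟩
    filter_upwards [hc] with p hp h
    rw [entry, if_pos h, hp h]
  · obtain ⟨cR, hR⟩ := entry_right_of_neg hD hj ⟨hs.1.le, hneg⟩
    refine ⟨cL, cR, jumpAt_of_germs hL' ?_⟩
    filter_upwards [eventually_snd_of_nhdsWithin hR] with p hp h
    rw [entry, if_neg (not_le.2 (hp h).1), (hp h).2]

theorem JumpAt.entry {j : ℕ} {g : ℝ → ℝ → ℝ} {s cL cR β : ℝ} (h : JumpAt g s cL cR β)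
    (hs : 0 < s) : JumpAt (fun ε => entry C D j (g ε)) s cL cR β := by
  have e := eventually_pos_of_continuous (f := fun p => p.2) (by fun_prop) (t := s) hs
  filter_upwards [h, e] with p hp e
  rw [SupplyChain.entry, if_pos e.le, hp]

theorem essLeft_eq {f : ℝ → ℝ} {t c : ℝ} (h : ∀ᶠ s in 𝓝[<] t ⊓ ae volume, f s = c) :
    essLeft f t = c := by
  have := neBot_nhdsLT_inf_ae t
  exact (tendsto_const_nhds.congr' (h.mono fun _ hs => hs.symm)).limUnder_eq

theorem essRight_eq {f : ℝ → ℝ} {t c : ℝ} (h : ∀ᶠ s in 𝓝[>] t ⊓ ae volume, f s = c) :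
    essRight f t = c := by
  have := neBot_nhdsGT_inf_ae t
  exact (tendsto_const_nhds.congr' (h.mono fun _ hs => hs.symm)).limUnder_eq

/-- Essential limits ignore null sets, so they transfer from the canonical flow to an arbitrary
solution; `g` converts fluxes into densities where needed. -/
theorem JumpAt.ess_eq {F : ℝ → ℝ → ℝ} {f g : ℝ → ℝ} {t cL cR β : ℝ} (h : JumpAt F t cL cR β)
    (ht : t ∈ Ioo 0 T) (hf : ∀ᵐ s ∂volume.restrict (Ioo 0 T), f s = g (F 0 s)) :
    essLeft f t = g cL ∧ essRight f t = g cR := by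
  have h0 : ∀ᶠ s in 𝓝 t, F 0 s = if s < t then cL else cR := by
    filter_upwards [eventually_slices h] with s hs
    simpa using hs.self_of_nhds
  have h1 : ∀ᶠ s in 𝓝 t ⊓ ae volume, f s = g (F 0 s) ∧ F 0 s = if s < t then cL else cR := by
    rw [ae_restrict_iff' measurableSet_Ioo] at hf
    filter_upwards [mem_inf_of_left h0, mem_inf_of_left (isOpen_Ioo.mem_nhds ht),
      mem_inf_of_right hf] with s a b c
    exact ⟨c b, a⟩
  constructor
  · apply essLeft_eq
    filter_upwards [inf_le_inf_right _ nhdsWithin_le_nhds h1,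
      mem_inf_of_left self_mem_nhdsWithin] with s hs hst
    rw [hs.1, hs.2, if_pos (mem_Iio.1 hst)]
  · apply essRight_eq
    filter_upwards [inf_le_inf_right _ nhdsWithin_le_nhds h1,
      mem_inf_of_left self_mem_nhdsWithin] with s hs hst
    rw [hs.1, hs.2, if_neg (not_lt.2 (mem_Ioi.1 hst).le)]

end Families

/-! ### Tangent vectors along the chain -/

section Tangent

variable {C : Chain} {D : InitialData} {T : ℝ}

/-- The dictionary between the two sets of rules: a flux is `v` times a density, and a shift is `v`
times the velocity of the arrival time. The incoming shift matters only where there is a jump. -/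
theorem FluxRule.interactionRule {n : ℕ} {q : ℝ → ℝ} {t cL cR β η ηp βo ξin : ℝ}
    (hv : 0 < C.v n) (h : FluxRule q t (C.μ (n + 1)) cL cR β η ηp βo)
    (hx : cL ≠ cR → ξin = C.v n * β) :
    InteractionRule C (n + 1) q t (cL / C.v n) (cR / C.v n) ξin η ηp (C.v (n + 1) * βo) := by
  have hne : cL / C.v n ≠ cR / C.v n → cL ≠ cR := fun h h' => h (by rw [h'])
  have hR : C.v n * (cR / C.v n) = cR := mul_div_cancel₀ _ hv.ne'
  have hL : C.v n * (cL / C.v n) = cL := mul_div_cancel₀ _ hv.ne'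
  constructor
  · intro h1 h2
    obtain ⟨h3, h4⟩ := h.none ((div_left_inj' hv.ne').1 h1) h2
    exact ⟨h3, by rw [h4, mul_zero]⟩
  · intro h1 h2 h3 h4
    simp only [Nat.add_sub_cancel] at h4 ⊢
    rw [hR] at h4
    obtain ⟨h5, h6⟩ := h.below (hne h1) h2 h3 h4
    exact ⟨by rw [hx (hne h1), h5]; field_simp, h6⟩
  · intro h1 h2 h3 h4
    simp only [Nat.add_sub_cancel] at h4 ⊢
    rw [hR] at h4 ⊢
    obtain ⟨h5, h6⟩ := h.above (hne h1) h2 h3 h4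
    exact ⟨by rw [hx (hne h1), h5]; field_simp, by rw [hx (hne h1), h6]; field_simp⟩
  · intro h1 h2
    obtain ⟨h5, h6⟩ := h.nonempty (hne h1) h2
    exact ⟨by rw [h5, mul_zero], by rw [hx (hne h1), h6]; field_simp⟩
  · intro h1
    obtain ⟨h5, h6⟩ := h.emptying h1
    simp only [Nat.add_sub_cancel]
    exact ⟨h5, by rw [h6, hL]; ring⟩

/-- The cases of the rule are exhaustive and each fixes both outputs, so any shifts that obey the
rule take the computed values. -/
theorem FluxRule.eq_of_interactionRule {n : ℕ} {q : ℝ → ℝ} {t cL cR β η ηp βo ξin ηp' ξo : ℝ}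
    (hv : 0 < C.v n) (hq : 0 ≤ q t) (h : FluxRule q t (C.μ (n + 1)) cL cR β η ηp βo)
    (hx : cL ≠ cR → ξin = C.v n * β)
    (hr : InteractionRule C (n + 1) q t (cL / C.v n) (cR / C.v n) ξin η ηp' ξo) :
    ηp' = ηp ∧ ξo = C.v (n + 1) * βo := by
  have hr' := h.interactionRule hv hx
  by_cases hE : Empties q t
  · rw [(hr.emptying hE).1, (hr.emptying hE).2, (hr'.emptying hE).1, (hr'.emptying hE).2]
    exact ⟨rfl, rfl⟩
  by_cases hc : cL / C.v n = cR / C.v n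
  · rw [(hr.none hc hE).1, (hr.none hc hE).2, (hr'.none hc hE).1, (hr'.none hc hE).2]
    exact ⟨rfl, rfl⟩
  rcases hq.eq_or_lt with hz | hpos
  · rcases le_or_gt (C.v (n + 1 - 1) * (cR / C.v n)) (C.μ (n + 1)) with hm | hm
    · have h1 := hr.wave_empty_below hc hE hz.symm hm
      have h2 := hr'.wave_empty_below hc hE hz.symm hm
      exact ⟨h1.2.trans h2.2.symm, h1.1.trans h2.1.symm⟩
    · have h1 := hr.wave_empty_above hc hE hz.symm hm
      have h2 := hr'.wave_empty_above hc hE hz.symm hm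
      exact ⟨h1.2.trans h2.2.symm, h1.1.trans h2.1.symm⟩
  · have h1 := hr.wave_nonempty hc hpos
    have h2 := hr'.wave_nonempty hc hpos
    exact ⟨h1.2.trans h2.2.symm, h1.1.trans h2.1.symm⟩

/-- The function `x` gives the shifts of the waves entering processor `n`, for the family of
controls `u`. -/
structure WaveShift (C : Chain) (D : InitialData) (T : ℝ) (u : ℝ → ℝ → ℝ) (n : ℕ) (x : ℝ → ℝ) :
    Prop where
  initial : ∃ c, ∀ᶠ p : ℝ × ℝ in 𝓝 (0, 0), 0 ≤ p.2 → inflow C D (u p.1) n p.2 = c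
  nonpos : ∀ s ≤ 0, x s = 0
  jump : ∀ s ∈ Ioo 0 T, ∃ cL cR β, JumpAt (fun ε => inflow C D (u ε) n) s cL cR β ∧
    (cL ≠ cR → x s = C.v n * β)

/-- Evolution of shifts from processor `n`, with wave shifts `x`, to queue `n + 1`, with shift `h`,
and processor `n + 1`, with wave shifts `y`. -/
structure ShiftStep (C : Chain) (T : ℝ) (S : State) (n : ℕ) (x y h : ℝ → ℝ) : Prop where
  nonpos : ∀ s ≤ 0, y s = 0
  initial : h 0 = 0 ∧ ∀ᶠ s in 𝓝[>] 0, h s = 0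
  evolution : ∀ t ∈ Ioo 0 T, ∃ ηm : ℝ,
    (∀ᶠ s in 𝓝[<] t, h s = ηm) ∧ (∀ᶠ s in 𝓝[>] t, h s = h t) ∧
    InteractionRule C (n + 1) (S.q (n + 1)) t
      (essLeft (S.outDensity C n) t) (essRight (S.outDensity C n) t)
      (x (t - C.procTime n)) ηm (h t) (y t)

variable {u : ℝ → ℝ → ℝ} {n : ℕ} {x : ℝ → ℝ}

theorem WaveShift.jump_outflow (hD : D.Admissible C) (hn : n ∈ Finset.Icc 1 C.P)
    (h : WaveShift C D T u n x) {t : ℝ} (ht : t ∈ Ioo 0 (T + C.procTime n)) :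
    ∃ cL cR β, JumpAt (fun ε => outflow C D (u ε) n) t cL cR β ∧
      (cL ≠ cR → x (t - C.procTime n) = C.v n * β) := by
  rcases le_or_gt (t - C.procTime n) 0 with h0 | h0
  · obtain ⟨cL, cR, hJ⟩ := jumpAt_entry_of_nonpos hD hn (g := fun ε => inflow C D (u ε) n) h.initial
      (s := t - C.procTime n) ⟨by linarith [ht.1], h0⟩
    exact ⟨cL, cR, 0, hJ.comp_sub, fun _ => by rw [h.nonpos _ h0, mul_zero]⟩
  · obtain ⟨cL, cR, β, hJ, hx⟩ := h.jump (t - C.procTime n) ⟨h0, by linarith [ht.2]⟩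
    exact ⟨cL, cR, β, (hJ.entry h0).comp_sub, hx⟩

theorem outflow_initial (hD : D.Admissible C) (hn : n ∈ Finset.Icc 1 C.P) (u : ℝ → ℝ → ℝ) :
    ∃ c, ∀ᶠ p : ℝ × ℝ in 𝓝 (0, 0), 0 ≤ p.2 → outflow C D (u p.1) n p.2 = c := by
  obtain ⟨c, hc⟩ := entry_right_of_neg hD hn (s := -C.procTime n)
    ⟨le_rfl, neg_neg_of_pos (C.procTime_pos n hn)⟩
  refine ⟨c, ?_⟩
  have h1 : Tendsto (fun p : ℝ × ℝ => p.2 - C.procTime n) (𝓝 (0, 0)) (𝓝 (-C.procTime n)) := by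
    have := (by fun_prop : Continuous fun p : ℝ × ℝ => p.2 - C.procTime n).tendsto (0, 0)
    simpa using this
  filter_upwards [h1.eventually (eventually_nhdsWithin_iff.1 hc)] with p hp h
  have := hp (mem_Ici.2 (by linarith))
  rw [outflow, entry, if_neg (not_le.2 this.1), this.2]

theorem queueAt_initial (hD : D.Admissible C) (hT : 0 < T)
    (hu : ∀ᶠ ε in 𝓝 (0 : ℝ), IsStepControl C T (u ε)) (hn : n ∈ Finset.Icc 1 C.P)
    (hn' : n + 1 ≤ C.P) :
    (∀ᶠ s in 𝓝[>] 0, ShiftAt (fun ε => queueAt C D (u ε) (n + 1)) s 0) ∧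
      ∃ c, ∀ᶠ p : ℝ × ℝ in 𝓝 (0, 0), 0 ≤ p.2 → inflow C D (u p.1) (n + 1) p.2 = c := by
  have hj : n + 1 ∈ Finset.Icc 2 C.P :=
    Finset.mem_Icc.2 ⟨by linarith [(Finset.mem_Icc.1 hn).1], hn'⟩
  simp only [inflow_succ C D _ (Finset.mem_Icc.1 hn).1]
  exact queueFamily_initial (F := fun ε => outflow C D (u ε) n)
    (hu.mono fun ε hε => stepOn_outflow hD hT hε hn) hT (hD.queue_nonneg _ hj)
    (outflow_initial hD hn u)

theorem Empties.congr {p q : ℝ → ℝ} {t : ℝ} (h : Empties q t) (hpq : p =ᶠ[𝓝 t] q) :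
    Empties p t :=
  ⟨hpq.self_of_nhds.trans h.1, by
    filter_upwards [h.2, nhdsWithin_le_nhds hpq] with s h1 h2
    rw [h2]; exact h1⟩

theorem InteractionRule.congr {j : ℕ} {p q : ℝ → ℝ} {t ρm ρp ξin ηm ηp ξo : ℝ}
    (h : InteractionRule C j q t ρm ρp ξin ηm ηp ξo) (hpq : p =ᶠ[𝓝 t] q) :
    InteractionRule C j p t ρm ρp ξin ηm ηp ξo := by
  have h1 : Empties p t → Empties q t := fun h => h.congr hpq.symm
  have h2 : Empties q t → Empties p t := fun h => h.congr hpq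
  have h3 := hpq.self_of_nhds
  exact ⟨fun a b => h.none a (mt h2 b), fun a b c => h.wave_empty_below a (mt h2 b) (h3 ▸ c),
    fun a b c => h.wave_empty_above a (mt h2 b) (h3 ▸ c), fun a b => h.wave_nonempty a (h3 ▸ b),
    fun a => h.emptying (h1 a)⟩

section Step

variable {S : State}

theorem queue_eventuallyEq (hD : D.Admissible C) (hT : 0 < T)
    (hu : ∀ᶠ ε in 𝓝 (0 : ℝ), IsStepControl C T (u ε)) (hS : IsSolution C D T (u 0) S)
    (hn1 : 1 ≤ n) (hn : n + 1 ∈ Finset.Icc 1 C.P) {t : ℝ} (ht : t ∈ Ioo 0 T) :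
    S.q (n + 1) =ᶠ[𝓝 t] queueAt C D (u 0) (n + 1) := by
  filter_upwards [isOpen_Ioo.mem_nhds ht] with s hs
  exact (hS.eq_canonical hD hT hu.self_of_nhds hn).2.2 (by omega) s (Ioo_subset_Icc_self hs)

theorem ess_outDensity (hD : D.Admissible C) (hT : 0 < T)
    (hu : ∀ᶠ ε in 𝓝 (0 : ℝ), IsStepControl C T (u ε)) (hS : IsSolution C D T (u 0) S)
    (hn : n ∈ Finset.Icc 1 C.P) {t cL cR β : ℝ} (ht : t ∈ Ioo 0 T)
    (hJ : JumpAt (fun ε => outflow C D (u ε) n) t cL cR β) :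
    essLeft (S.outDensity C n) t = cL / C.v n ∧ essRight (S.outDensity C n) t = cR / C.v n :=
  hJ.ess_eq (g := fun r => r / C.v n) ht (hS.eq_canonical hD hT hu.self_of_nhds hn).1

theorem eq_of_empties (hD : D.Admissible C) (hT : 0 < T)
    (hu : ∀ᶠ ε in 𝓝 (0 : ℝ), IsStepControl C T (u ε)) (hS : IsSolution C D T (u 0) S)
    {w : ℝ → ℝ} (hN : NoSimultaneous C T w S) (hn : n ∈ Finset.Icc 1 C.P) (hn' : n + 1 ≤ C.P)
    {t cL cR β : ℝ} (ht : t ∈ Ioo 0 T) (hJ : JumpAt (fun ε => outflow C D (u ε) n) t cL cR β)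
    (hE : Empties (queueLen (D.q₀ (n + 1)) (outflow C D (u 0) n) (C.μ (n + 1))) t) : cL = cR := by
  have hn1 := (Finset.mem_Icc.1 hn).1
  have h := hN.queue (n + 1) (Finset.mem_Icc.2 ⟨by omega, hn'⟩) t ht
    (hE.congr (queue_eventuallyEq hD hT hu hS hn1 (Finset.mem_Icc.2 ⟨by omega, hn'⟩) ht))
  rw [Nat.add_sub_cancel, (ess_outDensity hD hT hu hS hn ht hJ).1,
    (ess_outDensity hD hT hu hS hn ht hJ).2, div_left_inj' (C.v_pos hn).ne'] at h
  exact h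

variable (hD : D.Admissible C) (hT : 0 < T)
    (hu : ∀ᶠ ε in 𝓝 (0 : ℝ), IsStepControl C T (u ε)) (hS : IsSolution C D T (u 0) S)
    {w : ℝ → ℝ} (hN : NoSimultaneous C T w S) (hn : n ∈ Finset.Icc 1 C.P) (hn' : n + 1 ≤ C.P)
    (hx : WaveShift C D T u n x)
include hD hT hu hS hN hn hn' hx

theorem WaveShift.exists_left : ∀ t ∈ Ioc 0 T, ∃ η, ∀ᶠ s in 𝓝[<] t,
    ShiftAt (fun ε => queueAt C D (u ε) (n + 1)) s η := by
  have hp := C.procTime_pos n hn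
  have hj : n + 1 ∈ Finset.Icc 2 C.P :=
    Finset.mem_Icc.2 ⟨by linarith [(Finset.mem_Icc.1 hn).1], hn'⟩
  refine queueFamily_exists_left (F := fun ε => outflow C D (u ε) n)
    (hu.mono fun ε hε => stepOn_outflow hD hT hε hn) hT (hD.queue_nonneg _ hj)
    (outflow_initial hD hn u) (fun t ht => ?_) fun t ht cL cR β hJ hE =>
      eq_of_empties hD hT hu hS hN hn hn' ht hJ hE
  obtain ⟨cL, cR, β, hJ, -⟩ := hx.jump_outflow hD hn (t := t) ⟨ht.1, by linarith [ht.2]⟩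
  exact ⟨cL, cR, β, hJ⟩

/-- The equivalence is used both ways: from right to left to construct shifts, from left to right to
identify given shifts with derivatives. -/
theorem WaveShift.interaction {t η : ℝ} (ht : t ∈ Ioo 0 T)
    (h : ∀ᶠ s in 𝓝[<] t, ShiftAt (fun ε => queueAt C D (u ε) (n + 1)) s η) :
    ∃ ηp βo cL cR, (∀ᶠ s in 𝓝[>] t, ShiftAt (fun ε => queueAt C D (u ε) (n + 1)) s ηp) ∧
      JumpAt (fun ε => inflow C D (u ε) (n + 1)) t cL cR βo ∧
      ∀ ηp' ξo, InteractionRule C (n + 1) (S.q (n + 1)) t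
        (essLeft (S.outDensity C n) t) (essRight (S.outDensity C n) t)
        (x (t - C.procTime n)) η ηp' ξo ↔ ηp' = ηp ∧ ξo = C.v (n + 1) * βo := by
  have hp := C.procTime_pos n hn
  have hv := C.v_pos hn
  have hn1 := (Finset.mem_Icc.1 hn).1
  obtain ⟨cL, cR, β, hJ, hxβ⟩ := hx.jump_outflow hD hn (t := t) ⟨ht.1, by linarith [ht.2]⟩
  have hstep := hu.mono fun ε hε => stepOn_outflow hD hT hε hn
  obtain ⟨ηp, βo, cL', cR', h1, h2, h3⟩ :=
    queueFamily_step (F := fun ε => outflow C D (u ε) n) hstep ht hJ h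
      (eq_of_empties hD hT hu hS hN hn hn' ht hJ)
  refine ⟨ηp, βo, cL', cR', h1, ?_, fun ηp' ξo => ?_⟩
  · simp only [inflow_succ C D _ hn1]
    exact h2
  · rw [(ess_outDensity hD hT hu hS hn ht hJ).1, (ess_outDensity hD hT hu hS hn ht hJ).2]
    have hq := queue_eventuallyEq hD hT hu hS hn1 (Finset.mem_Icc.2 ⟨by omega, hn'⟩) ht
    constructor
    · intro hr
      exact h3.eq_of_interactionRule hv (queueLen_nonneg
        (hstep.self_of_nhds.intervalIntegrable hT.le) (Ioo_subset_Icc_self ht)) hxβ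
        (hr.congr hq.symm)
    · rintro ⟨rfl, rfl⟩
      exact (h3.interactionRule hv hxβ).congr hq

/-- The derivatives of the queue themselves define the shift; since left and right germs exist at
every time, it remains to check that the chosen values fit together. -/
theorem WaveShift.exists_step : ∃ y h, ShiftStep C T S n x y h := by
  have hL := hx.exists_left hD hT hu hS hN hn hn'
  have hR := (queueAt_initial hD hT hu hn hn').1
  have key : ∀ t, ∃ ηm ηp ξo, t ∈ Ioo 0 T →
      (∀ᶠ s in 𝓝[<] t, ShiftAt (fun ε => queueAt C D (u ε) (n + 1)) s ηm) ∧
      (∀ᶠ s in 𝓝[>] t, ShiftAt (fun ε => queueAt C D (u ε) (n + 1)) s ηp) ∧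
      InteractionRule C (n + 1) (S.q (n + 1)) t
        (essLeft (S.outDensity C n) t) (essRight (S.outDensity C n) t)
        (x (t - C.procTime n)) ηm ηp ξo := by
    intro t
    by_cases ht : t ∈ Ioo 0 T
    · obtain ⟨η, hη⟩ := hL t ⟨ht.1, ht.2.le⟩
      obtain ⟨ηp, βo, -, -, h1, -, h2⟩ := hx.interaction hD hT hu hS hN hn hn' ht hη
      exact ⟨η, ηp, _, fun _ => ⟨hη, h1, (h2 _ _).2 ⟨rfl, rfl⟩⟩⟩
    · exact ⟨0, 0, 0, fun h => absurd h ht⟩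
  choose ηm ηp ξo hkey using key
  -- The values `ηp` were chosen separately for each time; uniqueness of the slope makes them
  -- constant on intervals where the queue has a constant slope.
  have hconst : ∀ l r η, 0 ≤ l → r ≤ T →
      (∀ s ∈ Ioo l r, ShiftAt (fun ε => queueAt C D (u ε) (n + 1)) s η) →
      ∀ s ∈ Ioo l r, ηp s = η ∧ s ∈ Ioo 0 T := by
    intro l r η hl hr h s hs
    have hsT : s ∈ Ioo 0 T := ⟨hl.trans_lt hs.1, hs.2.trans_le hr⟩
    obtain ⟨s', h1, h2⟩ := ((hkey s hsT).2.1.and (Ioo_mem_nhdsGT hs.2)).exists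
    exact ⟨h1.unique (h s' ⟨hs.1.trans h2.1, h2.2⟩), hsT⟩
  have hright : ∀ t η, 0 ≤ t → t < T →
      (∀ᶠ s in 𝓝[>] t, ShiftAt (fun ε => queueAt C D (u ε) (n + 1)) s η) →
      ∀ᶠ s in 𝓝[>] t, ηp s = η ∧ s ∈ Ioo 0 T := by
    intro t η h0 htT h
    obtain ⟨r, hr, hrs⟩ := mem_nhdsGT_iff_exists_Ioo_subset.1 h
    filter_upwards [Ioo_mem_nhdsGT (lt_min (mem_Ioi.1 hr) htT)] with s hs
    exact hconst t (min r T) η h0 (min_le_right _ _)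
      (fun s hs => hrs ⟨hs.1, hs.2.trans_le (min_le_left _ _)⟩) s hs
  have hleft : ∀ t η, 0 < t → t ≤ T →
      (∀ᶠ s in 𝓝[<] t, ShiftAt (fun ε => queueAt C D (u ε) (n + 1)) s η) →
      ∀ᶠ s in 𝓝[<] t, ηp s = η ∧ s ∈ Ioo 0 T := by
    intro t η h0 htT h
    obtain ⟨l, hl, hls⟩ := mem_nhdsLT_iff_exists_Ioo_subset.1 h
    filter_upwards [Ioo_mem_nhdsLT (max_lt (mem_Iio.1 hl) h0)] with s hs
    exact hconst (max l 0) t η (le_max_right _ _) htT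
      (fun s hs => hls ⟨(le_max_left _ _).trans_lt hs.1, hs.2⟩) s hs
  classical
  refine ⟨fun t => if 0 < t then ξo t else 0, fun t => if t ∈ Ioo 0 T then ηp t else 0,
    fun s hs => if_neg hs.not_gt, ⟨if_neg (by simp), ?_⟩, fun t ht => ⟨ηm t, ?_, ?_, ?_⟩⟩
  · filter_upwards [hright 0 0 le_rfl hT hR] with s hs
    rw [if_pos hs.2, hs.1]
  · filter_upwards [hleft t _ ht.1 ht.2.le (hkey t ht).1] with s hs
    rw [if_pos hs.2, hs.1]
  · filter_upwards [hright t _ ht.1.le ht.2 (hkey t ht).2.1] with s hs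
    rw [if_pos hs.2, hs.1, if_pos ht]
  · simp only [if_pos ht.1, if_pos ht]
    exact (hkey t ht).2.2

/-- Shifts that obey the rules agree with the derivatives near time `0`. The rules preserve
agreement across each time, and at limit times the left germs of both functions exist and coincide.
The exceptional set is discrete in `(0, T)`. -/
theorem WaveShift.of_step {y h : ℝ → ℝ} (hy : ShiftStep C T S n x y h) :
    WaveShift C D T u (n + 1) y ∧
      ∀ t ∈ Ioo 0 T, ∀ᶠ s in 𝓝[≠] t, ShiftAt (fun ε => queueAt C D (u ε) (n + 1)) s (h s) := by
  have hL := hx.exists_left hD hT hu hS hN hn hn'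
  have hR := queueAt_initial hD hT hu hn hn'
  have hspread : ∀ t,
      (∀ᶠ s in 𝓝[>] t, ShiftAt (fun ε => queueAt C D (u ε) (n + 1)) s (h s)) →
      ∀ᶠ s in 𝓝[>] t, s < T →
        ∀ᶠ r in 𝓝[<] s, ShiftAt (fun ε => queueAt C D (u ε) (n + 1)) r (h r) := by
    intro t ht
    obtain ⟨r, hr, hrs⟩ := mem_nhdsGT_iff_exists_Ioo_subset.1 ht
    filter_upwards [Ioo_mem_nhdsGT (mem_Ioi.1 hr)] with s hs _
    filter_upwards [Ioo_mem_nhdsLT hs.1] with r hr using hrs ⟨hr.1, hr.2.trans hs.2⟩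
  have hlem : ∀ t ∈ Ioo 0 T,
      (∀ᶠ s in 𝓝[<] t, ShiftAt (fun ε => queueAt C D (u ε) (n + 1)) s (h s)) →
      (∀ᶠ s in 𝓝[>] t, ShiftAt (fun ε => queueAt C D (u ε) (n + 1)) s (h s)) ∧
      ∃ cL cR βo, JumpAt (fun ε => inflow C D (u ε) (n + 1)) t cL cR βo ∧
        y t = C.v (n + 1) * βo := by
    intro t ht hl
    obtain ⟨ηm, h1, h2, h3⟩ := hy.evolution t ht
    have hl' : ∀ᶠ s in 𝓝[<] t, ShiftAt (fun ε => queueAt C D (u ε) (n + 1)) s ηm := by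
      filter_upwards [hl, h1] with s a b
      rwa [b] at a
    obtain ⟨ηp, βo, cL, cR, h4, h5, h6⟩ := hx.interaction hD hT hu hS hN hn hn' ht hl'
    obtain ⟨h7, h8⟩ := (h6 _ _).1 h3
    refine ⟨?_, cL, cR, βo, h5, h8⟩
    filter_upwards [h4, h2] with s a b
    rw [b, h7]; exact a
  -- The premise `t < T` is carried along because the induction principle includes `T`, while the
  -- rules are imposed on the open interval only.
  have hall : ∀ t ∈ Ioc 0 T, t < T →
      ∀ᶠ s in 𝓝[<] t, ShiftAt (fun ε => queueAt C D (u ε) (n + 1)) s (h s) := by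
    refine forall_Ioc_of_left_right ?_ ?_ ?_
    · refine hspread 0 ?_
      filter_upwards [hR.1, hy.initial.2] with s a b
      rw [b]; exact a
    · intro t ht hs htT
      obtain ⟨η, hη⟩ := hL t ht
      obtain ⟨ηm, h1, -, -⟩ := hy.evolution t ⟨ht.1, htT⟩
      obtain ⟨l, hl, hls⟩ := mem_nhdsLT_iff_exists_Ioo_subset.1 (hη.and h1)
      have hlt : max l 0 < t := max_lt (mem_Iio.1 hl) ht.1
      obtain ⟨s, hs1, hs2⟩ := exists_between hlt
      obtain ⟨r, hr, hr'⟩ := ((hs s ⟨(le_max_right _ _).trans_lt hs1, hs2⟩ (hs2.trans htT)).and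
        (Ioo_mem_nhdsLT hs1)).exists
      have hrl := hls ⟨(le_max_left _ _).trans_lt hr'.1, hr'.2.trans hs2⟩
      have hηη : η = ηm := by
        rw [← hrl.2]; exact hrl.1.unique hr
      filter_upwards [hη, h1] with s a b
      rw [b, ← hηη]; exact a
    · intro t ht h
      exact hspread t (hlem t ht (h ht.2)).1
  refine ⟨⟨hR.2, hy.nonpos, fun t ht => ?_⟩, fun t ht => ?_⟩
  · obtain ⟨-, cL, cR, βo, h1, h2⟩ := hlem t ht (hall t ⟨ht.1, ht.2.le⟩ ht.2)
    exact ⟨cL, cR, βo, h1, fun _ => h2⟩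
  · have hl := hall t ⟨ht.1, ht.2.le⟩ ht.2
    rw [← nhdsLT_sup_nhdsGT, eventually_sup]
    exact ⟨hl, (hlem t ht hl).1⟩

end Step

end Tangent

/-! ### Existence and identification of the tangent evolution -/

section TangentEvolution

variable {C : Chain} {D : InitialData} {T : ℝ} {δ : ℕ} {τ ξ : Fin δ → ℝ} {c : Fin (δ + 1) → ℝ}

theorem eventually_isStepControl (hT : 0 < T) (hu : IsPCControl C T τ c) :
    ∀ᶠ ε in 𝓝 (0 : ℝ), IsStepControl C T (shiftedControl T τ c ξ ε) := by
  filter_upwards [eventually_strictMono_nodes (ξ := ξ) (strictMono_nodes hT hu.strictMono hu.mem)]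
    with ε hε using isStepControl_pcControl hT hε hu.range

theorem waveShift_one (hT : 0 < T) (hu : IsPCControl C T τ c) {x : ℝ → ℝ} (hx : ∀ s ≤ 0, x s = 0)
    (hxτ : ∀ k, x (τ k) = C.v 1 * ξ k) : WaveShift C D T (shiftedControl T τ c ξ) 1 x := by
  have h := strictMono_nodes hT hu.strictMono hu.mem
  constructor
  · simp only [inflow_one]
    exact shiftedControl_initial h
  · exact hx
  · intro s hs
    simp only [inflow_one]
    rcases jumpAt_shiftedControl (c := c) (ξ := ξ) h hs with ⟨k, rfl⟩ | ⟨a, ha⟩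
    · exact ⟨_, _, _, jumpAt_shiftedControl_node h k, fun _ => hxτ k⟩
    · exact ⟨a, a, 0, ha, fun h => absurd rfl h⟩

variable {S : State}

theorem IsTangentEvolution.shiftStep {Z : Shifts} (hZ : IsTangentEvolution C T τ ξ S Z) {n : ℕ}
    (hn : 1 ≤ n) (hn' : n + 1 ≤ C.P) :
    ShiftStep C T S n (Z.ξ n) (Z.ξ (n + 1)) (Z.η (n + 1)) where
  nonpos := hZ.initial_wave _ (Finset.mem_Icc.2 ⟨by omega, hn'⟩)
  initial := hZ.initial_queue _ (Finset.mem_Icc.2 ⟨by omega, hn'⟩)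
  evolution := hZ.evolution _ (Finset.mem_Icc.2 ⟨by omega, hn'⟩)

variable (hD : D.Admissible C) (hT : 0 < T) (hu : IsPCControl C T τ c)
  (hS : IsSolution C D T (shiftedControl T τ c ξ 0) S) {w : ℝ → ℝ} (hN : NoSimultaneous C T w S)
include hD hT hu hS hN

theorem IsTangentEvolution.waveShift {Z : Shifts} (hZ : IsTangentEvolution C T τ ξ S Z) {n : ℕ}
    (hn : n ∈ Finset.Icc 1 C.P) : WaveShift C D T (shiftedControl T τ c ξ) n (Z.ξ n) := by
  obtain ⟨hn1, hnP⟩ := Finset.mem_Icc.1 hn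
  clear hn
  induction n, hn1 using Nat.le_induction with
  | base =>
    exact waveShift_one hT hu (hZ.initial_wave 1 (Finset.mem_Icc.2 ⟨le_rfl, hnP⟩)) hZ.control_wave
  | succ n hn1 ih =>
    exact ((ih (by omega)).of_step hD hT (eventually_isStepControl hT hu) hS hN
      (Finset.mem_Icc.2 ⟨hn1, by omega⟩) hnP (hZ.shiftStep hn1 hnP)).1

theorem IsTangentEvolution.shiftAt {Z : Shifts} (hZ : IsTangentEvolution C T τ ξ S Z) {j : ℕ}
    (hj : j ∈ Finset.Icc 2 C.P) {t : ℝ} (ht : t ∈ Ioo 0 T) : ∀ᶠ s in 𝓝[≠] t,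
      ShiftAt (fun ε => queueAt C D (shiftedControl T τ c ξ ε) j) s (Z.η j s) := by
  obtain ⟨hj2, hjP⟩ := Finset.mem_Icc.1 hj
  obtain ⟨n, rfl⟩ := Nat.exists_eq_add_of_le' (one_le_two.trans hj2)
  have hn : n ∈ Finset.Icc 1 C.P := Finset.mem_Icc.2 ⟨by omega, by omega⟩
  exact ((hZ.waveShift hD hT hu hS hN hn).of_step hD hT (eventually_isStepControl hT hu) hS hN
    hn hjP (hZ.shiftStep (by omega) hjP)).2 t ht

theorem exists_isTangentEvolution : ∃ Z, IsTangentEvolution C T τ ξ S Z := by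
  classical
  have hmain : ∀ n, 1 ≤ n → n ≤ C.P → ∃ X H : ℕ → ℝ → ℝ, (∀ s ≤ 0, X 1 s = 0) ∧
      (∀ k, X 1 (τ k) = C.v 1 * ξ k) ∧ WaveShift C D T (shiftedControl T τ c ξ) n (X n) ∧
      ∀ i, 1 ≤ i → i < n → ShiftStep C T S i (X i) (X (i + 1)) (H (i + 1)) := by
    intro n hn
    induction n, hn using Nat.le_induction with
    | base =>
      intro _
      obtain ⟨x, hx0, hxτ⟩ : ∃ x : ℝ → ℝ, (∀ s ≤ 0, x s = 0) ∧ ∀ k, x (τ k) = C.v 1 * ξ k := by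
        refine ⟨fun s => if h : ∃ k, s = τ k then C.v 1 * ξ h.choose else 0, fun s hs => ?_,
          fun k => ?_⟩
        · exact dif_neg fun ⟨k, hk⟩ => by linarith [(hu.mem k).1]
        -- The chosen index need not be `k` syntactically; strict monotonicity of `τ` forces it.
        · have h : ∃ k', τ k = τ k' := ⟨k, rfl⟩
          exact (dif_pos h).trans (by rw [← hu.strictMono.injective h.choose_spec])
      exact ⟨fun _ => x, fun _ _ => 0, hx0, hxτ, waveShift_one hT hu hx0 hxτ,
        fun i h1 h2 => absurd h1 h2.not_ge⟩
    | succ n hn1 ih =>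
      intro hnP
      obtain ⟨X, H, h1, h2, h3, h4⟩ := ih (by omega)
      have hn : n ∈ Finset.Icc 1 C.P := Finset.mem_Icc.2 ⟨hn1, by omega⟩
      have hu' := eventually_isStepControl (ξ := ξ) hT hu
      obtain ⟨y, h, hy⟩ := h3.exists_step hD hT hu' hS hN hn hnP
      have hX : ∀ i, i ≤ n → Function.update X (n + 1) y i = X i := fun i hi =>
        Function.update_of_ne (by omega) _ _
      refine ⟨Function.update X (n + 1) y, Function.update H (n + 1) h, ?_, ?_, ?_, ?_⟩
      · rw [hX 1 hn1]; exact h1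
      · rw [hX 1 hn1]; exact h2
      · rw [Function.update_self]
        exact (h3.of_step hD hT hu' hS hN hn hnP hy).1
      · intro i hi1 hi2
        rw [hX i (by omega)]
        rcases (Nat.lt_succ_iff.1 hi2).eq_or_lt with rfl | hlt
        · rw [Function.update_self, Function.update_self]
          exact hy
        · rw [hX _ hlt, Function.update_of_ne (by omega)]
          exact h4 i hi1 hlt
  obtain ⟨X, H, h1, h2, -, h4⟩ := hmain C.P C.one_le_P le_rfl
  have key : ∀ j ∈ Finset.Icc 2 C.P, ShiftStep C T S (j - 1) (X (j - 1)) (X j) (H j) := by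
    intro j hj
    obtain ⟨hj2, hjP⟩ := Finset.mem_Icc.1 hj
    have := h4 (j - 1) (by omega) (by omega)
    rwa [Nat.sub_add_cancel (by omega)] at this
  refine ⟨⟨X, H⟩, fun j hj => ?_, h2, fun j hj => (key j hj).initial, fun j hj t ht => ?_⟩
  · rcases (Finset.mem_Icc.1 hj).1.eq_or_lt with rfl | hlt
    · exact h1
    · exact (key j (Finset.mem_Icc.2 ⟨hlt, (Finset.mem_Icc.1 hj).2⟩)).nonpos
  · have := (key j hj).evolution t ht
    rwa [Nat.sub_add_cancel (by linarith [(Finset.mem_Icc.1 hj).1])] at this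

end TangentEvolution

/-! ### Differentiating integrals along a family -/

section Variation

theorem IsCompact.finite_inter_of_eventually {K A : Set ℝ} (hK : IsCompact K)
    (h : ∀ t ∈ K, ∀ᶠ s in 𝓝[≠] t, s ∉ A) : (K ∩ A).Finite := by
  refine hK.induction_on (p := fun s => (s ∩ A).Finite) (by simp)
    (fun s t hst ht => ht.subset (inter_subset_inter_left _ hst))
    (fun s t hs ht => by rw [union_inter_distrib_right]; exact hs.union ht) fun t ht => ?_
  refine ⟨{s | s ∈ ({t} : Set ℝ)ᶜ → s ∉ A},
    mem_nhdsWithin_of_mem_nhds (eventually_nhdsWithin_iff.1 (h t ht)), ?_⟩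
  refine (finite_singleton t).subset fun s hs => ?_
  by_contra hc
  exact hs.1 hc hs.2

theorem ae_Ioo_of_eventually {P : ℝ → Prop} {a b : ℝ}
    (h : ∀ t ∈ Ioo a b, ∀ᶠ s in 𝓝[≠] t, P s) : ∀ᵐ t ∂volume.restrict (Ioo a b), P t := by
  rw [ae_restrict_iff' measurableSet_Ioo]
  change volume {t | ¬ (t ∈ Ioo a b → P t)} = 0
  refine measure_null_of_locally_null _ fun t ht => ⟨{t}, ?_, measure_singleton t⟩
  have ht' : t ∈ Ioo a b := by
    by_contra hc
    exact ht fun h => absurd h hc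
  have h1 := h t ht'
  rw [eventually_nhdsWithin_iff] at h1
  filter_upwards [nhdsWithin_le_nhds h1, self_mem_nhdsWithin] with s hs hs'
  by_contra hc
  exact hs' fun _ => hs hc

/-- The function counting whether `t` is passed when `d` moves to `e`. -/
def passing (d e t : ℝ) : ℝ := (if t < e then 1 else 0) - (if t < d then 1 else 0)

theorem passing_self (d t : ℝ) : passing d d t = 0 := sub_self _

variable {F : ℝ → ℝ → ℝ} {T : ℝ} {cL cR β : ℝ → ℝ}

theorem JumpAt.eventually_eq {t a b c : ℝ} (h : JumpAt F t a b c) :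
    ∀ᶠ s in 𝓝 t, F 0 s = if s < t then a else b := by
  filter_upwards [eventually_slices h] with s hs
  simpa using hs.self_of_nhds

theorem eq_of_jump_of_eventually_const {f : ℝ → ℝ} {t a b c : ℝ}
    (h : ∀ᶠ s in 𝓝 t, f s = if s < t then a else b) (hc : ∀ᶠ s in 𝓝 t, f s = c) : a = b := by
  obtain ⟨s, ⟨h1, h2⟩, h3⟩ :=
    (((h.and hc).filter_mono nhdsWithin_le_nhds).and (self_mem_nhdsWithin (s := Iio t))).exists
  have h4 := h.self_of_nhds
  rw [if_neg (lt_irrefl t), hc.self_of_nhds] at h4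
  rw [if_pos (mem_Iio.1 h3), h2] at h1
  exact h1.symm.trans h4

/-- Near each time the unperturbed function is constant on either side, so jumps do not accumulate
anywhere in the compact interval; `h0` covers the endpoint `0`. -/
theorem finite_jumps (h0 : ∃ c, ∀ᶠ p : ℝ × ℝ in 𝓝 (0, 0), 0 ≤ p.2 → F p.1 p.2 = c)
    (hJ : ∀ t ∈ Ioc 0 T, JumpAt F t (cL t) (cR t) (β t)) :
    {t | t ∈ Ioc 0 T ∧ cL t ≠ cR t}.Finite := by
  refine (IsCompact.finite_inter_of_eventually (K := Icc 0 T)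
    (A := {t | t ∈ Ioc 0 T ∧ cL t ≠ cR t}) isCompact_Icc ?_).subset
    fun t ht => ⟨Ioc_subset_Icc_self ht.1, ht⟩
  have key : ∀ t c : ℝ, t ∈ Ioc 0 T → (∀ᶠ s in 𝓝 t, F 0 s = c) → cL t = cR t := fun t c ht h =>
    eq_of_jump_of_eventually_const (hJ t ht).eventually_eq h
  intro t ht
  rcases ht.1.eq_or_lt with rfl | hpos
  · obtain ⟨c, hc⟩ := h0
    have h1 : ∀ᶠ s in 𝓝 (0 : ℝ), 0 ≤ s → F 0 s = c := by
      filter_upwards [eventually_slices hc] with s hs using hs.self_of_nhds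
    filter_upwards [nhdsWithin_le_nhds (eventually_eventually_nhds.2 h1)] with s hs hA
    refine hA.2 (key s c hA.1 ?_)
    filter_upwards [hs, Ioi_mem_nhds hA.1.1] with r h1 h2 using h1 (mem_Ioi.1 h2).le
  · have h1 := eventually_eventually_nhds.2 (hJ t ⟨hpos, ht.2⟩).eventually_eq
    filter_upwards [nhdsWithin_le_nhds h1, self_mem_nhdsWithin] with s hs hne hA
    rcases lt_or_gt_of_ne hne with hlt | hlt
    · refine hA.2 (key s (cL t) hA.1 ?_)
      filter_upwards [hs, Iio_mem_nhds hlt] with r h1 h2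
      rw [h1, if_pos (mem_Iio.1 h2)]
    · refine hA.2 (key s (cR t) hA.1 ?_)
      filter_upwards [hs, Ioi_mem_nhds hlt] with r h1 h2
      rw [h1, if_neg (mem_Ioi.1 h2).le.not_gt]

/-- Near a given time at most one summand is active and the identity is a case check. Compactness
makes the range of `ε` uniform in time. The quantifier over `g` stands after that over `t`, so that
`g` may depend on the time. -/
theorem eventually_sub_eq_sum (h0 : ∃ c, ∀ᶠ p : ℝ × ℝ in 𝓝 (0, 0), 0 ≤ p.2 → F p.1 p.2 = c)
    (hJ : ∀ t ∈ Ioc 0 T, JumpAt F t (cL t) (cR t) (β t)) {K : Finset ℝ}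
    (hK : ∀ t, t ∈ K ↔ t ∈ Ioc 0 T ∧ cL t ≠ cR t) :
    ∀ᶠ ε in 𝓝 (0 : ℝ), ∀ t ∈ Icc 0 T, ∀ g : ℝ → ℝ,
      g (F ε t) - g (F 0 t) = ∑ d ∈ K, (g (cL d) - g (cR d)) * passing d (d + ε * β d) t := by
  have hpass : ∀ t d : ℝ, t ≠ d → ∀ᶠ p in 𝓝 ((0 : ℝ), t), passing d (d + p.1 * β d) p.2 = 0 := by
    intro t d hne
    rcases lt_or_gt_of_ne hne with hlt | hlt
    · have e1 := eventually_pos_of_continuous (f := fun p => d - p.2) (by fun_prop) (t := t)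
        (by simpa using hlt)
      have e2 := eventually_pos_of_continuous (f := fun p => d + p.1 * β d - p.2) (by fun_prop)
        (t := t) (by simpa using hlt)
      filter_upwards [e1, e2] with p e1 e2
      rw [passing, if_pos (by linarith), if_pos (by linarith), sub_self]
    · have e1 := eventually_pos_of_continuous (f := fun p => p.2 - d) (by fun_prop) (t := t)
        (by simpa using hlt)
      have e2 := eventually_pos_of_continuous (f := fun p => p.2 - (d + p.1 * β d)) (by fun_prop)
        (t := t) (by simpa using hlt)
      filter_upwards [e1, e2] with p e1 e2
      rw [passing, if_neg (by linarith), if_neg (by linarith), sub_self]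
  have hall : ∀ t, ∀ᶠ p in 𝓝 ((0 : ℝ), t), ∀ d ∈ K, t ≠ d → passing d (d + p.1 * β d) p.2 = 0 := by
    intro t
    rw [Finset.eventually_all]
    intro d _
    by_cases hne : t = d
    · exact Eventually.of_forall fun p h => absurd hne h
    · filter_upwards [hpass t d hne] with p hp _ using hp
  have key : ∀ t ∈ Icc 0 T, ∀ᶠ p in 𝓝 ((0 : ℝ), t), p.2 ∈ Icc 0 T → ∀ g : ℝ → ℝ,
      g (F p.1 p.2) - g (F 0 p.2)
        = ∑ d ∈ K, (g (cL d) - g (cR d)) * passing d (d + p.1 * β d) p.2 := by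
    intro t ht
    rcases ht.1.eq_or_lt with rfl | hpos
    · obtain ⟨c, hc⟩ := h0
      have h1 : ∀ᶠ s in 𝓝 (0 : ℝ), 0 ≤ s → F 0 s = c := by
        filter_upwards [eventually_slices hc] with s hs using hs.self_of_nhds
      filter_upwards [hc, (continuous_snd.tendsto ((0 : ℝ), (0 : ℝ))).eventually h1, hall 0]
        with p e1 e2 e3 hp g
      rw [e1 hp.1, e2 hp.1, sub_self, Finset.sum_eq_zero]
      intro d hd
      rw [e3 d hd ((hK d).1 hd).1.1.ne, mul_zero]
    · have hJt := hJ t ⟨hpos, ht.2⟩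
      filter_upwards [hJt, (continuous_snd.tendsto ((0 : ℝ), t)).eventually hJt.eventually_eq,
        hall t] with p e1 e2 e3 hp g
      have e4 : g (F p.1 p.2) - g (F 0 p.2)
          = (g (cL t) - g (cR t)) * passing t (t + p.1 * β t) p.2 := by
        rw [e1, e2, passing]
        split_ifs <;> ring
      rw [e4]
      by_cases htK : t ∈ K
      · rw [Finset.sum_eq_single_of_mem t htK]
        intro d hd hne
        rw [e3 d hd hne.symm, mul_zero]
      · have hc : cL t = cR t := by
          by_contra hc
          exact htK ((hK t).2 ⟨⟨hpos, ht.2⟩, hc⟩)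
        rw [hc, sub_self, zero_mul, Finset.sum_eq_zero]
        intro d hd
        rw [e3 d hd (fun h => htK (h ▸ hd)), mul_zero]
  have h1 := isCompact_Icc.eventually_forall_of_forall_eventually (x₀ := (0 : ℝ))
    (K := Icc (0 : ℝ) T) (P := fun ε t => t ∈ Icc 0 T → ∀ g : ℝ → ℝ,
      g (F ε t) - g (F 0 t) = ∑ d ∈ K, (g (cL d) - g (cR d)) * passing d (d + ε * β d) t) key
  filter_upwards [h1] with ε hε t ht using hε t ht ht

theorem measurable_passing (d e : ℝ) : Measurable (passing d e) :=
  (Measurable.ite measurableSet_Iio measurable_const measurable_const).sub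
    (Measurable.ite measurableSet_Iio measurable_const measurable_const)

theorem abs_passing_le (d e t : ℝ) : |passing d e t| ≤ 1 := by
  unfold passing
  split_ifs <;> norm_num

theorem intervalIntegrable_mul_passing {k : ℝ → ℝ} {a b : ℝ}
    (hk : IntervalIntegrable k volume a b) (d e : ℝ) :
    IntervalIntegrable (fun t => k t * passing d e t) volume a b := by
  rw [intervalIntegrable_iff] at hk ⊢
  refine Integrable.mul_bdd (c := 1) hk (measurable_passing d e).aestronglyMeasurable
    (Eventually.of_forall fun t => abs_passing_le d e t)

theorem integral_abs_passing_le {T : ℝ} (hT : 0 ≤ T) (d e : ℝ) :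
    ∫ t in (0)..T, |passing d e t| ≤ |e - d| := by
  have h : ∀ t, |passing d e t| = (Ico (min d e) (max d e)).indicator (fun _ => 1) t := by
    intro t
    rw [indicator_apply]
    simp only [passing, mem_Ico, min_le_iff, lt_max_iff]
    split_ifs <;> grind
  simp only [h]
  rw [intervalIntegral.integral_of_le hT, integral_indicator_const _ measurableSet_Ico, smul_eq_mul,
    mul_one, measureReal_restrict_apply measurableSet_Ico]
  refine (measureReal_mono inter_subset_left (by simp)).trans ?_
  rw [Real.volume_real_Ico_of_le min_le_max, max_sub_min_eq_abs]

theorem exists_integral_abs_sub_le (hT : 0 ≤ T)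
    (h0 : ∃ c, ∀ᶠ p : ℝ × ℝ in 𝓝 (0, 0), 0 ≤ p.2 → F p.1 p.2 = c)
    (hJ : ∀ t ∈ Ioc 0 T, JumpAt F t (cL t) (cR t) (β t)) :
    ∃ M, ∀ᶠ ε in 𝓝 (0 : ℝ), ∫ t in (0)..T, |F ε t - F 0 t| ≤ M * |ε| := by
  have hfin := finite_jumps h0 hJ
  refine ⟨∑ d ∈ hfin.toFinset, |cL d - cR d| * |β d|, ?_⟩
  filter_upwards [eventually_sub_eq_sum h0 hJ (K := hfin.toFinset) fun t => hfin.mem_toFinset]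
    with ε hε
  have hsum : ∀ {f : ℝ → ℝ → ℝ}, (∀ d ∈ hfin.toFinset, IntervalIntegrable (f d) volume 0 T) →
      IntervalIntegrable (fun t => ∑ d ∈ hfin.toFinset, f d t) volume 0 T := fun h => by
    simpa only [Finset.sum_fn] using IntervalIntegrable.sum _ h
  have hpi : ∀ d ∈ hfin.toFinset, IntervalIntegrable
      (fun t => |cL d - cR d| * |passing d (d + ε * β d) t|) volume 0 T := by
    intro d _
    have := intervalIntegrable_mul_passing (k := fun _ => |cL d - cR d|) (a := 0) (b := T)
      intervalIntegrable_const d (d + ε * β d)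
    simpa only [abs_mul, abs_abs] using this.abs
  calc ∫ t in (0)..T, |F ε t - F 0 t|
      ≤ ∫ t in (0)..T, ∑ d ∈ hfin.toFinset, |cL d - cR d| * |passing d (d + ε * β d) t| := by
        refine intervalIntegral.integral_mono_on_of_le_Ioo hT ?_
          ?_ fun t ht => ?_
        · have : IntervalIntegrable (fun t => |∑ d ∈ hfin.toFinset,
              (cL d - cR d) * passing d (d + ε * β d) t|) volume 0 T :=
            (hsum fun d _ =>
              intervalIntegrable_mul_passing intervalIntegrable_const d (d + ε * β d)).abs
          refine this.congr fun t ht => ?_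
          rw [uIoc_of_le hT] at ht
          exact congrArg abs (hε t (Ioc_subset_Icc_self ht) id).symm
        · exact hsum hpi
        · have := hε t (Ioo_subset_Icc_self ht) id
          simp only [id] at this
          rw [this]
          refine (Finset.abs_sum_le_sum_abs _ _).trans (Finset.sum_le_sum fun d _ => ?_)
          rw [abs_mul]
    _ = ∑ d ∈ hfin.toFinset, |cL d - cR d| * ∫ t in (0)..T, |passing d (d + ε * β d) t| := by
        rw [intervalIntegral.integral_finsetSum hpi]
        simp only [intervalIntegral.integral_const_mul]
    _ ≤ ∑ d ∈ hfin.toFinset, |cL d - cR d| * |β d| * |ε| := by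
        refine Finset.sum_le_sum fun d _ => ?_
        rw [mul_assoc]
        refine mul_le_mul_of_nonneg_left ((integral_abs_passing_le hT _ _).trans ?_) (abs_nonneg _)
        rw [add_sub_cancel_left, abs_mul, mul_comm]
    _ = _ := by rw [Finset.sum_mul]

theorem integral_mul_passing {k : ℝ → ℝ} {d e : ℝ} (hT : 0 ≤ T)
    (hk : IntervalIntegrable k volume 0 T) (hd : d ∈ Icc 0 T) (he : e ∈ Icc 0 T) :
    ∫ t in (0)..T, k t * passing d e t = ∫ t in d..e, k t := by
  have hsub : ∀ a b, a ∈ Icc 0 T → b ∈ Icc 0 T → IntervalIntegrable k volume a b := fun a b ha hb =>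
    hk.mono_set (by rw [uIcc_of_le hT]; exact uIcc_subset_Icc ha hb)
  have h0 : (0 : ℝ) ∈ Icc 0 T := ⟨le_rfl, hT⟩
  have hTT : T ∈ Icc 0 T := ⟨hT, le_rfl⟩
  have key : ∀ e ∈ Icc 0 T, (IntervalIntegrable (fun t => k t * if t < e then 1 else 0) volume 0 T) ∧
      ∫ t in (0)..T, k t * (if t < e then 1 else 0) = ∫ t in (0)..e, k t := by
    intro e he
    have hI : IntervalIntegrable (fun t => k t * if t < e then 1 else 0) volume 0 T := by
      have := (intervalIntegrable_mul_passing hk (-1) e)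
      refine this.congr fun t ht => ?_
      rw [uIoc_of_le hT] at ht
      simp [passing, (show ¬ t < -1 by linarith [ht.1])]
    refine ⟨hI, ?_⟩
    rw [← intervalIntegral.integral_add_adjacent_intervals (b := e)
      (hI.mono_set (by rw [uIcc_of_le hT]; exact uIcc_subset_Icc h0 he))
      (hI.mono_set (by rw [uIcc_of_le hT]; exact uIcc_subset_Icc he hTT))]
    have h1 : ∫ t in (0)..e, k t * (if t < e then 1 else 0) = ∫ t in (0)..e, k t := by
      refine intervalIntegral.integral_congr_ae ?_
      filter_upwards [compl_mem_ae_iff.2 (measure_singleton e)] with t ht hte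
      rw [uIoc_of_le he.1] at hte
      rw [if_pos (lt_of_le_of_ne hte.2 ht), mul_one]
    have h2 : ∫ t in e..T, k t * (if t < e then 1 else 0) = 0 := by
      refine (intervalIntegral.integral_congr (g := fun _ => 0) fun t ht => ?_).trans (by simp)
      rw [uIcc_of_le he.2] at ht
      simp [ht.1.not_gt]
    rw [h1, h2, add_zero]
  simp only [passing, mul_sub]
  rw [intervalIntegral.integral_sub (key e he).1 (key d hd).1, (key e he).2, (key d hd).2,
    intervalIntegral.integral_interval_sub_left (hsub 0 e h0 he) (hsub 0 d h0 hd)]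

theorem hasDerivAt_integral_mul_passing {k : ℝ → ℝ} {d b : ℝ} (hd : d ∈ Ioo 0 T)
    (hk : IntervalIntegrable k volume 0 T) (hc : ContinuousOn k (Ioo 0 T)) :
    HasDerivAt (fun ε => ∫ t in (0)..T, k t * passing d (d + ε * b) t) (k d * b) 0 := by
  have hT : 0 ≤ T := hd.1.le.trans hd.2.le
  have hcont : ContinuousAt (fun ε : ℝ => d + ε * b) 0 := by fun_prop
  have hev : ∀ᶠ ε in 𝓝 (0 : ℝ), d + ε * b ∈ Ioo 0 T :=
    hcont.eventually (isOpen_Ioo.mem_nhds (by simpa using hd))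
  have h1 : HasDerivAt (fun x => ∫ t in d..x, k t) (k d) (d + 0 * b) := by
    rw [zero_mul, add_zero]
    exact intervalIntegral.integral_hasDerivAt_right (by simp)
      (hc.stronglyMeasurableAtFilter isOpen_Ioo d hd) (hc.continuousAt (isOpen_Ioo.mem_nhds hd))
  have h2 : HasDerivAt (fun ε : ℝ => d + ε * b) b 0 := by
    simpa using ((hasDerivAt_id (0 : ℝ)).mul_const b).const_add d
  refine (h1.comp 0 h2).congr_of_eventuallyEq ?_
  filter_upwards [hev] with ε hε
  exact integral_mul_passing hT hk (Ioo_subset_Icc_self hd) (Ioo_subset_Icc_self hε)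

/-- Each moving jump contributes the integral of the difference of the two integrands over the swept
interval, whose derivative comes from the fundamental theorem of calculus. A moving jump at `T`
would count for one sign of its displacement only, which `hend` excludes. -/
theorem hasDerivAt_integral_family {G : ℝ → ℝ → ℝ} (hT : 0 < T)
    (h0 : ∃ c, ∀ᶠ p : ℝ × ℝ in 𝓝 (0, 0), 0 ≤ p.2 → F p.1 p.2 = c)
    (hJ : ∀ t ∈ Ioc 0 T, JumpAt F t (cL t) (cR t) (β t)) (hend : cL T = cR T ∨ β T = 0)
    (hG : ∀ᶠ ε in 𝓝 (0 : ℝ), IntervalIntegrable (fun t => G (F ε t) t) volume 0 T)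
    (hGi : ∀ r, IntervalIntegrable (G r) volume 0 T) (hGc : ∀ r, ContinuousOn (G r) (Ioo 0 T))
    {K : Finset ℝ} (hK : ∀ t, t ∈ K ↔ t ∈ Ioo 0 T ∧ cL t ≠ cR t) :
    HasDerivAt (fun ε => ∫ t in (0)..T, G (F ε t) t)
      (∑ d ∈ K, (G (cL d) d - G (cR d) d) * β d) 0 := by
  have hfin := finite_jumps h0 hJ
  set K' := hfin.toFinset with hK'
  have hKK : K ⊆ K' := fun t ht => by
    exact hfin.mem_toFinset.2 ⟨Ioo_subset_Ioc_self ((hK t).1 ht).1, ((hK t).1 ht).2⟩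
  have hβ : ∀ d ∈ K', d ∉ K → β d = 0 := by
    intro d hd hdK
    obtain ⟨hd1, hd2⟩ := hfin.mem_toFinset.1 hd
    rcases hd1.2.eq_or_lt with rfl | hlt
    · exact hend.resolve_left hd2
    · exact absurd ((hK d).2 ⟨⟨hd1.1, hlt⟩, hd2⟩) hdK
  rw [Finset.sum_subset hKK fun d hd hdK => by rw [hβ d hd hdK, mul_zero]]
  have h1 : HasDerivAt (fun ε => ∑ d ∈ K',
      ∫ t in (0)..T, (G (cL d) t - G (cR d) t) * passing d (d + ε * β d) t)
      (∑ d ∈ K', (G (cL d) d - G (cR d) d) * β d) 0 := by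
    refine HasDerivAt.fun_sum fun d hd => ?_
    by_cases hdK : d ∈ K
    · exact hasDerivAt_integral_mul_passing ((hK d).1 hdK).1 ((hGi _).sub (hGi _))
        ((hGc _).sub (hGc _))
    · simp only [hβ d hd hdK, mul_zero, add_zero, passing_self, intervalIntegral.integral_zero]
      exact hasDerivAt_const _ _
  refine (h1.add_const (∫ t in (0)..T, G (F 0 t) t)).congr_of_eventuallyEq ?_
  filter_upwards [hG, eventually_sub_eq_sum h0 hJ (K := K') fun t => hfin.mem_toFinset] with ε h2 h3
  rw [← sub_eq_iff_eq_add, ← intervalIntegral.integral_sub h2 hG.self_of_nhds,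
    ← intervalIntegral.integral_finsetSum fun d _ =>
      intervalIntegrable_mul_passing ((hGi _).sub (hGi _)) _ _]
  refine intervalIntegral.integral_congr fun t ht => ?_
  rw [uIcc_of_le hT.le] at ht
  exact h3 t ht fun r => G r t

/-- For almost every time the difference quotients are eventually equal to `η t`, though not
uniformly in time; the Lipschitz bound in `ε` gives the dominating function `|α| * M`. -/
theorem hasDerivAt_integral_of_shiftAt {α η : ℝ → ℝ} {q : ℝ → ℝ → ℝ} (hT : 0 ≤ T)
    (hα : IntegrableOn α (Ioo 0 T)) (hq : ∀ᶠ ε in 𝓝 (0 : ℝ), ContinuousOn (q ε) (Icc 0 T))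
    (hM : ∃ M, ∀ᶠ ε in 𝓝 (0 : ℝ), ∀ t ∈ Icc 0 T, |q ε t - q 0 t| ≤ M * |ε|)
    (hη : ∀ᵐ t ∂volume.restrict (Ioo 0 T), ShiftAt q t (η t)) :
    HasDerivAt (fun ε => ∫ t in (0)..T, α t * q ε t) (∫ t in (0)..T, α t * η t) 0 := by
  obtain ⟨M, hM⟩ := hM
  have hαi : IntervalIntegrable α volume 0 T := by
    rwa [intervalIntegrable_iff_integrableOn_Ioo_of_le hT]
  have hint : ∀ᶠ ε in 𝓝 (0 : ℝ), IntervalIntegrable (fun t => α t * q ε t) volume 0 T := by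
    filter_upwards [hq] with ε hε
    exact hαi.mul_continuousOn (by rwa [uIcc_of_le hT])
  rw [hasDerivAt_iff_tendsto_slope]
  have hlim : Tendsto (fun ε => ∫ t in Ioo 0 T, α t * ((q ε t - q 0 t) / ε)) (𝓝[≠] 0)
      (𝓝 (∫ t in Ioo 0 T, α t * η t)) := by
    refine tendsto_integral_filter_of_dominated_convergence (fun t => |α t| * M) ?_ ?_ ?_ ?_
    · filter_upwards [nhdsWithin_le_nhds hq] with ε hε
      refine hα.aestronglyMeasurable.mul ?_
      exact (((hε.sub hq.self_of_nhds).div_const ε).mono Ioo_subset_Icc_self).aestronglyMeasurable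
        measurableSet_Ioo
    · filter_upwards [nhdsWithin_le_nhds hM, self_mem_nhdsWithin] with ε hε hne
      filter_upwards [ae_restrict_mem measurableSet_Ioo] with t ht
      rw [Real.norm_eq_abs, abs_mul, abs_div]
      refine mul_le_mul_of_nonneg_left ?_ (abs_nonneg _)
      rw [div_le_iff₀ (abs_pos.2 hne)]
      exact hε t (Ioo_subset_Icc_self ht)
    · exact hα.abs.mul_const M
    · filter_upwards [hη] with t ht
      refine tendsto_const_nhds.congr' ?_
      filter_upwards [nhdsWithin_le_nhds ht, self_mem_nhdsWithin] with ε hε hne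
      rw [hε, add_sub_cancel_left, mul_div_cancel_left₀ _ hne]
  rw [intervalIntegral.integral_of_le hT, integral_Ioc_eq_integral_Ioo]
  refine hlim.congr' ?_
  filter_upwards [nhdsWithin_le_nhds hint] with ε hε
  rw [slope_def_field, ← intervalIntegral.integral_sub hε hint.self_of_nhds, sub_zero,
    ← intervalIntegral.integral_div, intervalIntegral.integral_of_le hT,
    integral_Ioc_eq_integral_Ioo]
  congr 1
  ext t
  ring

end Variation

/-! ### The derivative of the cost -/

section Cost

variable {C : Chain} {D : InitialData} {T : ℝ} {W : Weights}

theorem intervalIntegrable_tracking {a p F : ℝ → ℝ} (ha : Continuous a) (hp : Continuous p)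
    (hT : 0 ≤ T) (hF : IntervalIntegrable F volume 0 T) {M : ℝ} (hM : ∀ t ∈ Icc 0 T, |F t| ≤ M) :
    IntervalIntegrable (fun t => a t * (F t - p t) ^ 2) volume 0 T := by
  have h1 : IntervalIntegrable (fun t => F t - p t) volume 0 T :=
    hF.sub (hp.intervalIntegrable 0 T)
  have h2 : IntervalIntegrable (fun t => (F t - p t) * F t) volume 0 T := by
    rw [intervalIntegrable_iff] at h1 hF ⊢
    refine Integrable.mul_bdd (c := M) h1 hF.aestronglyMeasurable ?_
    filter_upwards [ae_restrict_mem measurableSet_uIoc] with t ht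
    rw [uIoc_of_le hT] at ht
    exact hM t (Ioc_subset_Icc_self ht)
  have h3 := (h2.sub (h1.mul_continuousOn hp.continuousOn)).continuousOn_mul ha.continuousOn
  refine h3.congr fun t _ => ?_
  ring

/-- The cost in terms of the canonical solution. -/
theorem cost_eq (hD : D.Admissible C) (hT : 0 < T) {u : ℝ → ℝ} (hu : IsStepControl C T u)
    {S : State} (hS : IsSolution C D T u S) {a p : ℝ → ℝ} (ha : EqOn W.α₂ a (Ioo 0 T))
    (hp : EqOn W.ψ p (Ioo 0 T)) :
    cost C T W S = (∑ j ∈ Finset.Icc 2 C.P, ∫ t in (0)..T, W.α₁ t * queueAt C D u j t)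
      + ∫ t in (0)..T, a t * (outflow C D u C.P t - p t) ^ 2 := by
  have hP : C.P ∈ Finset.Icc 1 C.P := Finset.mem_Icc.2 ⟨C.one_le_P, le_rfl⟩
  rw [cost]
  congr 1
  · refine Finset.sum_congr rfl fun j hj => intervalIntegral.integral_congr fun t ht => ?_
    rw [uIcc_of_le hT.le] at ht
    have hj' := Finset.mem_Icc.1 hj
    simp only [(hS.eq_canonical hD hT hu (Finset.mem_Icc.2 ⟨by omega, hj'.2⟩)).2.2 hj'.1 t ht]
  · simp only [intervalIntegral.integral_of_le hT.le, integral_Ioc_eq_integral_Ioo]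
    refine integral_congr_ae ?_
    filter_upwards [(hS.eq_canonical hD hT hu hP).1, ae_restrict_mem measurableSet_Ioo]
      with t ht htI
    rw [ht, mul_div_cancel₀ _ (C.v_pos hP).ne', ha htI, hp htI]

variable {u : ℝ → ℝ → ℝ} {S : State} {n : ℕ} {x : ℝ → ℝ}

/-- At the final time a wave from the initial data does not move, and a wave that entered later is
excluded by `NoSimultaneous.outlet`. -/
theorem WaveShift.jump_outlet (hD : D.Admissible C) (hT : 0 < T)
    (hu : ∀ᶠ ε in 𝓝 (0 : ℝ), IsStepControl C T (u ε)) (hS : IsSolution C D T (u 0) S)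
    (hN : NoSimultaneous C T (u 0) S) (hx : WaveShift C D T u C.P x) {t : ℝ} (ht : t ∈ Ioc 0 T) :
    ∃ cL cR β, JumpAt (fun ε => outflow C D (u ε) C.P) t cL cR β ∧
      (cL ≠ cR → x (t - C.procTime C.P) = C.v C.P * β) ∧ (t = T → cL = cR ∨ β = 0) := by
  have hP : C.P ∈ Finset.Icc 1 C.P := Finset.mem_Icc.2 ⟨C.one_le_P, le_rfl⟩
  have hp := C.procTime_pos _ hP
  rcases ht.2.lt_or_eq with hlt | rfl
  · obtain ⟨cL, cR, β, h1, h2⟩ := hx.jump_outflow hD hP (t := t) ⟨ht.1, by linarith⟩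
    exact ⟨cL, cR, β, h1, h2, fun h => absurd h hlt.ne⟩
  · rcases le_or_gt (t - C.procTime C.P) 0 with h0 | h0
    · obtain ⟨cL, cR, hJ⟩ := jumpAt_entry_of_nonpos hD hP (g := fun ε => inflow C D (u ε) C.P)
        hx.initial (s := t - C.procTime C.P) ⟨by linarith [ht.1], h0⟩
      exact ⟨cL, cR, 0, hJ.comp_sub, fun _ => by rw [hx.nonpos _ h0, mul_zero],
        fun _ => Or.inr rfl⟩
    · have hs : t - C.procTime C.P ∈ Ioo 0 t := ⟨h0, by linarith⟩
      obtain ⟨cL, cR, β, hJ, hxβ⟩ := hx.jump _ hs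
      obtain ⟨h1, h2⟩ := hJ.ess_eq (g := id) hs (hS.eq_canonical hD hT hu.self_of_nhds hP).2.1
      exact ⟨cL, cR, β, (hJ.entry h0).comp_sub, hxβ,
        fun _ => Or.inl (h1.symm.trans ((hN.outlet h0).trans h2))⟩

theorem WaveShift.abs_queueAt_sub_le (hD : D.Admissible C) (hT : 0 < T)
    (hu : ∀ᶠ ε in 𝓝 (0 : ℝ), IsStepControl C T (u ε)) (hn : n ∈ Finset.Icc 1 C.P)
    (hx : WaveShift C D T u n x) : ∃ M, ∀ᶠ ε in 𝓝 (0 : ℝ), ∀ t ∈ Icc 0 T,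
      |queueAt C D (u ε) (n + 1) t - queueAt C D (u 0) (n + 1) t| ≤ M * |ε| := by
  have hp := C.procTime_pos n hn
  have hJ : ∀ t, ∃ cL cR β, t ∈ Ioc 0 T → JumpAt (fun ε => outflow C D (u ε) n) t cL cR β := by
    intro t
    by_cases ht : t ∈ Ioc 0 T
    · obtain ⟨cL, cR, β, h, -⟩ := hx.jump_outflow hD hn (t := t) ⟨ht.1, by linarith [ht.2]⟩
      exact ⟨cL, cR, β, fun _ => h⟩
    · exact ⟨0, 0, 0, fun h => absurd h ht⟩
  choose cL cR β hJ using hJ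
  obtain ⟨M, hM⟩ := exists_integral_abs_sub_le (F := fun ε => outflow C D (u ε) n) hT.le
    (outflow_initial hD hn u) hJ
  refine ⟨2 * M, ?_⟩
  filter_upwards [hM, hu] with ε h1 h2 t ht
  rw [mul_assoc]
  exact (abs_queueLen_sub_le ((stepOn_outflow hD hT h2 hn).intervalIntegrable hT.le)
    ((stepOn_outflow hD hT hu.self_of_nhds hn).intervalIntegrable hT.le) ht).trans
    (mul_le_mul_of_nonneg_left h1 zero_le_two)

theorem WaveShift.hasDerivAt_queueCost (hD : D.Admissible C) (hT : 0 < T)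
    (hu : ∀ᶠ ε in 𝓝 (0 : ℝ), IsStepControl C T (u ε)) (hn : n ∈ Finset.Icc 1 C.P)
    (hx : WaveShift C D T u n x) {α h : ℝ → ℝ} (hα : IntegrableOn α (Ioo 0 T))
    (hh : ∀ t ∈ Ioo 0 T, ∀ᶠ s in 𝓝[≠] t,
      ShiftAt (fun ε => queueAt C D (u ε) (n + 1)) s (h s)) :
    HasDerivAt (fun ε => ∫ t in (0)..T, α t * queueAt C D (u ε) (n + 1) t)
      (∫ t in (0)..T, α t * h t) 0 :=
  hasDerivAt_integral_of_shiftAt (q := fun ε => queueAt C D (u ε) (n + 1)) hT.le hα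
    (hu.mono fun _ hε => continuousOn_queueLen (stepOn_outflow hD hT hε hn) hT.le)
    (hx.abs_queueAt_sub_le hD hT hu hn) (ae_Ioo_of_eventually hh)

theorem WaveShift.outletCost (hD : D.Admissible C) (hT : 0 < T)
    (hu : ∀ᶠ ε in 𝓝 (0 : ℝ), IsStepControl C T (u ε)) (hS : IsSolution C D T (u 0) S)
    (hN : NoSimultaneous C T (u 0) S) (hx : WaveShift C D T u C.P x) {a p : ℝ → ℝ}
    (ha : Continuous a) (hp : Continuous p) (haW : EqOn W.α₂ a (Ioo 0 T))
    (hpW : EqOn W.ψ p (Ioo 0 T)) {Z : Shifts} (hZ : Z.ξ C.P = x) :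
    (outletTimes C T S).Finite ∧
      HasDerivAt (fun ε => ∫ t in (0)..T, a t * (outflow C D (u ε) C.P t - p t) ^ 2)
        (Y₂ C T W S Z) 0 := by
  have hP : C.P ∈ Finset.Icc 1 C.P := Finset.mem_Icc.2 ⟨C.one_le_P, le_rfl⟩
  have hv := C.v_pos hP
  have hJ : ∀ t, ∃ cL cR β, t ∈ Ioc 0 T → JumpAt (fun ε => outflow C D (u ε) C.P) t cL cR β ∧
      (cL ≠ cR → x (t - C.procTime C.P) = C.v C.P * β) ∧ (t = T → cL = cR ∨ β = 0) := by
    intro t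
    by_cases ht : t ∈ Ioc 0 T
    · obtain ⟨cL, cR, β, h⟩ := hx.jump_outlet hD hT hu hS hN ht
      exact ⟨cL, cR, β, fun _ => h⟩
    · exact ⟨0, 0, 0, fun h => absurd h ht⟩
  choose cL cR β hJ using hJ
  have h0 := outflow_initial hD hP u
  have hJ' : ∀ t ∈ Ioc 0 T, JumpAt (fun ε => outflow C D (u ε) C.P) t (cL t) (cR t) (β t) :=
    fun t ht => (hJ t ht).1
  have hess : ∀ t ∈ Ioo 0 T, essLeft (S.outDensity C C.P) t = cL t / C.v C.P ∧
      essRight (S.outDensity C C.P) t = cR t / C.v C.P := fun t ht =>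
    ess_outDensity hD hT hu hS hP ht (hJ' t (Ioo_subset_Ioc_self ht))
  have hout : ∀ t, t ∈ outletTimes C T S ↔ t ∈ Ioo 0 T ∧ cL t ≠ cR t := by
    intro t
    refine and_congr_right fun ht => not_congr ?_
    rw [(hess t ht).1, (hess t ht).2, div_left_inj' hv.ne']
  have hfin : (outletTimes C T S).Finite := (finite_jumps h0 hJ').subset fun t ht =>
    ⟨Ioo_subset_Ioc_self ((hout t).1 ht).1, ((hout t).1 ht).2⟩
  refine ⟨hfin, ?_⟩
  -- With flux `v * ρ` and shift `v * β`, the difference of squares factors into the sum of the two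
  -- states minus `2 * ψ`, times their difference.
  have hval : Y₂ C T W S Z = ∑ d ∈ hfin.toFinset,
      (a d * (cL d - p d) ^ 2 - a d * (cR d - p d) ^ 2) * β d := by
    rw [Y₂, finsum_mem_eq_finite_toFinset_sum _ hfin]
    refine Finset.sum_congr rfl fun d hd => ?_
    obtain ⟨hd1, hd2⟩ := (hout d).1 (hfin.mem_toFinset.1 hd)
    simp only [outletTerm, (hess d hd1).1, (hess d hd1).2, hZ,
      (hJ d (Ioo_subset_Ioc_self hd1)).2.1 hd2, haW hd1, hpW hd1]
    field_simp
    ring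
  rw [hval]
  refine hasDerivAt_integral_family (F := fun ε => outflow C D (u ε) C.P)
    (G := fun r t => a t * (r - p t) ^ 2) hT h0 hJ' ((hJ T ⟨hT, le_rfl⟩).2.2 rfl) ?_ ?_ ?_
    fun t => by rw [hfin.mem_toFinset, hout]
  · filter_upwards [hu] with ε hε
    refine intervalIntegrable_tracking ha hp hT.le
      ((stepOn_outflow hD hT hε hP).intervalIntegrable hT.le) (M := C.μ C.P) fun t ht => ?_
    have := outflow_mem hD hT hε hP ht
    rw [abs_of_nonneg this.1]
    exact this.2
  · exact fun r => Continuous.intervalIntegrable (by fun_prop) 0 T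
  · exact fun r => Continuous.continuousOn (by fun_prop)

end Cost


end SupplyChain

end

/-! ### Assembly of the proposition -/

theorem mainTheorem4 (C : SupplyChain.Chain) (D : SupplyChain.InitialData) (T : ℝ)
    (W : SupplyChain.Weights) (hT : 0 < T) (hD : D.Admissible C) (hW : W.Admissible T)
    {δ : ℕ} (τ : Fin δ → ℝ) (c : Fin (δ + 1) → ℝ) (hu : SupplyChain.IsPCControl C T τ c)
    (ξ : Fin δ → ℝ) :
    (∀ᶠ ε in 𝓝 (0 : ℝ), ∃ S : SupplyChain.State,
      SupplyChain.IsSolution C D T (SupplyChain.shiftedControl T τ c ξ ε) S) ∧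
    ∀ S : ℝ → SupplyChain.State,
      (∀ᶠ ε in 𝓝 (0 : ℝ),
        SupplyChain.IsSolution C D T (SupplyChain.shiftedControl T τ c ξ ε) (S ε)) →
      SupplyChain.NoSimultaneous C T (SupplyChain.pcControl T τ c) (S 0) →
      (SupplyChain.outletTimes C T (S 0)).Finite ∧
      (∃ Z : SupplyChain.Shifts, SupplyChain.IsTangentEvolution C T τ ξ (S 0) Z) ∧
      ∀ Z : SupplyChain.Shifts, SupplyChain.IsTangentEvolution C T τ ξ (S 0) Z →
        HasDerivAt (fun ε => SupplyChain.cost C T W (S ε))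
          (SupplyChain.Y₁ C T W Z + SupplyChain.Y₂ C T W (S 0) Z) 0 := by
  have hsc := SupplyChain.eventually_isStepControl (ξ := ξ) hT hu
  refine ⟨hsc.mono fun ε hε => ⟨_, SupplyChain.isSolution_canonicalState hD hT hε⟩,
    fun S hS hN => ?_⟩
  have hS0 := hS.self_of_nhds
  rw [← SupplyChain.shiftedControl_zero (ξ := ξ)] at hN
  have hP : C.P ∈ Finset.Icc 1 C.P := Finset.mem_Icc.2 ⟨C.one_le_P, le_rfl⟩
  obtain ⟨K₁, h₁⟩ := hW.α₂_lipschitz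
  obtain ⟨K₂, h₂⟩ := hW.ψ_lipschitz
  -- The weights are controlled on the open interval only; Lipschitz extensions to the line are
  -- continuous everywhere and do not change the integrals.
  obtain ⟨a, ha, haW⟩ := h₁.extend_real
  obtain ⟨p, hp, hpW⟩ := h₂.extend_real
  have hout : ∀ Z : SupplyChain.Shifts, SupplyChain.IsTangentEvolution C T τ ξ (S 0) Z → _ :=
    fun Z hZ => (hZ.waveShift hD hT hu hS0 hN hP).outletCost (W := W) hD hT hsc hS0 hN
      ha.continuous hp.continuous haW hpW rfl
  have hex := SupplyChain.exists_isTangentEvolution hD hT hu hS0 hN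
  -- Finiteness of the outlet times does not involve shifts, so it may be read off from any tangent
  -- evolution.
  refine ⟨(hout _ hex.choose_spec).1, hex, fun Z hZ => ?_⟩
  have hsum : HasDerivAt (fun ε => ∑ j ∈ Finset.Icc 2 C.P, ∫ t in (0)..T,
      W.α₁ t * SupplyChain.queueAt C D (SupplyChain.shiftedControl T τ c ξ ε) j t)
      (SupplyChain.Y₁ C T W Z) 0 := by
    refine HasDerivAt.fun_sum fun j hj => ?_
    have hjt := fun t => hZ.shiftAt hD hT hu hS0 hN hj (t := t)
    obtain ⟨hj2, hjP⟩ := Finset.mem_Icc.1 hj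
    obtain ⟨n, rfl⟩ := Nat.exists_eq_add_of_le' (one_le_two.trans hj2)
    have hn : n ∈ Finset.Icc 1 C.P := Finset.mem_Icc.2 ⟨by omega, by omega⟩
    exact (hZ.waveShift hD hT hu hS0 hN hn).hasDerivAt_queueCost hD hT hsc hn hW.α₁_integrable hjt
  refine (hsum.add (hout Z hZ).2).congr_of_eventuallyEq ?_
  filter_upwards [hsc, hS] with ε h1 h2
  exact SupplyChain.cost_eq hD hT h1 h2 haW hpW
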